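/- Let $F$ be a free group of finite rank $n \ge 2$. A free splitting of $F$ is a minimal simplicial action of $F$ on a simplicial tree $T$ (with the CW topology) which is not a point, such that every edge stabilizer is trivial; two free splittings are conjugate if there is an $F$-equivariant homeomorphism between them. A natural vertex of $T$ is a vertex of valence at least $3$. A natural edge of $T$ is an arc in $T$ whose endpoints are natural vertices and none of whose interior points is a natural vertex. $T$ is a $k$-edge free splitting if it has exactly $k$ $F$-orbits of natural edges. A natural subgraph $\sigma \subset T$ is a (possibly empty) union of natural edges. A collapse map $S \to T$ between free splittings is an $F$-equivariant simplicial map that is injective over the interior of each edge of $T$; its collapsed subgraph is the union of the edges of $S$ that it maps to vertices. For an $F$-invariant natural subgraph $\sigma \subsetneq T$, let $T_\sigma$ be the free splitting obtained from $T$ by collapsing to a point each component of $\sigma$; it is characterized, up to simplicial conjugacy, as the target of a collapse map from $T$ with collapsed subgraph $\sigma$. Let $\mathcal F_0(T)$ be the set of conjugacy classes of $1$-edge free splittings of the form $T_\sigma$. One says that $T$ expands to $S$, or that $S$ collapses to $T$, if there is a function $S \to T$ which is a collapse map with respect to some $F$-invariant simplicial subdivisions of the natural cell structures on $S$ and $T$.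 The following hold. (1) For every free splitting $T$ and every $F$-invariant natural subgraph $\sigma \subsetneq T$, the free splitting $T_\sigma$ exists; and for any two such subgraphs $\sigma_1, \sigma_2 \subsetneq T$, we have $\sigma_1 = \sigma_2$ if and only if $T_{\sigma_1}$ and $T_{\sigma_2}$ are conjugate. (2) For any two free splittings $T, T'$ of $F$, we have $\mathcal F_0(T) = \mathcal F_0(T')$ if and only if $T$ and $T'$ are conjugate. (3) There exists a simplicial complex $\mathcal{FS}(F)$ whose simplices $\langle T\rangle$ are in one-to-one correspondence with the conjugacy classes of free splittings $T$ of $F$, the $K$-simplices corresponding exactly to the $(K+1)$-edge free splittings for each $K \ge 0$, such that for any free splittings $T, U$ of $F$ we have $\langle U\rangle \subset \langle T\rangle$ if and only if $U$ expands to $T$. -/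

import Mathlib

universe u w

noncomputable section

open scoped Classical in
/-- The point with barycentric coordinates `1 - t` at the vertex `a` and `t` at the vertex `b`. -/
def edgePoint {V : Type w} (a b : V) (t : unitInterval) : V → ℝ :=
  fun v => (1 - (t : ℝ)) * (if v = a then 1 else 0) + (t : ℝ) * (if v = b then 1 else 0)

/-- The underlying space of a graph regarded as a 1-dimensional simplicial complex: a point is a
system of barycentric coordinates that is supported on a single vertex or on a single edge. -/
@[ext]
structure GraphRealization {V : Type w} (G : SimpleGraph V) where
  coord : V → ℝ
  mem_cell : ∃ a b : V, (a = b ∨ G.Adj a b) ∧ ∃ t : unitInterval, coord = edgePoint a b t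

namespace GraphRealization

/-- The characteristic map of the closed cell (a vertex if `a = b`, an edge otherwise) on `a, b`. -/
def cellMap {V : Type w} {G : SimpleGraph V} {a b : V} (h : a = b ∨ G.Adj a b)
    (t : unitInterval) : GraphRealization G :=
  ⟨edgePoint a b t, a, b, h, t, rfl⟩

/-- The CW topology: a set is open iff its preimage in every closed cell is open. -/
instance {V : Type w} (G : SimpleGraph V) : TopologicalSpace (GraphRealization G) :=
  ⨆ p : {p : V × V // p.1 = p.2 ∨ G.Adj p.1 p.2},
    TopologicalSpace.coinduced (cellMap p.2) inferInstance

end GraphRealization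

/-- A free splitting of the group `F`: a minimal simplicial action of `F` on a simplicial tree
that is not a point, with trivial edge stabilizers. The stabilizer of an edge is its setwise
stabilizer, and a subtree is given by its (nonempty, connected) set of vertices. -/
structure FreeSplitting (F : Type u) [Group F] where
  V : Type w
  graph : SimpleGraph V
  isTree : graph.IsTree
  nontrivial : Nontrivial V
  action : MulAction F V
  smul_adj : ∀ (g : F) {a b : V}, graph.Adj a b → graph.Adj (g • a) (g • b)
  minimal : ∀ W : Set V, (graph.induce W).Connected →
    (∀ (g : F), ∀ v ∈ W, g • v ∈ W) → W = Set.univ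
  edge_stabilizer : ∀ (g : F) (a b : V), graph.Adj a b → s(g • a, g • b) = s(a, b) → g = 1

namespace FreeSplitting

attribute [instance] FreeSplitting.action

variable {F : Type u} [Group F]

/-! ### Conjugacy -/

/-- The tree of a free splitting as a topological space. -/
abbrev Space (T : FreeSplitting.{u, w} F) : Type w := GraphRealization T.graph

theorem edgePoint_smul (T : FreeSplitting.{u, w} F) (g : F) (a b : T.V) (t : unitInterval) :
    (fun v => edgePoint a b t (g⁻¹ • v)) = edgePoint (g • a) (g • b) t := by
  funext v
  have h (c : T.V) : g⁻¹ • v = c ↔ v = g • c := inv_smul_eq_iff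
  classical
  simp only [edgePoint, h]

/-- The action of `F` on the tree, extended from the vertices by barycentric coordinates. -/
instance (T : FreeSplitting.{u, w} F) : SMul F T.Space where
  smul g x := ⟨fun v => x.coord (g⁻¹ • v), by
    obtain ⟨a, b, h, t, ht⟩ := x.mem_cell
    refine ⟨g • a, g • b, h.imp (fun e => by rw [e]) (T.smul_adj g), t, ?_⟩
    rw [ht, edgePoint_smul]⟩

/-- Two free splittings are conjugate if there is an equivariant homeomorphism between them. -/
def Conjugate (S T : FreeSplitting.{u, w} F) : Prop :=
  ∃ h : S.Space ≃ₜ T.Space, ∀ (g : F) (x : S.Space), h (g • x) = g • h x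

theorem Conjugate.refl (S : FreeSplitting.{u, w} F) : S.Conjugate S :=
  ⟨Homeomorph.refl _, fun _ _ => rfl⟩

theorem Conjugate.symm {S T : FreeSplitting.{u, w} F} (h : S.Conjugate T) : T.Conjugate S := by
  obtain ⟨f, hf⟩ := h
  refine ⟨f.symm, fun g x => ?_⟩
  rw [Homeomorph.symm_apply_eq, hf, Homeomorph.apply_symm_apply]

theorem Conjugate.trans {R S T : FreeSplitting.{u, w} F} (h : R.Conjugate S)
    (k : S.Conjugate T) : R.Conjugate T := by
  obtain ⟨f, hf⟩ := h
  obtain ⟨e, he⟩ := k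
  exact ⟨f.trans e, fun g x => by simp [hf, he]⟩

instance conjugacySetoid (F : Type u) [Group F] : Setoid (FreeSplitting.{u, w} F) where
  r := Conjugate
  iseqv := ⟨Conjugate.refl, Conjugate.symm, Conjugate.trans⟩

/-- Conjugacy classes of free splittings. -/
def ConjClass (F : Type u) [Group F] : Type (max u (w + 1)) :=
  Quotient (conjugacySetoid.{u, w} F)

/-- The conjugacy class of a free splitting. -/
def conjClass (T : FreeSplitting.{u, w} F) : ConjClass.{u, w} F :=
  Quotient.mk (conjugacySetoid.{u, w} F) T

/-! ### The natural cell structure -/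

/-- A natural vertex is a vertex of valence at least `3`. -/
def IsNaturalVertex (T : FreeSplitting.{u, w} F) (v : T.V) : Prop :=
  3 ≤ (T.graph.neighborSet v).encard

/-- A natural edge, as the set of edgelets (edges of the given simplicial structure) in it: an arc
whose endpoints are natural vertices and which contains no other natural vertices. -/
def IsNaturalEdge (T : FreeSplitting.{u, w} F) (η : Set (Sym2 T.V)) : Prop :=
  ∃ (a b : T.V) (p : T.graph.Walk a b), a ≠ b ∧ p.IsPath ∧
    T.IsNaturalVertex a ∧ T.IsNaturalVertex b ∧
    (∀ v ∈ p.support, T.IsNaturalVertex v → v = a ∨ v = b) ∧ η = {e | e ∈ p.edges}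

/-- The translate of a set of edgelets by a group element. -/
def translate (T : FreeSplitting.{u, w} F) (g : F) (η : Set (Sym2 T.V)) : Set (Sym2 T.V) :=
  Sym2.map (fun v => g • v) '' η

theorem translate_one (T : FreeSplitting.{u, w} F) (η : Set (Sym2 T.V)) :
    T.translate 1 η = η := by
  simp [translate]

theorem translate_mul (T : FreeSplitting.{u, w} F) (g h : F) (η : Set (Sym2 T.V)) :
    T.translate (g * h) η = T.translate g (T.translate h η) := by
  simp only [translate, Set.image_image, Sym2.map_map]
  congr 1
  funext e
  congr 1
  funext v
  simp [mul_smul]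

/-- Two natural edges are equivalent if they lie in the same orbit. -/
def naturalEdgeSetoid (T : FreeSplitting.{u, w} F) :
    Setoid {η : Set (Sym2 T.V) // T.IsNaturalEdge η} where
  r η θ := ∃ g : F, T.translate g η.1 = θ.1
  iseqv := by
    refine ⟨fun η => ⟨1, T.translate_one _⟩, ?_, ?_⟩
    · rintro η θ ⟨g, hg⟩
      exact ⟨g⁻¹, by rw [← hg, ← translate_mul, inv_mul_cancel, translate_one]⟩
    · rintro η θ κ ⟨g, hg⟩ ⟨h, hh⟩
      exact ⟨h * g, by rw [translate_mul, hg, hh]⟩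

/-- The number of orbits of natural edges; `T` is a `k`-edge free splitting if this is `k`. -/
def numNaturalEdges (T : FreeSplitting.{u, w} F) : ℕ∞ :=
  ENat.card (Quotient T.naturalEdgeSetoid)

/-- An `F`-invariant natural subgraph, as its set of edgelets: an invariant set of edgelets which
is a union of natural edges. -/
def IsNaturalSubgraph (T : FreeSplitting.{u, w} F) (σ : Set (Sym2 T.V)) : Prop :=
  (∀ g : F, T.translate g σ = σ) ∧ ∀ e ∈ σ, ∃ η, T.IsNaturalEdge η ∧ e ∈ η ∧ η ⊆ σ

/-! ### Collapse maps -/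

/-- A collapse map from `S` to `T`, given on vertices: an equivariant simplicial map that is
injective over the interior of each edgelet of `T`. -/
structure IsCollapseMap (S T : FreeSplitting.{u, w} F) (f : S.V → T.V) : Prop where
  equivariant : ∀ (g : F) (v : S.V), f (g • v) = g • f v
  simplicial : ∀ a b : S.V, S.graph.Adj a b → f a = f b ∨ T.graph.Adj (f a) (f b)
  injective_over : ∀ e₁ ∈ S.graph.edgeSet, ∀ e₂ ∈ S.graph.edgeSet,
    Sym2.map f e₁ ∈ T.graph.edgeSet → Sym2.map f e₁ = Sym2.map f e₂ → e₁ = e₂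

/-- The collapsed subgraph of a simplicial map: the edgelets that are mapped to a vertex. -/
def collapsedSubgraph (S T : FreeSplitting.{u, w} F) (f : S.V → T.V) : Set (Sym2 S.V) :=
  {e | e ∈ S.graph.edgeSet ∧ (Sym2.map f e).IsDiag}

/-- `U` is obtained from `T` by collapsing `σ`, that is, `U` is (a copy of) `T_σ`: there is a
collapse map from `T` to `U` with collapsed subgraph `σ`. -/
def IsCollapseAlong (T : FreeSplitting.{u, w} F) (σ : Set (Sym2 T.V))
    (U : FreeSplitting.{u, w} F) : Prop :=
  ∃ f : T.V → U.V, IsCollapseMap T U f ∧ collapsedSubgraph T U f = σ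

/-- `S` collapses to `T`, equivalently `T` expands to `S`: there is a function from `S` to `T`
which is a collapse map with respect to some invariant simplicial structures on (that is, some
simplicial subdivisions of the natural cell structures of) the `F`-spaces `S` and `T`. An invariant
simplicial structure on the `F`-space `S` is a free splitting `S'` with a conjugacy to `S`. -/
def CollapsesTo (S T : FreeSplitting.{u, w} F) : Prop :=
  ∃ S' T' : FreeSplitting.{u, w} F, S'.Conjugate S ∧ T'.Conjugate T ∧
    ∃ f : S'.V → T'.V, IsCollapseMap S' T' f

/-- The set of conjugacy classes of `(k+1)`-edge free splittings of the form `T_σ`, where `σ` is a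
natural subgraph of `T`. -/
def collapseClasses (T : FreeSplitting.{u, w} F) (k : ℕ) : Set (ConjClass.{u, w} F) :=
  {c | ∃ (σ : Set (Sym2 T.V)) (U : FreeSplitting.{u, w} F), T.IsNaturalSubgraph σ ∧
    T.IsCollapseAlong σ U ∧ U.numNaturalEdges = (k + 1 : ℕ) ∧ U.conjClass = c}

end FreeSplitting

end

/-! A free splitting can be encoded by subsets of the group. A nontrivial element g has in the tree
T a least nonempty invariant convex set, `charSet`: its axis or its fixed point. Each of the two
half-trees at an edge determines a side, the set of nontrivial g whose characteristic set lies in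
it. The pair of sides is the wall of the oriented edge. Walls are pairs of subsets of F, so walls in
different trees can be compared. Up to conjugation and exchange of sides they form the set
`T.classes`. The whole theorem follows once T ↦ `T.classes` is known to be a complete conjugacy
invariant that turns collapsing into inclusion of sets.

Four facts carry this. Walls and natural edges: suitably oriented, two edges have the same wall
exactly if they lie in one natural edge (`isNaturalEdge_iff`). A wall does not change across a
vertex of valence two, because F has no involutions. It changes at a natural vertex v, because some
characteristic set passes through v and avoids a prescribed direction (`exists_charSet_turn`). Hence
orbits of natural edges are counted by wall classes (`numNaturalEdges_eq`). Collapses: collapse maps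
carry invariant convex sets forward and backward, so the classes of T_σ are those of the edges
outside σ (`IsCollapseMap.classes_eq`), and every nonempty subset of `T.classes` arises
(`exists_classes_eq`). Invariance: sides can be described by connected invariant sets on one side of
an interior point of the edge, so equivariant homeomorphisms preserve the classes
(`Conjugate.classes_eq`). Rigidity: three directions at a natural vertex give three characteristic
sets that meet only there. Walls detect whether characteristic sets are disjoint, so in a second
tree with the same classes these sets meet pairwise, and Helly's theorem provides the corresponding
vertex (`exists_corresponds`). The resulting isomorphism of the graphs of natural vertices is
realized by a conjugacy (`conjugate_of_classes_eq`).

The free splitting complex then has wall classes as vertices and the finite sets `T.classes` as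
simplices. Freeness of F enters only through three properties: F is torsion-free, it is not
commutative (so the tree is not a line and has natural vertices), and it is finitely generated (so
there are finitely many classes). -/

namespace SimpleGraph

variable {V : Type w} {G : SimpleGraph V}

/-! ### Geodesic segments and half-trees -/

/-- The set of vertices on geodesics from `x` to `y`. -/
def seg (G : SimpleGraph V) (x y : V) : Set V := {z | G.dist x z + G.dist z y = G.dist x y}

/-- The vertices closer to `q` than to `p`: one side of the edge `pq` of a tree. -/
def half (G : SimpleGraph V) (p q : V) : Set V := {x | G.dist q x < G.dist p x}

/-- A set of vertices that contains the segments between its points. -/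
def SegConvex (G : SimpleGraph V) (A : Set V) : Prop := ∀ x ∈ A, ∀ y ∈ A, G.seg x y ⊆ A

theorem mem_seg {x y z : V} : z ∈ G.seg x y ↔ G.dist x z + G.dist z y = G.dist x y := Iff.rfl

theorem mem_half {p q x : V} : x ∈ G.half p q ↔ G.dist q x < G.dist p x := Iff.rfl

theorem left_mem_seg (x y : V) : x ∈ G.seg x y := by simp [mem_seg]

theorem right_mem_seg (x y : V) : y ∈ G.seg x y := by simp [mem_seg]

theorem seg_comm (x y : V) : G.seg x y = G.seg y x := by
  ext z
  simp only [mem_seg, G.dist_comm (u := x), G.dist_comm (v := y)]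
  constructor <;> intro h <;> rw [add_comm] <;> simpa [G.dist_comm] using h

theorem SegConvex.iInter {ι : Sort*} {A : ι → Set V} (hA : ∀ i, G.SegConvex (A i)) :
    G.SegConvex (⋂ i, A i) := fun x hx y hy z hz => by
  simp only [Set.mem_iInter] at *
  exact fun i => hA i x (hx i) y (hy i) hz

/-! ### Segments in connected graphs -/

namespace Connected

variable (hG : G.Connected)
include hG

theorem mem_seg_self {x z : V} : z ∈ G.seg x x ↔ z = x := by
  rw [mem_seg, dist_self]
  constructor
  · intro h
    exact hG.dist_eq_zero_iff.1 (by omega)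
  · rintro rfl
    simp

theorem seg_trans {x y z t : V} (hz : z ∈ G.seg x y) (ht : t ∈ G.seg x z) :
    t ∈ G.seg x y ∧ z ∈ G.seg t y := by
  simp only [mem_seg] at *
  have h1 := hG.dist_triangle (u := t) (v := z) (w := y)
  have h2 := hG.dist_triangle (u := x) (v := t) (w := y)
  constructor <;> omega

theorem seg_trans' {x y z t : V} (hz : z ∈ G.seg x y) (ht : t ∈ G.seg z y) :
    t ∈ G.seg x y ∧ z ∈ G.seg x t := by
  rw [seg_comm] at hz ht
  have := hG.seg_trans hz ht
  rwa [seg_comm, G.seg_comm x t]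

theorem seg_antisymm {x y z : V} (hz : z ∈ G.seg x y) (hy : y ∈ G.seg x z) : y = z := by
  rw [mem_seg] at *
  have : G.dist z y = 0 := by
    have := G.dist_comm (u := y) (v := z)
    omega
  exact (hG.dist_eq_zero_iff.1 this).symm

theorem exists_step {x y : V} (h : x ≠ y) : ∃ x', G.Adj x x' ∧ x' ∈ G.seg x y := by
  obtain ⟨p, hp⟩ := hG.exists_walk_length_eq_dist x y
  cases p with
  | nil => exact absurd rfl h
  | @cons _ x' _ ha p =>
    refine ⟨x', ha, ?_⟩
    rw [mem_seg, dist_eq_one_iff_adj.2 ha]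
    have h1 := dist_le p
    have h2 := hG.dist_triangle (u := x) (v := x') (w := y)
    rw [dist_eq_one_iff_adj.2 ha] at h2
    rw [Walk.length_cons] at hp
    omega

/-- Induction along a convex set. -/
theorem convex_induction {A : Set V} (hA : G.SegConvex A) {P : V → Prop} {q : V} (hq : q ∈ A)
    (hP : P q) (step : ∀ r ∈ A, ∀ s ∈ A, G.Adj r s → P r → P s) : ∀ z ∈ A, P z := by
  suffices ∀ n, ∀ z ∈ A, G.dist q z = n → P z from fun z hz => this _ z hz rfl
  intro n
  induction n with
  | zero =>
    intro z _ h
    rwa [← hG.dist_eq_zero_iff.1 h]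
  | succ n ih =>
    intro z hz h
    have hne : z ≠ q := by
      rintro rfl
      simp at h
    obtain ⟨r, har, hr⟩ := hG.exists_step hne
    have hrA := hA z hz q hq hr
    refine step r hrA z hz har.symm (ih r hrA ?_)
    rw [mem_seg, dist_eq_one_iff_adj.2 har, G.dist_comm (u := z), h, G.dist_comm] at hr
    omega

theorem induction_adj {P : V → Prop} {q : V} (hP : P q) (step : ∀ r s, G.Adj r s → P r → P s)
    (z : V) : P z :=
  hG.convex_induction (A := Set.univ) (fun _ _ _ _ _ _ => trivial) trivial hP
    (fun r _ s _ => step r s) z trivial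

theorem exists_crossing {A : Set V} (hA : G.SegConvex A) {P : V → Prop} {x y : V} (hx : x ∈ A)
    (hy : y ∈ A) (hPx : P x) (hPy : ¬ P y) : ∃ r ∈ A, ∃ s ∈ A, G.Adj r s ∧ P r ∧ ¬ P s := by
  by_contra! h
  exact hPy (hG.convex_induction hA hx hPx (fun r hr s hs => h r hr s hs) y hy)

theorem connected_induce {A : Set V} (hA : G.SegConvex A) (hne : A.Nonempty) :
    (G.induce A).Connected := by
  obtain ⟨q, hq⟩ := hne
  rw [connected_iff_exists_forall_reachable]
  refine ⟨⟨q, hq⟩, fun ⟨z, hz⟩ => ?_⟩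
  exact hG.convex_induction hA (P := fun z => ∀ hz : z ∈ A, (G.induce A).Reachable ⟨q, hq⟩ ⟨z, hz⟩)
    hq (fun _ => Reachable.refl _)
    (fun r hr s hs hrs ih _ => (ih hr).trans (Adj.reachable hrs)) z hz hz

omit hG in
/-- The point of a set closest to a given vertex. -/
theorem exists_closest {A : Set V} (hne : A.Nonempty) (x : V) :
    ∃ y ∈ A, ∀ z ∈ A, G.dist x y ≤ G.dist x z := by
  obtain ⟨y, hy, h⟩ := exists_minimalFor_of_wellFoundedLT (· ∈ A) (G.dist x) hne
  refine ⟨y, hy, fun z hz => ?_⟩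
  by_contra hlt
  exact hlt (h hz (by omega))

end Connected

/-! ### Medians, gates and half-trees in trees -/

namespace IsTree

variable (hG : G.IsTree)
include hG

/-- Geodesics from x to z and from z to y concatenate to a path, and a tree has only one path from x
to y; every walk contains it after removal of loops. -/
theorem seg_subset_support {x y z : V} (p : G.Walk x y) (hz : z ∈ G.seg x y) : z ∈ p.support := by
  classical
  obtain ⟨q₁, h₁⟩ := hG.connected.exists_walk_length_eq_dist x z
  obtain ⟨q₂, h₂⟩ := hG.connected.exists_walk_length_eq_dist z y
  have hq : (q₁.append q₂).IsPath := by
    apply Walk.isPath_of_length_eq_dist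
    rw [Walk.length_append, h₁, h₂, hz]
  have := congrArg Subtype.val ((hG.isAcyclic.subsingleton_path x y).elim ⟨_, hq⟩ p.toPath)
  apply p.support_bypass_subset_support
  change z ∈ (p.toPath : G.Walk x y).support
  rw [← this]
  simp

theorem mem_support_iff {x y z : V} {p : G.Walk x y} (hp : p.IsPath) :
    z ∈ p.support ↔ z ∈ G.seg x y := by
  classical
  refine ⟨fun hz => ?_, hG.seg_subset_support p⟩
  obtain ⟨q, hq⟩ := hG.connected.exists_walk_length_eq_dist x y
  have hqp := q.isPath_of_length_eq_dist hq
  have : p = q := congrArg Subtype.val ((hG.isAcyclic.subsingleton_path x y).elim ⟨p, hp⟩ ⟨q, hqp⟩)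
  subst this
  have h := congrArg Walk.length (p.take_spec hz)
  rw [Walk.length_append] at h
  have h1 := dist_le (p.takeUntil z hz)
  have h2 := dist_le (p.dropUntil z hz)
  have h3 := hG.connected.dist_triangle (u := x) (v := z) (w := y)
  rw [mem_seg]
  omega

/-- The paths from x to t and from t to y form a walk from x to y, which must cover the segment.
Most case distinctions about three points of a tree come down to this. -/
theorem seg_split {x y z : V} (hz : z ∈ G.seg x y) (t : V) : z ∈ G.seg x t ∨ z ∈ G.seg t y := by
  obtain ⟨p, hp, -⟩ := hG.existsUnique_path x t
  obtain ⟨q, hq, -⟩ := hG.existsUnique_path t y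
  have := hG.seg_subset_support (p.append q) hz
  rw [Walk.mem_support_append_iff] at this
  exact this.imp (hG.mem_support_iff hp).1 (hG.mem_support_iff hq).1

theorem eq_of_mem_seg {x y z t : V} (hz : z ∈ G.seg x y) (ht : t ∈ G.seg x y)
    (h : G.dist x z = G.dist x t) : z = t := by
  rw [← hG.connected.dist_eq_zero_iff]
  have hc := G.dist_comm (u := z) (v := t)
  rcases hG.seg_split ht z with h' | h' <;> rw [mem_seg] at * <;> omega

theorem segConvex_seg (x y : V) : G.SegConvex (G.seg x y) := by
  intro a ha b hb z hz
  have hc := hG.connected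
  rcases hG.seg_split hz x with h | h
  · rw [seg_comm] at h
    exact (hc.seg_trans ha h).1
  · exact (hc.seg_trans hb h).1

/-- The median is the point m of the segment from x to y closest to z. A step from m along this
segment increases the distance to z by one, so m lies between z and every point of the segment. -/
theorem exists_median (x y z : V) : ∃ m, m ∈ G.seg x y ∧ m ∈ G.seg y z ∧ m ∈ G.seg x z := by
  have hc := hG.connected
  obtain ⟨m, hm, hmin⟩ := Connected.exists_closest (G := G) (A := G.seg x y) ⟨x, left_mem_seg _ _⟩ z
  have key : ∀ t ∈ G.seg x y, m ∈ G.seg z t := by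
    intro t ht
    by_contra hn
    rcases eq_or_ne m t with rfl | hmt
    · exact hn (right_mem_seg _ _)
    obtain ⟨n, hadj, hn'⟩ := hc.exists_step hmt
    have hnA := hG.segConvex_seg x y m hm t ht hn'
    have h1 := hmin n hnA
    rcases hG.dist_eq_dist_add_one_of_adj z hadj with h2 | h2
    · omega
    have hmn : m ∈ G.seg z n := by rw [mem_seg, dist_eq_one_iff_adj.2 hadj]; omega
    rcases hG.seg_split hmn t with h | h
    · exact hn h
    · have := hc.seg_antisymm (x := t) (by rwa [seg_comm] at hn') h
      exact hadj.ne this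
  refine ⟨m, hm, ?_, ?_⟩
  · rw [seg_comm]; exact key y (right_mem_seg _ _)
  · rw [seg_comm]; exact key x (left_mem_seg _ _)

/-- The gate property of the closest point of a convex set. -/
theorem gate {A : Set V} (hA : G.SegConvex A) {x y : V} (hy : y ∈ A)
    (hmin : ∀ z ∈ A, G.dist x y ≤ G.dist x z) {z : V} (hz : z ∈ A) : y ∈ G.seg x z := by
  obtain ⟨m, h1, h2, h3⟩ := hG.exists_median x y z
  have := hmin m (hA y hy z hz h2)
  have h1' := h1
  rw [mem_seg] at h1
  have : m = y := hG.connected.dist_eq_zero_iff.1 (by omega)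
  rwa [← this]

/-- Helly's theorem for three convex sets. -/
theorem helly {A B C : Set V} (hA : G.SegConvex A) (hB : G.SegConvex B) (hC : G.SegConvex C)
    (hAB : (A ∩ B).Nonempty) (hBC : (B ∩ C).Nonempty) (hAC : (A ∩ C).Nonempty) :
    (A ∩ B ∩ C).Nonempty := by
  obtain ⟨x, hxA, hxB⟩ := hAB
  obtain ⟨y, hyB, hyC⟩ := hBC
  obtain ⟨z, hzA, hzC⟩ := hAC
  obtain ⟨m, h1, h2, h3⟩ := hG.exists_median x y z
  exact ⟨m, ⟨hA x hxA z hzA h3, hB x hxB y hyB h1⟩, hC y hyC z hzC h2⟩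

theorem mem_half_iff_seg {p q x : V} (h : G.Adj p q) : x ∈ G.half p q ↔ q ∈ G.seg p x := by
  rw [mem_half, mem_seg, dist_eq_one_iff_adj.2 h]
  have h1 := hG.dist_eq_dist_add_one_of_adj x h
  rw [G.dist_comm (u := x), G.dist_comm (u := x)] at h1
  omega

theorem mem_half_iff_not_seg {p q x : V} (h : G.Adj p q) : x ∈ G.half p q ↔ p ∉ G.seg q x := by
  rw [mem_half, mem_seg, dist_eq_one_iff_adj.2 h.symm]
  have h1 := hG.dist_eq_dist_add_one_of_adj x h
  rw [G.dist_comm (u := x), G.dist_comm (u := x)] at h1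
  omega

theorem not_mem_half {p q x : V} (h : G.Adj p q) : x ∉ G.half p q ↔ x ∈ G.half q p := by
  rw [mem_half, mem_half]
  have h1 := hG.dist_eq_dist_add_one_of_adj x h
  rw [G.dist_comm (u := x), G.dist_comm (u := x)] at h1
  omega

omit hG in
theorem left_not_mem_half (p q : V) : p ∉ G.half p q := by simp [mem_half]

theorem right_mem_half {p q : V} (h : G.Adj p q) : q ∈ G.half p q := by
  rw [hG.mem_half_iff_seg h]
  exact right_mem_seg _ _

theorem segConvex_half {p q : V} (h : G.Adj p q) : G.SegConvex (G.half p q) := by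
  intro x hx y hy z hz
  rw [hG.mem_half_iff_not_seg h] at *
  intro hp
  rcases hG.seg_split hz q with h1 | h1
  · rw [seg_comm] at h1
    exact hx (hG.connected.seg_trans h1 hp).1
  · exact hy (hG.connected.seg_trans h1 hp).1

/-- The endpoints of an edge lie on every segment across it. -/
theorem mem_seg_of_half {p q x y : V} (h : G.Adj p q) (hx : x ∈ G.half q p)
    (hy : y ∈ G.half p q) : p ∈ G.seg x y ∧ q ∈ G.seg x y := by
  have hqx : q ∉ G.seg p x := by rwa [hG.mem_half_iff_not_seg h.symm] at hx
  have hq := (hG.mem_half_iff_seg h).1 hy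
  have hpy : p ∉ G.seg q y := by rwa [hG.mem_half_iff_not_seg h] at hy
  have hp := (hG.mem_half_iff_seg h.symm).1 hx
  constructor
  · rcases hG.seg_split hp y with h1 | h1
    · exact absurd h1 hpy
    · rwa [seg_comm]
  · rcases hG.seg_split hq x with h1 | h1
    · exact absurd h1 hqx
    · exact h1

/-- A segment joining the two sides of pq contains both p and q, and the segment of an edge consists
of its two endpoints. -/
theorem crossing_unique {p q x y : V} (h : G.Adj p q) (hxy : G.Adj x y) (hx : x ∈ G.half q p)
    (hy : y ∈ G.half p q) : x = p ∧ y = q := by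
  obtain ⟨h1, h2⟩ := hG.mem_seg_of_half h hx hy
  have hcases : ∀ z ∈ G.seg x y, z = x ∨ z = y := by
    intro z hz
    rw [mem_seg, dist_eq_one_iff_adj.2 hxy] at hz
    rcases Nat.eq_zero_or_pos (G.dist x z) with h0 | h0
    · exact Or.inl (hG.connected.dist_eq_zero_iff.1 h0).symm
    · exact Or.inr (hG.connected.dist_eq_zero_iff.1 (by omega))
  constructor
  · rcases hcases p h1 with e | e
    · exact e.symm
    · rw [← e] at hy
      exact absurd hy (left_not_mem_half p q)
  · rcases hcases q h2 with e | e
    · rw [← e] at hx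
      exact absurd hx (left_not_mem_half q p)
    · exact e.symm

/-- Disjoint convex sets are separated by an edge. -/
theorem exists_separating {A B : Set V} (hA : G.SegConvex A) (hB : G.SegConvex B)
    (hAne : A.Nonempty) (hBne : B.Nonempty) (hAB : Disjoint A B) :
    ∃ p q, G.Adj p q ∧ A ⊆ G.half q p ∧ B ⊆ G.half p q := by
  have hc := hG.connected
  obtain ⟨a, ha⟩ := hAne
  -- The bridge between A and B: b is the gate of a in B, p is the gate of b in A, and the
  -- separating edge is the first one from p towards b.
  obtain ⟨b, hb, hbmin⟩ := Connected.exists_closest (G := G) hBne a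
  obtain ⟨p, hp, hpmin⟩ := Connected.exists_closest (G := G) ⟨a, ha⟩ b
  have hpb : p ≠ b := fun e => Set.disjoint_left.1 hAB hp (e ▸ hb)
  obtain ⟨q, hadj, hq⟩ := hc.exists_step hpb
  refine ⟨p, q, hadj, fun x hx => ?_, fun y hy => ?_⟩
  · have h1 := hG.gate hA hp hpmin hx
    rw [hG.mem_half_iff_seg hadj.symm]
    rw [seg_comm] at hq
    exact (hc.seg_trans h1 hq).2
  · have h1 := hG.gate hB hb hbmin hy
    have h2 := hG.gate hA hp hpmin ha
    rw [hG.mem_half_iff_seg hadj]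
    rw [seg_comm] at h2
    have h3 := hc.seg_trans' h2 hq
    rcases eq_or_ne p y with rfl | hne
    · exact absurd hy (Set.disjoint_left.1 hAB hp)
    have h4 := (hc.seg_trans h1 h2).2
    exact (hc.seg_trans h4 hq).1

/-- A point off the segment is separated from it by an edge. Thus segments are recovered from
half-trees, which are what collapse maps and equalities of walls respect. -/
theorem mem_seg_iff_half {x y z : V} :
    z ∈ G.seg x y ↔ ∀ p q, G.Adj p q → x ∈ G.half p q → y ∈ G.half p q → z ∈ G.half p q := by
  refine ⟨fun h p q hpq hx hy => hG.segConvex_half hpq x hx y hy h, fun h => ?_⟩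
  by_contra hz
  obtain ⟨p, q, hpq, h1, h2⟩ := hG.exists_separating (A := {z}) (B := G.seg x y) (by
      rintro a rfl b rfl t ht
      exact (hG.connected.mem_seg_self).1 ht) (hG.segConvex_seg x y) ⟨z, rfl⟩
      ⟨x, left_mem_seg _ _⟩ (by simpa using hz)
  have h3 := h p q hpq (h2 (left_mem_seg _ _)) (h2 (right_mem_seg _ _))
  rw [Set.singleton_subset_iff] at h1
  rw [← hG.not_mem_half hpq] at h1
  exact h1 h3

theorem exists_separating_edge {x y : V} (h : x ≠ y) :
    ∃ p q, G.Adj p q ∧ x ∈ G.half q p ∧ y ∈ G.half p q := by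
  have hs : ∀ z : V, G.SegConvex {z} := by
    rintro z a rfl b rfl t ht
    exact (hG.connected.mem_seg_self).1 ht
  obtain ⟨p, q, hpq, h1, h2⟩ := hG.exists_separating (hs x) (hs y) ⟨x, rfl⟩ ⟨y, rfl⟩ (by simpa)
  exact ⟨p, q, hpq, h1 rfl, h2 rfl⟩

/-- The component of the complement of `a` that contains the neighbour `b`. -/
theorem mem_half_of_not_mem_seg {a b y z : V} (h : G.Adj a b) (hy : y ∈ G.half a b)
    (hz : a ∉ G.seg y z) : z ∈ G.half a b := by
  by_contra hn
  rw [hG.not_mem_half h] at hn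
  have := (hG.mem_seg_of_half h hn hy).1
  rw [seg_comm] at this
  exact hz this

theorem exists_branch {a z : V} (h : z ≠ a) : ∃ b, G.Adj a b ∧ z ∈ G.half a b := by
  obtain ⟨b, hab, hb⟩ := hG.connected.exists_step h.symm
  exact ⟨b, hab, (hG.mem_half_iff_seg hab).2 hb⟩

theorem branch_unique {a b c z : V} (hb : G.Adj a b) (hc : G.Adj a c) (hzb : z ∈ G.half a b)
    (hzc : z ∈ G.half a c) : b = c := by
  rw [hG.mem_half_iff_seg hb] at hzb
  rw [hG.mem_half_iff_seg hc] at hzc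
  exact hG.eq_of_mem_seg hzb hzc (by rw [dist_eq_one_iff_adj.2 hb, dist_eq_one_iff_adj.2 hc])

theorem mem_seg_of_branch_ne {a b c y z : V} (hb : G.Adj a b) (hc : G.Adj a c) (hbc : b ≠ c)
    (hy : y ∈ G.half a b) (hz : z ∈ G.half a c) : a ∈ G.seg y z := by
  by_contra hn
  exact hbc (hG.branch_unique hb hc (hG.mem_half_of_not_mem_seg hb hy hn) hz)

theorem half_subset_of_branch {a b c : V} (hb : G.Adj a b) (hc : G.Adj a c) (hbc : b ≠ c) :
    G.half a c ⊆ G.half b a := by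
  intro z hz
  rw [← hG.not_mem_half hb]
  intro hzb
  exact hbc (hG.branch_unique hb hc hzb hz)

theorem segConvex_of_connected_induce {W : Set V} (hW : (G.induce W).Connected) :
    G.SegConvex W := by
  intro x hx y hy z hz
  obtain ⟨p⟩ := hW.preconnected ⟨x, hx⟩ ⟨y, hy⟩
  have := hG.seg_subset_support (p.map (Embedding.induce W).toHom) hz
  rw [Walk.support_map, List.mem_map] at this
  obtain ⟨t, -, rfl⟩ := this
  exact t.2

end IsTree

end SimpleGraph

namespace FreeSplitting

open SimpleGraph

variable {F : Type u} [Group F] (T : FreeSplitting.{u, w} F)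

/-! ### The action on the tree -/

theorem connected : T.graph.Connected := T.isTree.connected

theorem adj_smul_iff (g : F) {a b : T.V} : T.graph.Adj (g • a) (g • b) ↔ T.graph.Adj a b :=
  ⟨fun h => by simpa using T.smul_adj g⁻¹ h, T.smul_adj g⟩

theorem dist_smul (g : F) (x y : T.V) : T.graph.dist (g • x) (g • y) = T.graph.dist x y := by
  have key : ∀ (h : F) (a b : T.V), T.graph.dist (h • a) (h • b) ≤ T.graph.dist a b := by
    intro h a b
    obtain ⟨p, hp⟩ := T.connected.exists_walk_length_eq_dist a b
    let f : T.graph →g T.graph := ⟨fun v => h • v, fun hab => T.smul_adj h hab⟩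
    rw [← hp, ← Walk.length_map f]
    exact dist_le (p.map f)
  refine le_antisymm (key g x y) ?_
  simpa using key g⁻¹ (g • x) (g • y)

theorem smul_mem_seg (g : F) {x y z : T.V} :
    g • z ∈ T.graph.seg (g • x) (g • y) ↔ z ∈ T.graph.seg x y := by
  simp only [mem_seg, dist_smul]

theorem smul_mem_half (g : F) {p q x : T.V} :
    g • x ∈ T.graph.half (g • p) (g • q) ↔ x ∈ T.graph.half p q := by
  simp only [mem_half, dist_smul]

theorem smul_mem_half' (g : F) {p q x : T.V} :
    g • x ∈ T.graph.half p q ↔ x ∈ T.graph.half (g⁻¹ • p) (g⁻¹ • q) := by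
  rw [← T.smul_mem_half g⁻¹, inv_smul_smul]

theorem eq_one_of_adj {g : F} {a b : T.V} (hab : T.graph.Adj a b) (ha : g • a = a)
    (hb : g • b = b) : g = 1 :=
  T.edge_stabilizer g a b hab (by rw [ha, hb])

theorem eq_one_of_flip {g : F} {a b : T.V} (hab : T.graph.Adj a b) (ha : g • a = b)
    (hb : g • b = a) : g = 1 :=
  T.edge_stabilizer g a b hab (by rw [ha, hb, Sym2.eq_swap])

/-- An element fixing both ends of a segment fixes its first edge. -/
theorem eq_one_of_ne {g : F} {a b : T.V} (hab : a ≠ b) (ha : g • a = a) (hb : g • b = b) :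
    g = 1 := by
  obtain ⟨c, hac, hc⟩ := T.connected.exists_step hab
  refine T.eq_one_of_adj hac ha (T.isTree.eq_of_mem_seg ?_ hc ?_ : g • c = c)
  · have := (T.smul_mem_seg g).2 hc
    rwa [ha, hb] at this
  · nth_rw 1 [← ha]
    rw [dist_smul]

/-- Every half-tree meets every orbit. -/
theorem exists_smul_mem_half {p q : T.V} (hpq : T.graph.Adj p q) (v : T.V) :
    ∃ g : F, g • v ∈ T.graph.half p q := by
  by_contra! h
  -- W is the intersection of all translates of the opposite half-tree. It would be an invariant
  -- subtree that omits q, against minimality.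
  set W : Set T.V := ⋂ g : F, {x | g • x ∈ T.graph.half q p} with hW
  have hmem : ∀ x, x ∈ W ↔ ∀ g : F, g • x ∈ T.graph.half q p := fun x => by simp [hW]
  have hconv : T.graph.SegConvex W := by
    refine SegConvex.iInter fun g x hx y hy z hz => ?_
    exact T.isTree.segConvex_half hpq.symm _ hx _ hy ((T.smul_mem_seg g).2 hz)
  have hne : W.Nonempty := ⟨v, (hmem v).2 fun g => (T.isTree.not_mem_half hpq).1 (h g)⟩
  have := T.minimal W (T.connected.connected_induce hconv hne) (fun g x hx => by
    rw [hmem] at *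
    intro k
    rw [smul_smul]
    exact hx _)
  have hq : q ∈ W := this ▸ Set.mem_univ q
  have := (hmem q).1 hq 1
  rw [one_smul] at this
  exact IsTree.left_not_mem_half _ _ this

/-! ### Characteristic sets -/

/-- Nonempty convex sets that are invariant under `g`. -/
structure InvConvex (g : F) (A : Set T.V) : Prop where
  nonempty : A.Nonempty
  convex : T.graph.SegConvex A
  smul_mem : ∀ x, g • x ∈ A ↔ x ∈ A

/-- The intersection of all nonempty convex sets invariant under `g`: the axis of `g` if `g` is
hyperbolic, and the fixed point of `g` if `g` is elliptic. -/
def charSet (g : F) : Set T.V := {v | ∀ A, T.InvConvex g A → v ∈ A}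

variable {T}

theorem InvConvex.inv_smul_mem {g : F} {A : Set T.V} (hA : T.InvConvex g A) (x : T.V) :
    g⁻¹ • x ∈ A ↔ x ∈ A := by
  rw [← hA.smul_mem, smul_inv_smul]

theorem InvConvex.zpow_smul_mem {g : F} {A : Set T.V} (hA : T.InvConvex g A) (n : ℤ) (x : T.V) :
    g ^ n • x ∈ A ↔ x ∈ A := by
  induction n with
  | zero => simp
  | succ n ih => rw [add_comm, zpow_add, zpow_one, mul_smul, hA.smul_mem, ih]
  | pred n ih => rw [sub_eq_neg_add, zpow_add, zpow_neg_one, mul_smul, hA.inv_smul_mem, ih]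

theorem InvConvex.zpow {g : F} {A : Set T.V} (hA : T.InvConvex g A) (n : ℤ) :
    T.InvConvex (g ^ n) A :=
  ⟨hA.nonempty, hA.convex, hA.zpow_smul_mem n⟩

variable (T)

/-- If the gate of `x` in an invariant convex set is moved, it lies between `x` and `g • x`. -/
theorem gate_mem_seg {g : F} {A : Set T.V} (hA : T.InvConvex g A) {x y : T.V} (hy : y ∈ A)
    (hmin : ∀ z ∈ A, T.graph.dist x y ≤ T.graph.dist x z) (hgy : g • y ≠ y) :
    y ∈ T.graph.seg x (g • x) ∧ g • y ∈ T.graph.seg y (g • x) := by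
  have h1 : y ∈ T.graph.seg x (g • y) :=
    T.isTree.gate hA.convex hy hmin ((hA.smul_mem y).2 hy)
  have h2 : g • y ∈ T.graph.seg y (g • x) := by
    have := T.isTree.gate hA.convex hy hmin ((hA.inv_smul_mem y).2 hy)
    rw [← T.smul_mem_seg g, smul_inv_smul] at this
    rwa [seg_comm]
  refine ⟨?_, h2⟩
  rcases T.isTree.seg_split h1 (g • x) with h | h
  · exact h
  · exact absurd (T.connected.seg_antisymm (x := g • x) (by rwa [seg_comm] at h2)
      h).symm (fun e => hgy e)

/-- A vertex x of least displacement lies in every invariant convex set A. Otherwise consider its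
gate in A: if moved, it is moved strictly less than x; if fixed, then x is fixed as well and g fixes
two vertices. -/
theorem charSet_nonempty {g : F} (hg : g ≠ 1) : (T.charSet g).Nonempty := by
  have := T.nontrivial
  obtain ⟨x, -, hx⟩ := exists_minimalFor_of_wellFoundedLT (fun _ : T.V => True)
    (fun x => T.graph.dist x (g • x)) ⟨Classical.arbitrary _, trivial⟩
  have hx : ∀ z, T.graph.dist x (g • x) ≤ T.graph.dist z (g • z) := by
    intro z
    by_contra h
    exact h (hx trivial (le_of_not_ge h))
  refine ⟨x, fun A hA => ?_⟩
  obtain ⟨y, hy, hmin⟩ := Connected.exists_closest (G := T.graph) hA.nonempty x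
  by_contra hxA
  have hxy : x ≠ y := fun e => hxA (e ▸ hy)
  by_cases hgy : g • y = y
  · have := hx y
    rw [hgy, SimpleGraph.dist_self] at this
    have : x = g • x := T.connected.dist_eq_zero_iff.1 (by omega)
    exact hg (T.eq_one_of_ne hxy this.symm hgy)
  · obtain ⟨h1, h2⟩ := T.gate_mem_seg hA hy hmin hgy
    have h3 := hx y
    have h4 := T.connected.pos_dist_of_ne hxy
    rw [mem_seg] at h1 h2
    rw [dist_smul, T.graph.dist_comm (u := y) (v := x)] at h2
    omega

theorem invConvex_charSet {g : F} (hg : g ≠ 1) : T.InvConvex g (T.charSet g) where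
  nonempty := T.charSet_nonempty hg
  convex := fun x hx y hy _ hz A hA => hA.convex x (hx A hA) y (hy A hA) hz
  smul_mem := fun x => ⟨fun h A hA => (hA.smul_mem x).1 (h A hA),
    fun h A hA => (hA.smul_mem x).2 (h A hA)⟩

theorem segConvex_singleton (v : T.V) : T.graph.SegConvex {v} := by
  rintro a rfl b rfl t ht
  exact T.connected.mem_seg_self.1 ht

theorem charSet_subset_of_fixed {g : F} {v : T.V} (h : g • v = v) : T.charSet g ⊆ {v} := by
  refine fun x hx => hx _ ⟨⟨v, rfl⟩, T.segConvex_singleton v, fun y => ?_⟩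
  rw [Set.mem_singleton_iff, Set.mem_singleton_iff, smul_eq_iff_eq_inv_smul]
  have : g⁻¹ • v = v := by rw [inv_smul_eq_iff, h]
  rw [this]

theorem mem_charSet_of_fixed {g : F} (hg : g ≠ 1) {v : T.V} (h : g • v = v) :
    v ∈ T.charSet g := by
  obtain ⟨x, hx⟩ := T.charSet_nonempty hg
  have := T.charSet_subset_of_fixed h hx
  rw [Set.mem_singleton_iff] at this
  rwa [← this]

/-- Local criterion for lying on an axis: the orbit does not backtrack at a. If a were outside an
invariant convex set, then either its gate y would be fixed and a, g • a, g⁻¹ • a equidistant from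
y, or y would lie on both segments from a to g • a and to g⁻¹ • a. Both contradict that a is between
its two translates. -/
theorem mem_charSet_of_mem_seg {g : F} {a : T.V} (hga : g • a ≠ a)
    (h : a ∈ T.graph.seg (g⁻¹ • a) (g • a)) : a ∈ T.charSet g := by
  intro A hA
  obtain ⟨y, hy, hmin⟩ := Connected.exists_closest (G := T.graph) hA.nonempty a
  by_contra haA
  have hay : a ≠ y := fun e => haA (e ▸ hy)
  by_cases hgy : g • y = y
  · have hgy' : g⁻¹ • y = y := by rw [inv_smul_eq_iff, hgy]
    have h1 : T.graph.dist (g • a) y = T.graph.dist a y := by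
      rw [← T.dist_smul g a y, hgy]
    have h2 : T.graph.dist (g⁻¹ • a) y = T.graph.dist a y := by
      rw [← T.dist_smul g⁻¹ a y, hgy']
    have h3 : T.graph.dist (g⁻¹ • a) a = T.graph.dist a (g • a) := by
      rw [← T.dist_smul g, smul_inv_smul]
    have h4 := T.connected.pos_dist_of_ne hga.symm
    have h5 := T.graph.dist_comm (u := y) (v := a)
    have h6 := T.graph.dist_comm (u := y) (v := g • a)
    rcases T.isTree.seg_split h y with h' | h' <;> rw [mem_seg] at h' <;> omega
  · obtain ⟨h1, h2⟩ := T.gate_mem_seg hA hy hmin hgy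
    have h3 := (T.connected.seg_trans' h1 h2).1
    rw [← T.smul_mem_seg g⁻¹, inv_smul_smul, inv_smul_smul] at h3
    rcases T.isTree.seg_split h y with h' | h'
    · exact hay (T.connected.seg_antisymm h3 h')
    · rw [seg_comm] at h1 h'
      exact hay (T.connected.seg_antisymm h1 h')

/-! ### Axes through a given turn -/

variable {T}

/-- The ping-pong step: r carries everything outside the branch at b into the branch at c. -/
theorem smul_mem_half_of_turn {r : F} {a b c : T.V} (hb : T.graph.Adj a b) (hc : T.graph.Adj a c)
    (h1 : r⁻¹ • a ∈ T.graph.half a b) (h2 : r • a ∈ T.graph.half a c) {z : T.V}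
    (hz : z ∉ T.graph.half a b) : r • z ∈ T.graph.half a c := by
  have h3 : a ∈ T.graph.seg (r⁻¹ • a) z := by
    by_contra h
    exact hz (T.isTree.mem_half_of_not_mem_seg hb h1 h)
  rw [← T.smul_mem_seg r, smul_inv_smul] at h3
  refine T.isTree.mem_half_of_not_mem_seg hc h2 fun h => ?_
  have : a = r • a := T.connected.seg_antisymm (x := r • z)
    (by rwa [seg_comm] at h3) (by rwa [seg_comm] at h)
  rw [← this] at h2
  exact IsTree.left_not_mem_half _ _ h2

theorem pow_smul_mem_half_of_turn {r : F} {a b c : T.V} (hb : T.graph.Adj a b)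
    (hc : T.graph.Adj a c) (hbc : b ≠ c) (h1 : r⁻¹ • a ∈ T.graph.half a b)
    (h2 : r • a ∈ T.graph.half a c) (n : ℕ) : r ^ (n + 1) • a ∈ T.graph.half a c := by
  induction n with
  | zero => simpa using h2
  | succ n ih =>
    rw [pow_succ', mul_smul]
    exact smul_mem_half_of_turn hb hc h1 h2 fun h => hbc (T.isTree.branch_unique hb hc h ih)

theorem zpow_smul_of_turn {r : F} {a b c : T.V} (hb : T.graph.Adj a b)
    (hc : T.graph.Adj a c) (hbc : b ≠ c) (h1 : r⁻¹ • a ∈ T.graph.half a b)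
    (h2 : r • a ∈ T.graph.half a c) (n : ℤ) :
    r ^ n • a = a ∨ r ^ n • a ∈ T.graph.half a b ∨ r ^ n • a ∈ T.graph.half a c := by
  rcases n with n | n
  · rcases n with - | n
    · simp
    · rw [Int.ofNat_eq_natCast, zpow_natCast]
      exact Or.inr (Or.inr (pow_smul_mem_half_of_turn hb hc hbc h1 h2 n))
  · refine Or.inr (Or.inl ?_)
    have := pow_smul_mem_half_of_turn hc hb hbc.symm (r := r⁻¹) (by rwa [inv_inv]) h1 n
    rwa [zpow_negSucc, ← inv_pow]

/-- By ping-pong the orbit of a under powers of r stays in {a} and the branches at b and c. For any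
other branch, at d, the vertices whose translates by powers of r all avoid it form an invariant
convex set containing a, so the characteristic set avoids the branch too. -/
theorem charSet_of_turn {r : F} {a b c : T.V} (hb : T.graph.Adj a b)
    (hc : T.graph.Adj a c) (hbc : b ≠ c) (h1 : r⁻¹ • a ∈ T.graph.half a b)
    (h2 : r • a ∈ T.graph.half a c) :
    a ∈ T.charSet r ∧
      ∀ z ∈ T.charSet r, z = a ∨ z ∈ T.graph.half a b ∨ z ∈ T.graph.half a c := by
  constructor
  · refine T.mem_charSet_of_mem_seg (fun e => ?_) (T.isTree.mem_seg_of_branch_ne hb hc hbc h1 h2)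
    rw [e] at h2
    exact IsTree.left_not_mem_half _ _ h2
  · intro z hz
    rcases eq_or_ne z a with hza | hza
    · exact Or.inl hza
    obtain ⟨d, hd, hzd⟩ := T.isTree.exists_branch hza
    rcases eq_or_ne d b with rfl | hdb
    · exact Or.inr (Or.inl hzd)
    rcases eq_or_ne d c with rfl | hdc
    · exact Or.inr (Or.inr hzd)
    have hY : T.InvConvex r (⋂ n : ℤ, {z | r ^ n • z ∈ T.graph.half d a}) := by
      refine ⟨⟨a, ?_⟩, SegConvex.iInter fun n x hx y hy t ht => ?_, fun x => ?_⟩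
      · rw [Set.mem_iInter]
        intro n
        rw [Set.mem_ofPred_eq, ← T.isTree.not_mem_half hd]
        intro hmem
        rcases zpow_smul_of_turn hb hc hbc h1 h2 n with h | h | h
        · rw [h] at hmem
          exact IsTree.left_not_mem_half _ _ hmem
        · exact hdb (T.isTree.branch_unique hd hb hmem h)
        · exact hdc (T.isTree.branch_unique hd hc hmem h)
      · exact T.isTree.segConvex_half hd.symm _ hx _ hy ((T.smul_mem_seg _).2 ht)
      · simp only [Set.mem_iInter, Set.mem_ofPred_eq, smul_smul]
        constructor
        · intro h n
          have := h (n - 1)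
          rwa [← zpow_add_one, sub_add_cancel] at this
        · intro h n
          have := h (n + 1)
          rwa [zpow_add_one] at this
    have := Set.mem_iInter.1 (hz _ hY) 0
    rw [Set.mem_ofPred_eq, zpow_zero, one_smul, ← T.isTree.not_mem_half hd] at this
    exact absurd hzd this

variable (T)

/-- Choose k and l that carry a into the branches at b and c respectively with least displacement of
a, and take r = l * k⁻¹. Too much cancellation in this product would yield a shorter choice for one
of the branches. Triviality of the stabilizer excludes the remaining case k⁻¹ • a = l⁻¹ • a. -/
theorem exists_turn {a b c : T.V} (hb : T.graph.Adj a b) (hc : T.graph.Adj a c) (hbc : b ≠ c)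
    (hstab : ∀ g : F, g • a = a → g = 1) :
    ∃ r : F, r⁻¹ • a ∈ T.graph.half a b ∧ r • a ∈ T.graph.half a c := by
  have hmin : ∀ d, T.graph.Adj a d → ∃ k : F, k • a ∈ T.graph.half a d ∧
      ∀ l : F, l • a ∈ T.graph.half a d → T.graph.dist a (k • a) ≤ T.graph.dist a (l • a) := by
    intro d hd
    obtain ⟨k, hk, h⟩ := exists_minimalFor_of_wellFoundedLT
      (fun k : F => k • a ∈ T.graph.half a d) (fun k => T.graph.dist a (k • a))
      (T.exists_smul_mem_half hd a)
    refine ⟨k, hk, fun l hl => ?_⟩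
    by_contra hlt
    exact hlt (h hl (le_of_not_ge hlt))
  obtain ⟨k, hk, hkmin⟩ := hmin b hb
  obtain ⟨l, hl, hlmin⟩ := hmin c hc
  -- the product of `l` and `k⁻¹` turns, unless it shortens `k` or `l`
  have hdist : ∀ m : F, T.graph.dist (m⁻¹ • a) a = T.graph.dist a (m • a) := fun m => by
    rw [← T.dist_smul m, smul_inv_smul]
  have main : ∀ (d : T.V) (m m' : F), T.graph.Adj a d → m • a ∈ T.graph.half a d →
      m⁻¹ • a ∉ T.graph.seg (m'⁻¹ • a) a → (m * m'⁻¹) • a ∈ T.graph.half a d := by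
    intro d m m' hd hm hnot
    refine T.isTree.mem_half_of_not_mem_seg hd hm fun h => hnot ?_
    rw [seg_comm, ← T.smul_mem_seg m⁻¹, inv_smul_smul, mul_smul, inv_smul_smul] at h
    exact h
  have hpos : ∀ (d : T.V) (m : F), m • a ∈ T.graph.half a d → 0 < T.graph.dist a (m • a) := by
    intro d m hm
    refine T.connected.pos_dist_of_ne fun e => ?_
    rw [← e] at hm
    exact IsTree.left_not_mem_half _ _ hm
  have hne : k⁻¹ • a ≠ l⁻¹ • a := by
    intro e
    have : (l * k⁻¹) • a = a := by rw [mul_smul, e, smul_inv_smul]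
    have : l = k := by simpa [mul_inv_eq_one] using hstab _ this
    subst this
    exact hbc (T.isTree.branch_unique hb hc hk hl)
  -- at least one of the two products has the desired direction
  have short : ∀ (d : T.V) (m m' : F), T.graph.Adj a d → m • a ∈ T.graph.half a d →
      (∀ l : F, l • a ∈ T.graph.half a d → T.graph.dist a (m • a) ≤ T.graph.dist a (l • a)) →
      0 < T.graph.dist a (m' • a) → m⁻¹ • a ≠ m'⁻¹ • a →
      m'⁻¹ • a ∉ T.graph.seg (m⁻¹ • a) a := by
    intro d m m' hd hm hmmin hm' hmm h
    have h1 : m⁻¹ • a ∉ T.graph.seg (m'⁻¹ • a) a := by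
      intro h'
      rw [seg_comm] at h h'
      exact hmm (T.connected.seg_antisymm h h')
    have h2 := hmmin _ (main d m m' hd hm h1)
    have h3 : T.graph.dist a ((m * m'⁻¹) • a) = T.graph.dist (m⁻¹ • a) (m'⁻¹ • a) := by
      rw [← T.dist_smul m (m⁻¹ • a), smul_inv_smul, mul_smul]
    rw [mem_seg, hdist, hdist] at h
    omega
  refine ⟨l * k⁻¹, ?_, ?_⟩
  · rw [mul_inv_rev, inv_inv]
    exact main b k l hb hk (short c l k hc hl hlmin (hpos b k hk) hne.symm)
  · exact main c l k hc hl (short b k l hb hk hkmin (hpos c l hl) hne)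

/-- Through every turn there is a characteristic set that contains no other directions. -/
theorem exists_charSet_turn {a b c : T.V} (hb : T.graph.Adj a b) (hc : T.graph.Adj a c)
    (hbc : b ≠ c) : ∃ g : F, g ≠ 1 ∧ a ∈ T.charSet g ∧
      ∀ z ∈ T.charSet g, z = a ∨ z ∈ T.graph.half a b ∨ z ∈ T.graph.half a c := by
  by_cases hstab : ∀ g : F, g • a = a → g = 1
  · obtain ⟨r, h1, h2⟩ := T.exists_turn hb hc hbc hstab
    refine ⟨r, ?_, charSet_of_turn hb hc hbc h1 h2⟩
    rintro rfl
    rw [one_smul] at h2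
    exact IsTree.left_not_mem_half _ _ h2
  · push Not at hstab
    obtain ⟨g, hga, hg⟩ := hstab
    exact ⟨g, hg, T.mem_charSet_of_fixed hg hga,
      fun z hz => Or.inl (T.charSet_subset_of_fixed hga hz)⟩

end FreeSplitting

namespace FreeSplitting

open SimpleGraph

variable {F : Type u} [Group F] (T : FreeSplitting.{u, w} F)

/-! ### Sides and walls -/

/-- The nontrivial group elements whose characteristic set lies on the `q`-side of the edge
`pq`. -/
def side (p q : T.V) : Set F := {g | g ≠ 1 ∧ T.charSet g ⊆ T.graph.half p q}

/-- The sides of an oriented edge. -/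
def wall (p q : T.V) : Set F × Set F := (T.side q p, T.side p q)

/-- Minimality of the characteristic set makes any invariant convex set a sufficient witness. This
form can be transported along maps that need not match characteristic sets. -/
theorem mem_side_iff {p q : T.V} {g : F} :
    g ∈ T.side p q ↔ g ≠ 1 ∧ ∃ A, T.InvConvex g A ∧ A ⊆ T.graph.half p q :=
  ⟨fun h => ⟨h.1, _, T.invConvex_charSet h.1, h.2⟩,
    fun ⟨h, A, hA, hAs⟩ => ⟨h, fun _ hx => hAs (hx A hA)⟩⟩

theorem wall_swap {T' : FreeSplitting.{u, w} F} {p q : T.V} {p' q' : T'.V}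
    (h : T.wall p q = T'.wall p' q') : T.wall q p = T'.wall q' p' :=
  Prod.ext (congrArg Prod.snd h) (congrArg Prod.fst h)

/-- Characteristic sets are disjoint if and only if they are separated by an edge. -/
theorem disjoint_charSet_iff {g k : F} (hg : g ≠ 1) (hk : k ≠ 1) :
    Disjoint (T.charSet g) (T.charSet k) ↔
      ∃ p q, T.graph.Adj p q ∧ g ∈ T.side q p ∧ k ∈ T.side p q := by
  constructor
  · intro h
    obtain ⟨p, q, hpq, h1, h2⟩ := T.isTree.exists_separating (T.invConvex_charSet hg).convex
      (T.invConvex_charSet hk).convex (T.charSet_nonempty hg) (T.charSet_nonempty hk) h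
    exact ⟨p, q, hpq, ⟨hg, h1⟩, ⟨hk, h2⟩⟩
  · rintro ⟨p, q, hpq, h1, h2⟩
    rw [Set.disjoint_left]
    exact fun x hx hx' => (T.isTree.not_mem_half hpq).2 (h1.2 hx) (h2.2 hx')

variable {T} in
theorem InvConvex.conj {g : F} {A : Set T.V} (hA : T.InvConvex g A) (h : F) :
    T.InvConvex (h * g * h⁻¹) {x | h⁻¹ • x ∈ A} where
  nonempty := by
    obtain ⟨x, hx⟩ := hA.nonempty
    exact ⟨h • x, by simpa using hx⟩
  convex := fun x hx y hy _ hz => hA.convex _ hx _ hy ((T.smul_mem_seg h⁻¹).2 hz)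
  smul_mem := fun x => by
    simp only [Set.mem_ofPred_eq, smul_smul]
    rw [show h⁻¹ * (h * g * h⁻¹) = g * h⁻¹ by group, mul_smul, hA.smul_mem]

theorem mem_side_smul_of_mem {p q : T.V} {g : F} (h : F) (hg : g ∈ T.side p q) :
    h * g * h⁻¹ ∈ T.side (h • p) (h • q) := by
  rw [mem_side_iff] at *
  obtain ⟨h1, A, hA, hAs⟩ := hg
  refine ⟨by simpa using h1, _, hA.conj h, fun x hx => ?_⟩
  have := hAs hx
  rwa [← T.smul_mem_half h, smul_inv_smul] at this

/-- The conjugate of a set of group elements. -/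
def conjSet (h : F) (A : Set F) : Set F := {x | h⁻¹ * x * h ∈ A}

theorem conjSet_one (A : Set F) : conjSet 1 A = A := by simp [conjSet]

theorem conjSet_mul (h k : F) (A : Set F) : conjSet h (conjSet k A) = conjSet (h * k) A := by
  ext x
  simp only [conjSet, Set.mem_ofPred_eq]
  rw [show k⁻¹ * (h⁻¹ * x * h) * k = (h * k)⁻¹ * x * (h * k) by group]

theorem side_smul (h : F) (p q : T.V) : T.side (h • p) (h • q) = conjSet h (T.side p q) := by
  ext g
  constructor
  · intro hg
    have := T.mem_side_smul_of_mem h⁻¹ hg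
    simpa [conjSet] using this
  · intro hg
    have := T.mem_side_smul_of_mem h hg
    simpa [mul_assoc] using this

/-- Pairs of sets up to conjugation and exchange. -/
def wallSetoid (F : Type u) [Group F] : Setoid (Set F × Set F) where
  r a b := ∃ h : F, b = (conjSet h a.1, conjSet h a.2) ∨ b = (conjSet h a.2, conjSet h a.1)
  iseqv := by
    refine ⟨fun a => ⟨1, Or.inl (by simp [conjSet_one])⟩, ?_, ?_⟩
    · rintro a b ⟨h, rfl | rfl⟩
      · exact ⟨h⁻¹, Or.inl (by simp [conjSet_mul, conjSet_one])⟩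
      · exact ⟨h⁻¹, Or.inr (by simp [conjSet_mul, conjSet_one])⟩
    · rintro a b c ⟨h, rfl | rfl⟩ ⟨k, rfl | rfl⟩
      · exact ⟨k * h, Or.inl (by simp only [conjSet_mul])⟩
      · exact ⟨k * h, Or.inr (by simp only [conjSet_mul])⟩
      · exact ⟨k * h, Or.inr (by simp only [conjSet_mul])⟩
      · exact ⟨k * h, Or.inl (by simp only [conjSet_mul])⟩

/-- Walls up to the action of the group, without orientation. -/
def WallClass (F : Type u) [Group F] : Type u := Quotient (wallSetoid F)

/-- The class of the wall of an edge. -/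
def wallClass (p q : T.V) : WallClass F := Quotient.mk (wallSetoid F) (T.wall p q)

/-- The classes of the walls of a free splitting. -/
def classes : Set (WallClass F) := {c | ∃ p q, T.graph.Adj p q ∧ T.wallClass p q = c}

theorem wallClass_eq_iff {T' : FreeSplitting.{u, w} F} {p q : T.V} {p' q' : T'.V} :
    T.wallClass p q = T'.wallClass p' q' ↔
      ∃ h : F, T'.wall p' q' = T.wall (h • p) (h • q) ∨
        T'.wall p' q' = T.wall (h • q) (h • p) := by
  refine (Quotient.eq (r := wallSetoid F)).trans ?_
  simp only [wall, side_smul]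
  exact Iff.rfl

theorem wallClass_swap (p q : T.V) : T.wallClass q p = T.wallClass p q := by
  rw [wallClass_eq_iff]
  exact ⟨1, Or.inr (by simp)⟩

theorem wallClass_smul (h : F) (p q : T.V) : T.wallClass (h • p) (h • q) = T.wallClass p q := by
  rw [wallClass_eq_iff]
  exact ⟨h⁻¹, Or.inl (by simp)⟩

theorem wallClass_eq_of_wall_eq {T' : FreeSplitting.{u, w} F} {p q : T.V} {p' q' : T'.V}
    (h : T.wall p q = T'.wall p' q') : T.wallClass p q = T'.wallClass p' q' := by
  rw [wallClass, h, wallClass]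

/-- Free splittings with the same wall classes have the same walls. -/
theorem exists_wall_eq {T' : FreeSplitting.{u, w} F} (h : T.classes ⊆ T'.classes) {p q : T.V}
    (hpq : T.graph.Adj p q) : ∃ p' q', T'.graph.Adj p' q' ∧ T.wall p q = T'.wall p' q' := by
  obtain ⟨p', q', hpq', he⟩ := h ⟨p, q, hpq, rfl⟩
  obtain ⟨k, hk | hk⟩ := (wallClass_eq_iff T').1 he
  · exact ⟨_, _, T'.smul_adj k hpq', hk⟩
  · exact ⟨_, _, T'.smul_adj k hpq'.symm, hk⟩

/-! ### Vertices of valence two -/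

/-- There are no leaves: the half-tree at a leaf v is {v}, so some g sends the neighbour b to v,
hence v to b, and flips the edge. -/
theorem exists_other_adj {v b : T.V} (hb : T.graph.Adj v b) : ∃ c, T.graph.Adj v c ∧ c ≠ b := by
  by_contra! h
  obtain ⟨g, hg⟩ := T.exists_smul_mem_half hb.symm b
  have hgb : g • b = v := by
    by_contra hne
    obtain ⟨c, hc, hgc⟩ := T.isTree.exists_branch hne
    obtain rfl := h c hc
    exact (T.isTree.not_mem_half hb).2 hg hgc
  have hgv : g • v = b := h _ (by
    have := T.smul_adj g hb
    rw [hgb] at this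
    exact this.symm)
  have := T.eq_one_of_flip hb hgv hgb
  subst this
  rw [one_smul] at hgv
  exact hb.ne hgv

theorem isNaturalVertex_of_adj {v a b c : T.V} (ha : T.graph.Adj v a) (hb : T.graph.Adj v b)
    (hc : T.graph.Adj v c) (hab : a ≠ b) (hac : a ≠ c) (hbc : b ≠ c) : T.IsNaturalVertex v := by
  have h : ({a, b, c} : Set T.V) ⊆ T.graph.neighborSet v := by
    rintro x (rfl | rfl | rfl) <;> assumption
  refine le_trans (le_of_eq ?_) (Set.encard_le_encard h)
  rw [Set.encard_insert_of_notMem (by simp [hab, hac]), Set.encard_pair hbc]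
  rfl

theorem IsNaturalVertex.exists_adj {v : T.V} (hv : T.IsNaturalVertex v) (b : T.V) :
    ∃ c d, T.graph.Adj v c ∧ T.graph.Adj v d ∧ c ≠ b ∧ d ≠ b ∧ c ≠ d := by
  have h : 1 < (T.graph.neighborSet v \ {b}).encard := by
    have h1 : 3 ≤ (T.graph.neighborSet v).encard := hv
    have h2 := Set.encard_le_encard_sdiff_add_encard (T.graph.neighborSet v) {b}
    rw [Set.encard_singleton] at h2
    have h3 := h1.trans h2
    by_contra hlt
    have h4 : (T.graph.neighborSet v \ {b}).encard + 1 ≤ 1 + 1 :=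
      add_le_add_left (le_of_not_gt hlt) 1
    exact absurd (h3.trans h4) (by norm_num)
  obtain ⟨c, d, hc, hd, hcd⟩ := Set.one_lt_encard_iff.1 h
  exact ⟨c, d, hc.1, hd.1, hc.2, hd.2, hcd⟩

theorem exists_two_adj (v : T.V) : ∃ b c, T.graph.Adj v b ∧ T.graph.Adj v c ∧ b ≠ c := by
  have := T.nontrivial
  obtain ⟨x, hx⟩ := exists_ne v
  obtain ⟨b, hb, -⟩ := T.isTree.exists_branch hx
  obtain ⟨c, hc, hcb⟩ := T.exists_other_adj hb
  exact ⟨b, c, hb, hc, hcb.symm⟩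

/-- The stabilizer of v is trivial, since an element exchanging the two neighbours would be an
involution. An invariant convex set A on the v-side of the edge bv has v at most as an end point.
Deleting from A all vertices that a power of g carries to v keeps it invariant and convex and pushes
it to the c-side of v. -/
theorem side_subset_of_valence_two [IsMulTorsionFree F] {v b c : T.V} (hb : T.graph.Adj v b)
    (hc : T.graph.Adj v c) (hbc : b ≠ c) (honly : ∀ d, T.graph.Adj v d → d = b ∨ d = c) :
    T.side b v ⊆ T.side v c := by
  intro g hg
  obtain ⟨hg1, A, hA, hAs⟩ := T.mem_side_iff.1 hg
  rw [mem_side_iff]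
  refine ⟨hg1, ?_⟩
  have hleaf : ∀ z ∈ A, z ≠ v → z ∈ T.graph.half v c := by
    intro z hz hzv
    obtain ⟨d, hd, hzd⟩ := T.isTree.exists_branch hzv
    rcases honly d hd with rfl | rfl
    · exact absurd hzd ((T.isTree.not_mem_half hb).2 (hAs hz))
    · exact hzd
  have hfix : ∀ k : F, k • v = v → k = 1 := by
    intro k hk
    have hadj : ∀ d, T.graph.Adj v d → T.graph.Adj v (k • d) := fun d hd => by
      have := T.smul_adj k hd
      rwa [hk] at this
    rcases honly _ (hadj b hb) with h1 | h1
    · exact T.eq_one_of_adj hb hk h1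
    rcases honly _ (hadj c hc) with h2 | h2
    · have : k * k = 1 := T.eq_one_of_adj hb (by rw [mul_smul, hk, hk])
        (by rw [mul_smul, h1, h2])
      exact (pow_eq_one_iff_left (two_ne_zero)).1 (by rw [sq, this])
    · exact T.eq_one_of_adj hc hk h2
  refine ⟨{z | z ∈ A ∧ ∀ n : ℤ, g ^ n • z ≠ v}, ⟨?_, ?_, ?_⟩, fun z hz => ?_⟩
  · obtain ⟨x, hx⟩ := hA.nonempty
    by_cases hvA : v ∈ A
    · have hgv : g • v ∈ A := (hA.smul_mem v).2 hvA
      have hgne : g • v ≠ v := fun e => hg1 (hfix g e)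
      have hcA : c ∈ A := hA.convex v hvA _ hgv
        ((T.isTree.mem_half_iff_seg hc).1 (hleaf _ hgv hgne))
      -- If v is in A, then c survives the deletion. Suppose a power k of g has k • c = v. Unless k
      -- flips the edge vc, both k • v and k • k • v lie in the branch at c, yet v is between them.
      refine ⟨c, hcA, fun n hn => ?_⟩
      set k := g ^ n with hk
      have hkA : T.InvConvex k A := hA.zpow n
      have hkv : k • v ≠ v := by
        intro e
        have := hfix k e
        rw [this, one_smul] at hn
        exact hc.ne hn.symm
      have hkc : k⁻¹ • v = c := by rw [← hn, inv_smul_smul]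
      by_cases hkvc : k • v = c
      · have := T.eq_one_of_flip hc hkvc hn
        exact hkv (by rw [this, one_smul])
      · have h1 : k • v ∈ A := (hkA.smul_mem v).2 hvA
        have h2 := (T.isTree.mem_half_iff_seg hc).1 (hleaf _ h1 hkv)
        rw [← T.smul_mem_seg k, hn] at h2
        have h3 : k • k • v ≠ v := by
          intro e
          exact hkvc (smul_left_cancel k (e.trans hn.symm))
        have h4 := T.isTree.segConvex_half hc _ (hleaf _ h1 hkv) _
          (hleaf _ ((hkA.smul_mem _).2 h1) h3) h2
        exact IsTree.left_not_mem_half _ _ h4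
    · exact ⟨x, hx, fun n e => hvA (e ▸ (hA.zpow_smul_mem n x).2 hx)⟩
  · rintro x ⟨hx, hxn⟩ y ⟨hy, hyn⟩ z hz
    refine ⟨hA.convex x hx y hy hz, fun n e => ?_⟩
    have h1 := (T.smul_mem_seg (g ^ n)).2 hz
    rw [e] at h1
    exact IsTree.left_not_mem_half _ _ (T.isTree.segConvex_half hc _
      (hleaf _ ((hA.zpow_smul_mem n x).2 hx) (hxn n)) _
      (hleaf _ ((hA.zpow_smul_mem n y).2 hy) (hyn n)) h1)
  · intro x
    simp only [Set.mem_ofPred_eq, hA.smul_mem, smul_smul]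
    refine and_congr_right fun _ => ⟨fun h n => ?_, fun h n => ?_⟩
    · have := h (n - 1)
      rwa [← zpow_add_one, sub_add_cancel] at this
    · have := h (n + 1)
      rwa [zpow_add_one] at this
  · have := hz.2 0
    rw [zpow_zero, one_smul] at this
    exact hleaf z hz.1 this

theorem side_eq_of_valence_two [IsMulTorsionFree F] {v b c : T.V} (hb : T.graph.Adj v b)
    (hc : T.graph.Adj v c) (hbc : b ≠ c) (honly : ∀ d, T.graph.Adj v d → d = b ∨ d = c) :
    T.side b v = T.side v c :=
  (T.side_subset_of_valence_two hb hc hbc honly).antisymm fun _ hg =>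
    ⟨hg.1, hg.2.trans (T.isTree.half_subset_of_branch hb hc hbc)⟩

theorem wall_eq_of_not_natural [IsMulTorsionFree F] {v b c : T.V} (hb : T.graph.Adj v b)
    (hc : T.graph.Adj v c) (hbc : b ≠ c) (hv : ¬ T.IsNaturalVertex v) :
    T.wall b v = T.wall v c := by
  have honly : ∀ d, T.graph.Adj v d → d = b ∨ d = c := by
    intro d hd
    by_contra! h
    exact hv (T.isNaturalVertex_of_adj hb hc hd hbc h.1.symm h.2.symm)
  exact Prod.ext (T.side_eq_of_valence_two hc hb hbc.symm fun d hd => (honly d hd).symm).symm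
    (T.side_eq_of_valence_two hb hc hbc honly)

/-- At a natural vertex there are characteristic sets that avoid a given direction. -/
theorem IsNaturalVertex.exists_mem_side {v b : T.V} (hv : T.IsNaturalVertex v)
    (hb : T.graph.Adj v b) : ∃ g ∈ T.side b v, v ∈ T.charSet g := by
  obtain ⟨c, d, hc, hd, hcb, hdb, hcd⟩ := hv.exists_adj T b
  obtain ⟨g, hg, hvg, h⟩ := T.exists_charSet_turn hc hd hcd
  refine ⟨g, ⟨hg, fun z hz => ?_⟩, hvg⟩
  rcases h z hz with rfl | h | h
  · exact T.isTree.right_mem_half hb.symm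
  · exact T.isTree.half_subset_of_branch hb hc hcb.symm h
  · exact T.isTree.half_subset_of_branch hb hd hdb.symm h

end FreeSplitting

namespace FreeSplitting

open SimpleGraph

variable {F : Type u} [Group F] (T : FreeSplitting.{u, w} F)

/-! ### Existence of natural vertices -/

/-- Each element acts on the line as a translation or a reflection. A reflection has trivial square
and is excluded by torsion-freeness; translations commute. -/
theorem commute_of_line [IsMulTorsionFree F] (φ : T.V → ℤ)
    (hφ : ∀ x y, (φ x - φ y).natAbs = T.graph.dist x y) (g h : F) : g * h = h * g := by
  have := T.nontrivial
  obtain ⟨v, c, -, hb, -, -⟩ := (⟨Classical.arbitrary T.V, T.exists_two_adj _⟩ :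
    ∃ v b c, T.graph.Adj v b ∧ T.graph.Adj v c ∧ b ≠ c)
  have hinj : ∀ x y, φ x = φ y → x = y := by
    intro x y hxy
    have := hφ x y
    rw [hxy, sub_self] at this
    exact T.connected.dist_eq_zero_iff.1 this.symm
  have hone : ∀ k : F, (∀ x : T.V, k • x = x) → k = 1 := fun k hk =>
    T.eq_one_of_adj hb (hk v) (hk c)
  have key : ∀ (k : F) (x : T.V), φ (k • x) = φ (k • v) + (φ x - φ v) := by
    intro k
    have h1 : ∀ x y, (φ (k • x) - φ (k • y)).natAbs = (φ x - φ y).natAbs := fun x y => by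
      rw [hφ, hφ, dist_smul]
    have h2 : (φ v - φ c).natAbs = 1 := by rw [hφ, dist_eq_one_iff_adj.2 hb]
    by_cases h3 : φ (k • c) - φ (k • v) = φ c - φ v
    · intro x
      have h4 := h1 x v
      have h5 := h1 x c
      omega
    · have h6 : ∀ x, φ (k • x) = φ (k • v) - (φ x - φ v) := by
        intro x
        have h4 := h1 x v
        have h5 := h1 x c
        have h7 := h1 v c
        omega
      have h8 : k * k = 1 := hone _ fun x => hinj _ _ (by
        rw [mul_smul, h6, h6 x]
        ring)
      have h9 : k = 1 := (pow_eq_one_iff_left (two_ne_zero)).1 (by rw [sq, h8])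
      intro x
      rw [h9]
      simp
  have : (h * g)⁻¹ * (g * h) = 1 := hone _ fun x => by
    rw [mul_smul, inv_smul_eq_iff]
    apply hinj
    rw [mul_smul, mul_smul, key g, key h, key h (g • x), key g x]
    ring
  rw [inv_mul_eq_one] at this
  exact this.symm

/-- If no vertex has valence three, then each branch at v is a ray: a median of v and two points of
the branch that differs from all three would be natural. The signed distance from v then embeds the
tree isometrically in ℤ, which forces F to be commutative. -/
theorem exists_isNaturalVertex [IsMulTorsionFree F] (hF : ∃ g h : F, g * h ≠ h * g) :
    ∃ v, T.IsNaturalVertex v := by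
  classical
  by_contra! hnat
  obtain ⟨g, h, hgh⟩ := hF
  have := T.nontrivial
  set v := Classical.arbitrary T.V
  obtain ⟨b, c, hb, hc, hbc⟩ := T.exists_two_adj v
  have honly : ∀ x, x ∉ T.graph.half v c → x ≠ v → x ∈ T.graph.half v b := by
    intro x hxc hxv
    obtain ⟨d, hd, hxd⟩ := T.isTree.exists_branch hxv
    by_contra hxb
    exact hnat v (T.isNaturalVertex_of_adj hb hc hd hbc (fun e => hxb (e ▸ hxd))
      (fun e => hxc (e ▸ hxd)))
  have hmed : ∀ a x y, T.graph.Adj v a → x ∈ T.graph.half v a → y ∈ T.graph.half v a →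
      x ∈ T.graph.seg v y ∨ y ∈ T.graph.seg v x := by
    intro a x y ha hx hy
    obtain ⟨m, h1, h2, h3⟩ := T.isTree.exists_median v x y
    rcases eq_or_ne x m with rfl | hxm
    · exact Or.inl h3
    rcases eq_or_ne y m with rfl | hym
    · exact Or.inr h1
    rcases eq_or_ne v m with rfl | hvm
    · exact absurd (T.isTree.segConvex_half ha x hx y hy h2) (IsTree.left_not_mem_half _ _)
    obtain ⟨a₁, ha₁, hx₁⟩ := T.isTree.exists_branch hxm
    obtain ⟨a₂, ha₂, hx₂⟩ := T.isTree.exists_branch hym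
    obtain ⟨a₃, ha₃, hx₃⟩ := T.isTree.exists_branch hvm
    refine absurd (T.isNaturalVertex_of_adj ha₁ ha₂ ha₃ ?_ ?_ ?_) (hnat m)
    · rintro rfl
      exact IsTree.left_not_mem_half _ _ (T.isTree.segConvex_half ha₁ x hx₁ y hx₂ h2)
    · rintro rfl
      exact IsTree.left_not_mem_half _ _ (T.isTree.segConvex_half ha₁ v hx₃ x hx₁ h1)
    · rintro rfl
      exact IsTree.left_not_mem_half _ _ (T.isTree.segConvex_half ha₂ v hx₃ y hx₂ h3)
  set φ : T.V → ℤ := fun x =>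
    if x ∈ T.graph.half v c then (T.graph.dist v x : ℤ) else -(T.graph.dist v x : ℤ) with hφ
  refine hgh (T.commute_of_line φ (fun x y => ?_) g h)
  have same : ∀ a, T.graph.Adj v a → x ∈ T.graph.half v a → y ∈ T.graph.half v a →
      ((T.graph.dist v x : ℤ) - T.graph.dist v y).natAbs = T.graph.dist x y := by
    intro a ha hx hy
    have hs := T.graph.dist_comm (u := x) (v := y)
    rcases hmed a x y ha hx hy with h1 | h1 <;> rw [mem_seg] at h1 <;> omega
  have diff : v ∈ T.graph.seg x y →
      T.graph.dist v x + T.graph.dist v y = T.graph.dist x y := by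
    intro h1
    rw [mem_seg, T.graph.dist_comm (u := x)] at h1
    exact h1
  by_cases hxc : x ∈ T.graph.half v c <;> by_cases hyc : y ∈ T.graph.half v c <;>
    simp only [hφ, hxc, hyc, if_true, if_false]
  · exact same c hc hxc hyc
  · rcases eq_or_ne y v with rfl | hyv
    · have := T.graph.dist_comm (u := x) (v := v)
      simp [this]
    · have := diff (T.isTree.mem_seg_of_branch_ne hc hb hbc.symm hxc (honly y hyc hyv))
      omega
  · rcases eq_or_ne x v with rfl | hxv
    · simp
    · have := diff (T.isTree.mem_seg_of_branch_ne hb hc hbc (honly x hxc hxv) hyc)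
      omega
  · rcases eq_or_ne y v with rfl | hyv
    · have := T.graph.dist_comm (u := x) (v := v)
      simp [this]
    rcases eq_or_ne x v with rfl | hxv
    · simp
    · have := same b hb (honly x hxc hxv) (honly y hyc hyv)
      omega

theorem IsNaturalVertex.smul {v : T.V} (hv : T.IsNaturalVertex v) (g : F) :
    T.IsNaturalVertex (g • v) := by
  obtain ⟨b, c, hb, hc, hbc⟩ := T.exists_two_adj v
  obtain ⟨c, d, hc, hd, hcb, hdb, hcd⟩ := hv.exists_adj T b
  exact T.isNaturalVertex_of_adj (T.smul_adj g hb) (T.smul_adj g hc) (T.smul_adj g hd)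
    (fun e => hcb (smul_left_cancel g e).symm) (fun e => hdb (smul_left_cancel g e).symm)
    (fun e => hcd (smul_left_cancel g e))

/-! ### Natural edges and walls -/

/-- `a` and `b` are the endpoints of a natural edge. -/
structure IsCell (a b : T.V) : Prop where
  ne : a ≠ b
  left : T.IsNaturalVertex a
  right : T.IsNaturalVertex b
  eq_or_eq : ∀ v ∈ T.graph.seg a b, T.IsNaturalVertex v → v = a ∨ v = b

variable {T}

theorem IsCell.symm {a b : T.V} (h : T.IsCell a b) : T.IsCell b a :=
  ⟨h.ne.symm, h.right, h.left, fun v hv hn =>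
    (h.eq_or_eq v (by rwa [seg_comm]) hn).symm⟩

theorem IsCell.smul {a b : T.V} (h : T.IsCell a b) (g : F) : T.IsCell (g • a) (g • b) := by
  refine ⟨fun e => h.ne (smul_left_cancel g e), h.left.smul T g, h.right.smul T g, ?_⟩
  intro v hv hn
  have h1 : g⁻¹ • v ∈ T.graph.seg a b := by rwa [← T.smul_mem_seg g, smul_inv_smul]
  rw [← inv_smul_eq_iff, ← inv_smul_eq_iff]
  exact h.eq_or_eq _ h1 (hn.smul T g⁻¹)

variable (T)

/-- Both half-trees contain translates of a natural vertex; the endpoints are the natural vertices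
nearest to the edge on its two sides. -/
theorem exists_isCell [IsMulTorsionFree F] (hF : ∃ g h : F, g * h ≠ h * g) {p q : T.V}
    (hpq : T.graph.Adj p q) :
    ∃ a b, T.IsCell a b ∧ a ∈ T.graph.half q p ∧ b ∈ T.graph.half p q := by
  have hex : ∀ p q, T.graph.Adj p q → ∃ b, b ∈ T.graph.half p q ∧ T.IsNaturalVertex b ∧
      ∀ v ∈ T.graph.half p q, T.IsNaturalVertex v → T.graph.dist p b ≤ T.graph.dist p v := by
    intro p q hpq
    obtain ⟨v, hv⟩ := T.exists_isNaturalVertex hF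
    obtain ⟨g, hg⟩ := T.exists_smul_mem_half hpq v
    obtain ⟨b, hb, hmin⟩ := Connected.exists_closest (G := T.graph)
      (A := {x | x ∈ T.graph.half p q ∧ T.IsNaturalVertex x}) ⟨_, hg, hv.smul T g⟩ p
    exact ⟨b, hb.1, hb.2, fun v hv hn => hmin v ⟨hv, hn⟩⟩
  obtain ⟨b, hb, hbn, hbmin⟩ := hex p q hpq
  obtain ⟨a, ha, han, hamin⟩ := hex q p hpq.symm
  obtain ⟨hp, hq⟩ := T.isTree.mem_seg_of_half hpq ha hb
  refine ⟨a, b, ⟨?_, han, hbn, ?_⟩, ha, hb⟩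
  · rintro rfl
    exact (T.isTree.not_mem_half hpq).2 ha hb
  · intro v hv hvn
    by_cases hvh : v ∈ T.graph.half p q
    · right
      have h1 := (T.isTree.mem_seg_of_half hpq ha hvh).1
      have h2 := (T.connected.seg_trans hv h1).2
      have h3 := hbmin v hvh hvn
      rw [mem_seg] at h2
      exact T.connected.dist_eq_zero_iff.1 (by omega)
    · left
      rw [T.isTree.not_mem_half hpq] at hvh
      have h1 := (T.isTree.mem_seg_of_half hpq hvh hb).2
      have h2 := (T.connected.seg_trans' hv h1).2
      have h3 := hamin v hvh hvn
      rw [seg_comm, mem_seg] at h2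
      exact T.connected.dist_eq_zero_iff.1 (by omega)

variable {T}

/-- Interior vertices of the segment have valence two, and walls do not change across them. Every
edge is compared with the first edge ac, by induction on the distance from a. -/
theorem IsCell.wall_eq [IsMulTorsionFree F] {a b p q p' q' : T.V} (hab : T.IsCell a b)
    (hpq : T.graph.Adj p q) (ha : a ∈ T.graph.half q p) (hb : b ∈ T.graph.half p q)
    (hpq' : T.graph.Adj p' q') (ha' : a ∈ T.graph.half q' p') (hb' : b ∈ T.graph.half p' q') :
    T.wall p q = T.wall p' q' := by
  obtain ⟨c, hac, hc⟩ := T.connected.exists_step hab.ne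
  suffices ∀ n p q, T.graph.Adj p q → a ∈ T.graph.half q p → b ∈ T.graph.half p q →
      T.graph.dist a p = n → T.wall p q = T.wall a c by
    rw [this _ p q hpq ha hb rfl, this _ p' q' hpq' ha' hb' rfl]
  intro n
  induction n with
  | zero =>
    intro p q hpq ha hb h
    obtain rfl := T.connected.dist_eq_zero_iff.1 h
    rw [T.isTree.branch_unique hpq hac hb ((T.isTree.mem_half_iff_seg hac).2 hc)]
  | succ n ih =>
    intro p q hpq ha hb h
    have hpa : p ≠ a := by
      rintro rfl
      rw [SimpleGraph.dist_self] at h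
      omega
    obtain ⟨hp, hq⟩ := T.isTree.mem_seg_of_half hpq ha hb
    have hpb : p ≠ b := by
      rintro rfl
      exact IsTree.left_not_mem_half _ _ hb
    have hpn : ¬ T.IsNaturalVertex p := fun hn => (hab.eq_or_eq p hp hn).elim hpa hpb
    obtain ⟨r, hpr, hr⟩ := T.connected.exists_step hpa
    have har : a ∈ T.graph.half p r := (T.isTree.mem_half_iff_seg hpr).2 hr
    have hrq : r ≠ q := by
      rintro rfl
      exact (T.isTree.not_mem_half hpq).2 ha har
    have hbr : b ∈ T.graph.half r p := T.isTree.half_subset_of_branch hpr hpq hrq hb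
    rw [← T.wall_eq_of_not_natural hpr hpq hrq hpn]
    refine ih r p hpr.symm har hbr ?_
    rw [mem_seg, dist_eq_one_iff_adj.2 hpr, T.graph.dist_comm (u := p), h,
      T.graph.dist_comm] at hr
    omega

/-- At the natural endpoint b there is g whose characteristic set contains b and lies beyond the
last edge. It belongs to one side of the common wall, which places b on the corresponding side of
p'q'; the same applies to a. -/
theorem IsCell.separates_of_wall_eq [IsMulTorsionFree F] {a b p q p' q' : T.V}
    (hab : T.IsCell a b) (hpq : T.graph.Adj p q) (ha : a ∈ T.graph.half q p)
    (hb : b ∈ T.graph.half p q) (h : T.wall p q = T.wall p' q') :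
    a ∈ T.graph.half q' p' ∧ b ∈ T.graph.half p' q' := by
  have key : ∀ a b p q p' q' : T.V, T.IsCell a b → T.graph.Adj p q → a ∈ T.graph.half q p →
      b ∈ T.graph.half p q → T.wall p q = T.wall p' q' → b ∈ T.graph.half p' q' := by
    intro a b p q p' q' hab hpq ha hb h
    obtain ⟨c, hbc, hc⟩ := T.connected.exists_step hab.ne.symm
    obtain ⟨g, hg, hbg⟩ := hab.right.exists_mem_side T hbc
    have hac : a ∈ T.graph.half b c := (T.isTree.mem_half_iff_seg hbc).2 hc
    have h1 := hab.wall_eq hpq ha hb hbc.symm hac (T.isTree.right_mem_half hbc.symm)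
    have h2 : T.side c b = T.side p' q' := congrArg Prod.snd (h1.symm.trans h)
    rw [h2] at hg
    exact hg.2 hbg
  exact ⟨key b a q p q' p' hab.symm hpq.symm hb ha (T.wall_swap h), key a b p q p' q' hab hpq ha hb h⟩

theorem mem_edges_of_half {a b p q : T.V} (w : T.graph.Walk a b) (hpq : T.graph.Adj p q)
    (ha : a ∈ T.graph.half q p) (hb : b ∈ T.graph.half p q) : s(p, q) ∈ w.edges := by
  obtain ⟨d, hd, h1, h2⟩ := w.exists_boundary_dart (T.graph.half q p) ha
    ((T.isTree.not_mem_half hpq.symm).2 hb)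
  rw [T.isTree.not_mem_half hpq.symm] at h2
  obtain ⟨e1, e2⟩ := T.isTree.crossing_unique hpq d.adj h1 h2
  rw [← e1, ← e2]
  exact List.mem_map.2 ⟨d, hd, rfl⟩

variable (T)

/-- The edges with a given wall. -/
def wallEdges (p q : T.V) : Set (Sym2 T.V) :=
  {e | ∃ p' q', e = s(p', q') ∧ T.graph.Adj p' q' ∧ T.wall p q = T.wall p' q'}

variable {T}

theorem IsCell.edges_eq [IsMulTorsionFree F] {a b p q : T.V} (hab : T.IsCell a b)
    (hpq : T.graph.Adj p q) (ha : a ∈ T.graph.half q p) (hb : b ∈ T.graph.half p q)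
    {w : T.graph.Walk a b} (hw : w.IsPath) : {e | e ∈ w.edges} = T.wallEdges p q := by
  ext e
  constructor
  · induction e using Sym2.ind with
    | _ c d =>
      intro he
      have hcd : T.graph.Adj c d := w.adj_of_mem_edges he
      have hc := (T.isTree.mem_support_iff hw).1 (w.fst_mem_support_of_mem_edges he)
      have hd := (T.isTree.mem_support_iff hw).1 (w.snd_mem_support_of_mem_edges he)
      have hne : ∀ c d, T.graph.Adj c d → d ∈ T.graph.seg a b → a ∈ T.graph.half d c →
          b ∈ T.graph.half c d := by
        intro c d hcd hd ha
        by_contra hb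
        rw [T.isTree.not_mem_half hcd] at hb
        exact IsTree.left_not_mem_half _ _ (T.isTree.segConvex_half hcd.symm a ha b hb hd)
      by_cases had : a ∈ T.graph.half d c
      · exact ⟨c, d, rfl, hcd, hab.wall_eq hpq ha hb hcd had (hne c d hcd hd had)⟩
      · rw [T.isTree.not_mem_half hcd.symm] at had
        exact ⟨d, c, Sym2.eq_swap, hcd.symm,
          hab.wall_eq hpq ha hb hcd.symm had (hne d c hcd.symm hc had)⟩
  · rintro ⟨p', q', rfl, hpq', h⟩
    obtain ⟨ha', hb'⟩ := hab.separates_of_wall_eq hpq ha hb h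
    exact mem_edges_of_half w hpq' ha' hb'

/-- Natural edges become the fibres of the wall, up to orientation; from here on they are handled
through walls alone. -/
theorem isNaturalEdge_iff [IsMulTorsionFree F] (hF : ∃ g h : F, g * h ≠ h * g)
    {η : Set (Sym2 T.V)} :
    T.IsNaturalEdge η ↔ ∃ p q, T.graph.Adj p q ∧ η = T.wallEdges p q := by
  constructor
  · rintro ⟨a, b, w, hne, hw, ha, hb, hab, rfl⟩
    have hcell : T.IsCell a b :=
      ⟨hne, ha, hb, fun v hv => hab v ((T.isTree.mem_support_iff hw).2 hv)⟩
    obtain ⟨p, q, hpq, hp, hq⟩ := T.isTree.exists_separating_edge hne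
    exact ⟨p, q, hpq, hcell.edges_eq hpq hp hq hw⟩
  · rintro ⟨p, q, hpq, rfl⟩
    obtain ⟨a, b, hab, ha, hb⟩ := T.exists_isCell hF hpq
    obtain ⟨w, hw, -⟩ := T.isTree.existsUnique_path a b
    exact ⟨a, b, w, hab.ne, hw, hab.left, hab.right,
      fun v hv => hab.eq_or_eq v ((T.isTree.mem_support_iff hw).1 hv),
      (hab.edges_eq hpq ha hb hw).symm⟩

theorem mem_wallEdges_self {p q : T.V} (hpq : T.graph.Adj p q) : s(p, q) ∈ T.wallEdges p q :=
  ⟨p, q, rfl, hpq, rfl⟩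

theorem wallEdges_eq {p q p' q' : T.V} (h : s(p', q') ∈ T.wallEdges p q) :
    T.wallEdges p' q' = T.wallEdges p q := by
  have hswap : ∀ p q : T.V, T.wallEdges p q = T.wallEdges q p := by
    have : ∀ p q : T.V, T.wallEdges p q ⊆ T.wallEdges q p := by
      rintro p q e ⟨c, d, rfl, hcd, h⟩
      exact ⟨d, c, Sym2.eq_swap, hcd.symm, T.wall_swap h⟩
    exact fun p q => (this p q).antisymm (this q p)
  obtain ⟨c, d, he, hcd, h⟩ := h
  have : T.wallEdges c d = T.wallEdges p q := by
    simp only [wallEdges, h]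
  rcases Sym2.eq_iff.1 he with ⟨rfl, rfl⟩ | ⟨rfl, rfl⟩
  · exact this
  · rw [hswap, this]

theorem mem_translate_iff {g : F} {η : Set (Sym2 T.V)} {p q : T.V} :
    s(p, q) ∈ T.translate g η ↔ s(g⁻¹ • p, g⁻¹ • q) ∈ η := by
  constructor
  · rintro ⟨e, he, h⟩
    induction e using Sym2.ind with
    | _ c d =>
      rw [Sym2.map_mk] at h
      rcases Sym2.eq_iff.1 h with ⟨rfl, rfl⟩ | ⟨rfl, rfl⟩
      · simpa using he
      · simpa [Sym2.eq_swap] using he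
  · intro h
    exact ⟨_, h, by simp⟩

theorem translate_wallEdges (g : F) (p q : T.V) :
    T.translate g (T.wallEdges p q) = T.wallEdges (g • p) (g • q) := by
  have hw : ∀ (k : F) {a b c d : T.V}, T.wall a b = T.wall c d →
      T.wall (k • a) (k • b) = T.wall (k • c) (k • d) := by
    intro k a b c d h
    have h1 := congrArg Prod.fst h
    have h2 := congrArg Prod.snd h
    simp only [wall] at h1 h2
    simp only [wall, side_smul, h1, h2]
  ext e
  induction e using Sym2.ind with
  | _ x y =>
    rw [mem_translate_iff]
    constructor
    · rintro ⟨c, d, he, hcd, h⟩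
      refine ⟨g • c, g • d, ?_, T.smul_adj g hcd, hw g h⟩
      rcases Sym2.eq_iff.1 he with ⟨rfl, rfl⟩ | ⟨rfl, rfl⟩
      · simp
      · simp [Sym2.eq_swap]
    · rintro ⟨c, d, he, hcd, h⟩
      refine ⟨g⁻¹ • c, g⁻¹ • d, ?_, T.smul_adj g⁻¹ hcd, ?_⟩
      · rcases Sym2.eq_iff.1 he with ⟨rfl, rfl⟩ | ⟨rfl, rfl⟩
        · simp
        · simp [Sym2.eq_swap]
      · simpa using hw g⁻¹ h

theorem IsNaturalSubgraph.mem_of_wallClass_eq [IsMulTorsionFree F]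
    (hF : ∃ g h : F, g * h ≠ h * g) {σ : Set (Sym2 T.V)} (hσ : T.IsNaturalSubgraph σ)
    {p q p' q' : T.V} (hpq' : T.graph.Adj p' q') (hmem : s(p, q) ∈ σ)
    (h : T.wallClass p q = T.wallClass p' q') : s(p', q') ∈ σ := by
  obtain ⟨hinv, hnat⟩ := hσ
  obtain ⟨k, hk⟩ := (wallClass_eq_iff T).1 h
  have hmem' : s(k • p, k • q) ∈ σ := by
    rw [← hinv k, mem_translate_iff]
    simpa
  obtain ⟨η, hη, he, hsub⟩ := hnat _ hmem'
  obtain ⟨c, d, hcd, rfl⟩ := (isNaturalEdge_iff hF).1 hη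
  rw [← wallEdges_eq he] at hsub
  rcases hk with hk | hk
  · exact hsub ⟨p', q', rfl, hpq', hk.symm⟩
  · exact hsub ⟨q', p', Sym2.eq_swap, hpq'.symm, T.wall_swap hk.symm⟩

theorem IsNaturalSubgraph.subset_edgeSet [IsMulTorsionFree F]
    (hF : ∃ g h : F, g * h ≠ h * g) {σ : Set (Sym2 T.V)} (hσ : T.IsNaturalSubgraph σ) :
    σ ⊆ T.graph.edgeSet := by
  intro e he
  obtain ⟨η, hη, heη, -⟩ := hσ.2 e he
  obtain ⟨c, d, hcd, rfl⟩ := (isNaturalEdge_iff hF).1 hη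
  obtain ⟨p', q', rfl, hpq', -⟩ := heη
  exact hpq'

variable (T)

/-- The edges whose wall class does not lie in a given set. -/
def classSubgraph (X : Set (WallClass F)) : Set (Sym2 T.V) :=
  {e | ∃ p q, e = s(p, q) ∧ T.graph.Adj p q ∧ T.wallClass p q ∉ X}

theorem mem_classSubgraph {X : Set (WallClass F)} {p q : T.V} :
    s(p, q) ∈ T.classSubgraph X ↔ T.graph.Adj p q ∧ T.wallClass p q ∉ X := by
  constructor
  · rintro ⟨c, d, he, hcd, h⟩
    rcases Sym2.eq_iff.1 he with ⟨rfl, rfl⟩ | ⟨rfl, rfl⟩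
    · exact ⟨hcd, h⟩
    · exact ⟨hcd.symm, by rwa [wallClass_swap]⟩
  · exact fun h => ⟨p, q, rfl, h⟩

theorem isNaturalSubgraph_classSubgraph [IsMulTorsionFree F] (hF : ∃ g h : F, g * h ≠ h * g)
    (X : Set (WallClass F)) : T.IsNaturalSubgraph (T.classSubgraph X) := by
  constructor
  · intro g
    ext e
    induction e using Sym2.ind with
    | _ x y => rw [mem_translate_iff, mem_classSubgraph, mem_classSubgraph, adj_smul_iff,
        wallClass_smul]
  · rintro e ⟨p, q, rfl, hpq, h⟩
    refine ⟨T.wallEdges p q, (isNaturalEdge_iff hF).2 ⟨p, q, hpq, rfl⟩,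
      mem_wallEdges_self hpq, ?_⟩
    rintro e ⟨p', q', rfl, hpq', h'⟩
    rw [mem_classSubgraph, ← T.wallClass_eq_of_wall_eq h']
    exact ⟨hpq', h⟩

theorem numNaturalEdges_eq [IsMulTorsionFree F] (hF : ∃ g h : F, g * h ≠ h * g) :
    T.numNaturalEdges = ENat.card T.classes := by
  have hex : ∀ η : {η : Set (Sym2 T.V) // T.IsNaturalEdge η}, ∃ p q, T.graph.Adj p q ∧
      η.1 = T.wallEdges p q := fun η => (isNaturalEdge_iff hF).1 η.2
  choose P Q hPQ hη using hex
  let f : Quotient T.naturalEdgeSetoid → T.classes :=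
    Quotient.lift (fun η => ⟨T.wallClass (P η) (Q η), P η, Q η, hPQ η, rfl⟩) (by
      rintro η θ ⟨g, hg⟩
      ext1
      dsimp only
      rw [hη, hη, translate_wallEdges] at hg
      have h1 := mem_wallEdges_self (hPQ θ)
      rw [← hg] at h1
      obtain ⟨c, d, he, -, h⟩ := h1
      have h2 := T.wallClass_eq_of_wall_eq h
      rw [wallClass_smul] at h2
      rw [h2]
      rcases Sym2.eq_iff.1 he with ⟨e1, e2⟩ | ⟨e1, e2⟩ <;> rw [e1, e2]
      rw [wallClass_swap])
  refine ENat.card_congr (Equiv.ofBijective f ⟨?_, ?_⟩)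
  · intro x y
    induction x using Quotient.ind with
    | _ η =>
    induction y using Quotient.ind with
    | _ θ =>
    intro h
    have h1 : T.wallClass (P η) (Q η) = T.wallClass (P θ) (Q θ) := congrArg Subtype.val h
    obtain ⟨k, hk⟩ := (wallClass_eq_iff T).1 h1
    refine Quotient.sound ⟨k, ?_⟩
    rw [hη, hη, translate_wallEdges]
    refine (wallEdges_eq ?_).symm
    rcases hk with hk | hk
    · exact ⟨P θ, Q θ, rfl, hPQ θ, hk.symm⟩
    · exact ⟨Q θ, P θ, Sym2.eq_swap, (hPQ θ).symm, T.wall_swap hk.symm⟩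
  · rintro ⟨c, p, q, hpq, rfl⟩
    refine ⟨Quotient.mk _ ⟨T.wallEdges p q, (isNaturalEdge_iff hF).2 ⟨p, q, hpq, rfl⟩⟩, ?_⟩
    ext1
    set η : {η : Set (Sym2 T.V) // T.IsNaturalEdge η} :=
      ⟨T.wallEdges p q, (isNaturalEdge_iff hF).2 ⟨p, q, hpq, rfl⟩⟩ with hηdef
    change T.wallClass (P η) (Q η) = T.wallClass p q
    have h1 := mem_wallEdges_self hpq
    have h2 : T.wallEdges p q = T.wallEdges (P η) (Q η) := hη η
    rw [h2] at h1
    obtain ⟨c, d, he, -, h⟩ := h1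
    rw [T.wallClass_eq_of_wall_eq h]
    rcases Sym2.eq_iff.1 he with ⟨rfl, rfl⟩ | ⟨rfl, rfl⟩
    · rfl
    · rw [wallClass_swap]

/-! ### Finiteness -/

theorem finite_seg (x y : T.V) : (T.graph.seg x y).Finite := by
  obtain ⟨p, -, -⟩ := T.isTree.existsUnique_path x y
  exact (List.finite_toSet p.support).subset fun z hz => T.isTree.seg_subset_support p hz

/-- The finitely many segments from v to s • v, for generators s, meet every orbit of edges. Indeed
an edge that separates no pair g • v, (g * s) • v would have the whole orbit of v on one side, but
both half-trees meet that orbit. -/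
theorem finite_classes [Group.FG F] : T.classes.Finite := by
  obtain ⟨S, hS⟩ := Group.fg_def.1 ‹Group.FG F›
  have := T.nontrivial
  set v := Classical.arbitrary T.V
  have hK : (⋃ s ∈ S, T.graph.seg v (s • v)).Finite :=
    S.finite_toSet.biUnion fun s _ => T.finite_seg _ _
  refine ((hK.prod hK).image fun x => T.wallClass x.1 x.2).subset ?_
  rintro c ⟨p, q, hpq, rfl⟩
  have hcross : ∃ g : F, ∃ s ∈ S,
      ¬ (g • v ∈ T.graph.half p q ↔ (g * s) • v ∈ T.graph.half p q) := by
    by_contra! h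
    have hall : ∀ k ∈ Subgroup.closure (S : Set F),
        ∀ g : F, g • v ∈ T.graph.half p q ↔ (g * k) • v ∈ T.graph.half p q := by
      intro k hk
      induction hk using Subgroup.closure_induction with
      | mem s hs => exact fun g => h g s hs
      | one => simp
      | mul x y _ _ hx hy => exact fun g => by rw [hx, hy, mul_assoc]
      | inv x _ hx => exact fun g => by rw [hx (g * x⁻¹), inv_mul_cancel_right]
    rw [hS] at hall
    obtain ⟨g, hg⟩ := T.exists_smul_mem_half hpq v
    obtain ⟨k, hk⟩ := T.exists_smul_mem_half hpq.symm v
    have := (hall (g⁻¹ * k) trivial g).1 hg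
    rw [mul_inv_cancel_left] at this
    exact (T.isTree.not_mem_half hpq).2 hk this
  obtain ⟨g, s, hs, h⟩ := hcross
  have hmem : p ∈ T.graph.seg (g • v) ((g * s) • v) ∧ q ∈ T.graph.seg (g • v) ((g * s) • v) := by
    by_cases h1 : g • v ∈ T.graph.half p q
    · have h2 : (g * s) • v ∉ T.graph.half p q := fun h2 => h (iff_of_true h1 h2)
      rw [T.isTree.not_mem_half hpq] at h2
      exact (T.isTree.mem_seg_of_half hpq.symm h1 h2).symm
    · have h2 : (g * s) • v ∈ T.graph.half p q := by
        by_contra h2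
        exact h (iff_of_false h1 h2)
      rw [T.isTree.not_mem_half hpq] at h1
      exact T.isTree.mem_seg_of_half hpq h1 h2
  refine ⟨(g⁻¹ • p, g⁻¹ • q), ⟨?_, ?_⟩, T.wallClass_smul _ _ _⟩
  · refine Set.mem_biUnion hs ?_
    rw [← T.smul_mem_seg g, smul_inv_smul, ← mul_smul]
    exact hmem.1
  · refine Set.mem_biUnion hs ?_
    rw [← T.smul_mem_seg g, smul_inv_smul, ← mul_smul]
    exact hmem.2

end FreeSplitting

namespace SimpleGraph.IsTree

/-! ### Collapse maps of trees -/

variable {V V' : Type w} {G : SimpleGraph V} {G' : SimpleGraph V'} (hG : G.IsTree)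
  (hG' : G'.IsTree) {f : V → V'} (hs : ∀ a b, G.Adj a b → f a = f b ∨ G'.Adj (f a) (f b))
  (hi : ∀ e₁ ∈ G.edgeSet, ∀ e₂ ∈ G.edgeSet,
    Sym2.map f e₁ ∈ G'.edgeSet → Sym2.map f e₁ = Sym2.map f e₂ → e₁ = e₂)

include hG hG' hs

include hi in
-- Along a half-tree the image can change sides only by crossing the edge from f p to f q, and pq is
-- the only edge over it.
theorem map_mem_half_iff {p q x : V} (hpq : G.Adj p q) (h : G'.Adj (f p) (f q)) :
    f x ∈ G'.half (f p) (f q) ↔ x ∈ G.half p q := by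
  have key : ∀ p q, G.Adj p q → G'.Adj (f p) (f q) → ∀ x ∈ G.half p q,
      f x ∈ G'.half (f p) (f q) := by
    intro p q hpq h
    refine hG.connected.convex_induction (hG.segConvex_half hpq)
      (P := fun x => f x ∈ G'.half (f p) (f q)) (hG.right_mem_half hpq) (hG'.right_mem_half h) ?_
    intro r hr s hss hrs hfr
    by_contra hfs
    rw [hG'.not_mem_half h] at hfs
    rcases hs r s hrs with e | hadj
    · rw [e] at hfr
      exact (hG'.not_mem_half h).2 hfs hfr
    · obtain ⟨e1, e2⟩ := hG'.crossing_unique h hadj.symm hfs hfr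
      have e3 : s(p, q) = s(s, r) := hi s(p, q) hpq s(s, r) hrs.symm h (by simp [e1, e2])
      have hp : p ∈ G.half p q := by
        rcases Sym2.eq_iff.1 e3 with ⟨rfl, -⟩ | ⟨rfl, -⟩ <;> assumption
      exact left_not_mem_half _ _ hp
  refine ⟨fun hx => ?_, key p q hpq h x⟩
  by_contra hx'
  rw [hG.not_mem_half hpq] at hx'
  exact (hG'.not_mem_half h).2 (key q p hpq.symm h.symm x hx') hx

theorem exists_adj_lift (hsurj : Function.Surjective f) {X Y : V'} (hXY : G'.Adj X Y) :
    ∃ p q, G.Adj p q ∧ f p = X ∧ f q = Y := by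
  obtain ⟨x, rfl⟩ := hsurj X
  obtain ⟨y, rfl⟩ := hsurj Y
  obtain ⟨r, -, s, -, hrs, hr, hss⟩ := hG.connected.exists_crossing (A := Set.univ)
    (fun _ _ _ _ _ _ => trivial) (P := fun z => f z ∈ G'.half (f y) (f x)) (x := x) (y := y)
    trivial trivial (hG'.right_mem_half hXY.symm) (left_not_mem_half _ _)
  rw [hG'.not_mem_half hXY.symm] at hss
  rcases hs r s hrs with e | hadj
  · rw [e] at hr
    exact absurd hr ((hG'.not_mem_half hXY.symm).2 hss)
  · exact ⟨r, s, hrs, hG'.crossing_unique hXY hadj hr hss⟩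

include hi in
-- Segments are intersections of half-trees, and every half-tree of the target pulls back to a
-- half-tree of the source.
theorem map_mem_seg (hsurj : Function.Surjective f) {x y z : V} (hz : z ∈ G.seg x y) :
    f z ∈ G'.seg (f x) (f y) := by
  rw [hG'.mem_seg_iff_half]
  intro X Y hXY hx hy
  obtain ⟨p, q, hpq, rfl, rfl⟩ := hG.exists_adj_lift hG' hs hsurj hXY
  rw [hG.map_mem_half_iff hG' hs hi hpq hXY] at *
  exact hG.segConvex_half hpq x hx y hy hz

include hi in
theorem segConvex_preimage (hsurj : Function.Surjective f) {B : Set V'} (hB : G'.SegConvex B) :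
    G.SegConvex (f ⁻¹' B) :=
  fun _ hx _ hy _ hz => hB _ hx _ hy (hG.map_mem_seg hG' hs hi hsurj hz)

/-- A simplicial map moves by at most one edge at a time, so as w runs through A the segment from f
x to f w cannot acquire a vertex that is not in the image. Injectivity over edges plays no role. -/
theorem segConvex_image {A : Set V} (hA : G.SegConvex A) : G'.SegConvex (f '' A) := by
  rintro _ ⟨x, hx, rfl⟩ _ ⟨y, hy, rfl⟩ Z hZ
  by_contra hn
  have hne : ∀ r ∈ A, f r ≠ Z := fun r hr e => hn ⟨r, hr, e⟩
  refine hG.connected.convex_induction hA (P := fun w => Z ∉ G'.seg (f x) (f w)) hx ?_ ?_ y hy hZ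
  · rw [hG'.connected.mem_seg_self]
    exact (hne x hx).symm
  · intro r hr s hss hrs h1 h2
    rcases hG'.seg_split h2 (f r) with h | h
    · exact h1 h
    · rcases hs r s hrs with e | hadj
      · rw [e, hG'.connected.mem_seg_self] at h
        exact hne s hss h.symm
      · rw [mem_seg, dist_eq_one_iff_adj.2 hadj] at h
        have h3 := hG'.connected.pos_dist_of_ne (hne r hr)
        have h4 := hG'.connected.pos_dist_of_ne (hne s hss).symm
        omega

end SimpleGraph.IsTree

namespace FreeSplitting

open SimpleGraph

variable {F : Type u} [Group F] {T U : FreeSplitting.{u, w} F}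

/-! ### Walls under collapse maps -/

/-- The image is an invariant subtree, so minimality of U applies. -/
theorem IsCollapseMap.surjective {f : T.V → U.V} (hf : IsCollapseMap T U f) :
    Function.Surjective f := by
  have := T.nontrivial
  rw [← Set.range_eq_univ]
  refine U.minimal _ (U.connected.connected_induce ?_ (Set.range_nonempty f)) ?_
  · rw [← Set.image_univ]
    exact T.isTree.segConvex_image U.isTree hf.simplicial fun _ _ _ _ _ _ => trivial
  · rintro g _ ⟨x, rfl⟩
    exact ⟨g • x, hf.equivariant g x⟩

/-- Images and preimages of invariant convex sets are again such sets, and the half-trees of an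
uncollapsed edge correspond. -/
theorem IsCollapseMap.side_eq {f : T.V → U.V} (hf : IsCollapseMap T U f) {p q : T.V}
    (hpq : T.graph.Adj p q) (h : U.graph.Adj (f p) (f q)) :
    T.side p q = U.side (f p) (f q) := by
  ext g
  rw [mem_side_iff, mem_side_iff]
  refine and_congr_right fun _ => ⟨?_, ?_⟩
  · rintro ⟨A, hA, hAs⟩
    refine ⟨f '' A, ⟨hA.nonempty.image f,
      T.isTree.segConvex_image U.isTree hf.simplicial hA.convex, fun x => ⟨?_, ?_⟩⟩, ?_⟩
    · rintro ⟨y, hy, e⟩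
      refine ⟨g⁻¹ • y, (hA.inv_smul_mem y).2 hy, ?_⟩
      rw [hf.equivariant, e, inv_smul_smul]
    · rintro ⟨y, hy, rfl⟩
      exact ⟨g • y, (hA.smul_mem y).2 hy, hf.equivariant g y⟩
    · rintro _ ⟨x, hx, rfl⟩
      exact (T.isTree.map_mem_half_iff U.isTree hf.simplicial hf.injective_over hpq h).2 (hAs hx)
  · rintro ⟨B, hB, hBs⟩
    refine ⟨f ⁻¹' B, ⟨hB.nonempty.preimage hf.surjective, T.isTree.segConvex_preimage U.isTree
      hf.simplicial hf.injective_over hf.surjective hB.convex, fun x => ?_⟩, ?_⟩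
    · rw [Set.mem_preimage, hf.equivariant, hB.smul_mem, Set.mem_preimage]
    · intro x hx
      exact (T.isTree.map_mem_half_iff U.isTree hf.simplicial hf.injective_over hpq h).1 (hBs hx)

theorem IsCollapseMap.wallClass_eq {f : T.V → U.V} (hf : IsCollapseMap T U f) {p q : T.V}
    (hpq : T.graph.Adj p q) (h : U.graph.Adj (f p) (f q)) :
    T.wallClass p q = U.wallClass (f p) (f q) :=
  wallClass_eq_of_wall_eq T (Prod.ext (hf.side_eq hpq.symm h.symm) (hf.side_eq hpq h))

theorem mem_collapsedSubgraph_iff {f : T.V → U.V} (hf : IsCollapseMap T U f) {p q : T.V}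
    (hpq : T.graph.Adj p q) :
    s(p, q) ∉ collapsedSubgraph T U f ↔ U.graph.Adj (f p) (f q) := by
  simp only [collapsedSubgraph, Set.mem_ofPred_eq, mem_edgeSet, hpq, true_and, Sym2.map_mk,
    Sym2.mk_isDiag_iff]
  exact ⟨fun h => (hf.simplicial p q hpq).resolve_left h, fun h => h.ne⟩

theorem IsCollapseMap.classes_eq {f : T.V → U.V} (hf : IsCollapseMap T U f) :
    U.classes = {c | ∃ p q, T.graph.Adj p q ∧ s(p, q) ∉ collapsedSubgraph T U f ∧
      T.wallClass p q = c} := by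
  ext c
  constructor
  · rintro ⟨X, Y, hXY, rfl⟩
    obtain ⟨p, q, hpq, rfl, rfl⟩ :=
      T.isTree.exists_adj_lift U.isTree hf.simplicial hf.surjective hXY
    exact ⟨p, q, hpq, (mem_collapsedSubgraph_iff hf hpq).2 hXY, hf.wallClass_eq hpq hXY⟩
  · rintro ⟨p, q, hpq, h, rfl⟩
    rw [mem_collapsedSubgraph_iff hf hpq] at h
    exact ⟨_, _, h, (hf.wallClass_eq hpq h).symm⟩

theorem IsCollapseMap.classes_subset {f : T.V → U.V} (hf : IsCollapseMap T U f) :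
    U.classes ⊆ T.classes := by
  rw [hf.classes_eq]
  rintro c ⟨p, q, hpq, -, h⟩
  exact ⟨p, q, hpq, h⟩

/-! ### Existence of collapses -/

variable (T)

/-- Vertices are identified if they are not separated by edges outside `σ`. -/
def collapseSetoid (σ : Set (Sym2 T.V)) : Setoid T.V where
  r x y := ∀ p q, T.graph.Adj p q → s(p, q) ∉ σ → (x ∈ T.graph.half p q ↔ y ∈ T.graph.half p q)
  iseqv := ⟨fun _ _ _ _ _ => Iff.rfl, fun h p q hpq hσ => (h p q hpq hσ).symm,
    fun h k p q hpq hσ => (h p q hpq hσ).trans (k p q hpq hσ)⟩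

/-- The vertices of the collapsed tree. -/
def CollapseVertex (σ : Set (Sym2 T.V)) : Type w := Quotient (T.collapseSetoid σ)

/-- The quotient map to the collapsed tree. -/
def collapseMk (σ : Set (Sym2 T.V)) : T.V → T.CollapseVertex σ :=
  Quotient.mk (T.collapseSetoid σ)

variable {σ : Set (Sym2 T.V)}

theorem collapseMk_surjective : Function.Surjective (T.collapseMk σ) := Quotient.mk_surjective

theorem collapseMk_eq_iff {x y : T.V} : T.collapseMk σ x = T.collapseMk σ y ↔
    ∀ p q, T.graph.Adj p q → s(p, q) ∉ σ → (x ∈ T.graph.half p q ↔ y ∈ T.graph.half p q) :=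
  Quotient.eq (r := T.collapseSetoid σ)

/-- Adjacent vertices are separated by their own edge and by no other. -/
theorem collapseMk_eq_iff_of_adj {x y : T.V} (hxy : T.graph.Adj x y) :
    T.collapseMk σ x = T.collapseMk σ y ↔ s(x, y) ∈ σ := by
  rw [collapseMk_eq_iff]
  constructor
  · intro h
    by_contra hn
    exact IsTree.left_not_mem_half _ _ ((h x y hxy hn).2 (T.isTree.right_mem_half hxy))
  · intro h p q hpq hn
    by_contra hne
    apply hn
    by_cases hx : x ∈ T.graph.half p q
    · have hy : y ∉ T.graph.half p q := fun hy => hne (iff_of_true hx hy)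
      rw [T.isTree.not_mem_half hpq] at hy
      obtain ⟨rfl, rfl⟩ := T.isTree.crossing_unique hpq hxy.symm hy hx
      rwa [Sym2.eq_swap]
    · have hy : y ∈ T.graph.half p q := by
        by_contra hy
        exact hne (iff_of_false hx hy)
      rw [T.isTree.not_mem_half hpq] at hx
      obtain ⟨rfl, rfl⟩ := T.isTree.crossing_unique hpq hxy hx hy
      exact h

variable (σ) in
/-- The collapsed tree. -/
def collapseGraph : SimpleGraph (T.CollapseVertex σ) where
  Adj X Y := X ≠ Y ∧ ∃ x y, T.collapseMk σ x = X ∧ T.collapseMk σ y = Y ∧ T.graph.Adj x y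
  symm := ⟨fun _ _ ⟨h, x, y, hx, hy, hxy⟩ => ⟨h.symm, y, x, hy, hx, hxy.symm⟩⟩
  loopless := ⟨fun _ h => h.1 rfl⟩

theorem collapseMk_adj {x y : T.V} (hxy : T.graph.Adj x y) :
    T.collapseMk σ x = T.collapseMk σ y ∨
      (T.collapseGraph σ).Adj (T.collapseMk σ x) (T.collapseMk σ y) := by
  by_cases h : T.collapseMk σ x = T.collapseMk σ y
  · exact Or.inl h
  · exact Or.inr ⟨h, x, y, rfl, rfl, hxy⟩

theorem edge_eq_of_collapseMk {p q x y : T.V} (hpq : T.graph.Adj p q) (hn : s(p, q) ∉ σ)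
    (hxy : T.graph.Adj x y) (hp : T.collapseMk σ x = T.collapseMk σ p)
    (hq : T.collapseMk σ y = T.collapseMk σ q) : x = p ∧ y = q := by
  rw [collapseMk_eq_iff] at hp hq
  refine T.isTree.crossing_unique hpq hxy ?_ ?_
  · rw [← T.isTree.not_mem_half hpq, hp p q hpq hn]
    exact IsTree.left_not_mem_half _ _
  · rw [hq p q hpq hn]
    exact T.isTree.right_mem_half hpq

/-- For an edge outside σ, the half-tree containing a vertex depends only on the class of the
vertex, and no other edge crosses between the two half-trees. Hence every edge of the quotient is a
bridge. -/
theorem isTree_collapseGraph : (T.collapseGraph σ).IsTree := by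
  have := T.nontrivial
  constructor
  · rw [connected_iff_exists_forall_reachable]
    refine ⟨T.collapseMk σ (Classical.arbitrary _), fun Y => ?_⟩
    obtain ⟨y, rfl⟩ := T.collapseMk_surjective Y
    refine T.connected.induction_adj
      (P := fun y => (T.collapseGraph σ).Reachable (T.collapseMk σ (Classical.arbitrary _))
        (T.collapseMk σ y)) (Reachable.refl _) ?_ y
    intro r s hrs hr
    rcases T.collapseMk_adj (σ := σ) hrs with e | h
    · rwa [← e]
    · exact hr.trans h.reachable
  · rw [isAcyclic_iff_forall_adj_isBridge]
    rintro X Y ⟨hne, p, q, rfl, rfl, hpq⟩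
    have hn : s(p, q) ∉ σ := fun h => hne ((T.collapseMk_eq_iff_of_adj hpq).2 h)
    rw [isBridge_iff]
    intro hreach
    -- the side of the edge is constant on the rest of the graph
    have hside : ∀ {X Y}, ((T.collapseGraph σ) \ fromEdgeSet {s(T.collapseMk σ p,
        T.collapseMk σ q)}).Adj X Y → ∀ x y, T.collapseMk σ x = X → T.collapseMk σ y = Y →
        x ∈ T.graph.half p q → y ∈ T.graph.half p q := by
      rintro X Y ⟨⟨hXY, a, b, rfl, rfl, hab⟩, hdel⟩ x y hx hy hxh
      by_contra hyh
      have ha := ((T.collapseMk_eq_iff.1 hx) p q hpq hn).1 hxh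
      have hb : b ∉ T.graph.half p q := fun hb => hyh (((T.collapseMk_eq_iff.1 hy) p q hpq hn).2 hb)
      rw [T.isTree.not_mem_half hpq] at hb
      obtain ⟨rfl, rfl⟩ := T.isTree.crossing_unique hpq hab.symm hb ha
      exact hdel ⟨Sym2.eq_swap, hXY⟩
    obtain ⟨walk⟩ := hreach.symm
    have : ∀ {X Y} (_ : ((T.collapseGraph σ) \ fromEdgeSet {s(T.collapseMk σ p,
        T.collapseMk σ q)}).Walk X Y), ∀ x y, T.collapseMk σ x = X → T.collapseMk σ y = Y →
        x ∈ T.graph.half p q → y ∈ T.graph.half p q := by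
      intro X Y walk
      induction walk with
      | nil =>
        intro x y hx hy h
        exact ((T.collapseMk_eq_iff.1 (hx.trans hy.symm)) p q hpq hn).1 h
      | cons hadj _ ih =>
        intro x y hx hy h
        obtain ⟨z, hz⟩ := T.collapseMk_surjective (σ := σ) _
        exact ih z y hz hy (hside hadj x z hx hz h)
    exact IsTree.left_not_mem_half _ _ (this walk q p rfl rfl (T.isTree.right_mem_half hpq))

theorem collapse_injective_over (e₁ : Sym2 T.V) (he₁ : e₁ ∈ T.graph.edgeSet) (e₂ : Sym2 T.V)
    (he₂ : e₂ ∈ T.graph.edgeSet)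
    (h : Sym2.map (T.collapseMk σ) e₁ ∈ (T.collapseGraph σ).edgeSet)
    (he : Sym2.map (T.collapseMk σ) e₁ = Sym2.map (T.collapseMk σ) e₂) : e₁ = e₂ := by
  induction e₁ using Sym2.ind with
  | _ p q =>
  induction e₂ using Sym2.ind with
  | _ x y =>
  have hn : s(p, q) ∉ σ := fun hmem =>
    (show (T.collapseGraph σ).Adj _ _ from h).ne ((T.collapseMk_eq_iff_of_adj he₁).2 hmem)
  rw [Sym2.map_mk, Sym2.map_mk] at he
  rcases Sym2.eq_iff.1 he with ⟨h1, h2⟩ | ⟨h1, h2⟩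
  · obtain ⟨rfl, rfl⟩ := T.edge_eq_of_collapseMk he₁ hn he₂ h1.symm h2.symm
    rfl
  · obtain ⟨rfl, rfl⟩ := T.edge_eq_of_collapseMk he₁ hn (Adj.symm he₂) h1.symm h2.symm
    exact Sym2.eq_swap

/-- Every proper invariant subgraph can be collapsed. -/
theorem exists_isCollapseAlong (hinv : ∀ g : F, T.translate g σ = σ)
    (hsub : σ ⊆ T.graph.edgeSet) (hne : σ ≠ T.graph.edgeSet) :
    ∃ U : FreeSplitting.{u, w} F, T.IsCollapseAlong σ U := by
  have hσ : ∀ (g : F) (p q : T.V), s(g • p, g • q) ∈ σ ↔ s(p, q) ∈ σ := by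
    intro g p q
    nth_rw 1 [← hinv g]
    rw [mem_translate_iff, inv_smul_smul, inv_smul_smul]
  have hmap : ∀ (g : F) (x y : T.V), T.collapseMk σ x = T.collapseMk σ y →
      T.collapseMk σ (g • x) = T.collapseMk σ (g • y) := by
    intro g x y h
    rw [collapseMk_eq_iff] at *
    intro p q hpq hn
    rw [T.smul_mem_half', T.smul_mem_half']
    exact h _ _ (T.smul_adj _ hpq) (by rwa [hσ])
  let act : MulAction F (T.CollapseVertex σ) :=
    { smul := fun g => Quotient.lift (fun x => T.collapseMk σ (g • x))
        fun x y h => hmap g x y (Quotient.sound h)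
      one_smul := fun X => by
        obtain ⟨x, rfl⟩ := T.collapseMk_surjective X
        change T.collapseMk σ ((1 : F) • x) = _
        rw [one_smul]
      mul_smul := fun g h X => by
        obtain ⟨x, rfl⟩ := T.collapseMk_surjective X
        change T.collapseMk σ ((g * h) • x) = T.collapseMk σ (g • h • x)
        rw [mul_smul] }
  have hsmul : ∀ (g : F) (x : T.V), T.collapseMk σ (g • x) = g • T.collapseMk σ x :=
    fun g x => rfl
  obtain ⟨e, he, hen⟩ : ∃ e ∈ T.graph.edgeSet, e ∉ σ := by
    by_contra! h
    exact hne (hsub.antisymm h)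
  let U : FreeSplitting.{u, w} F :=
    { V := T.CollapseVertex σ
      graph := T.collapseGraph σ
      isTree := T.isTree_collapseGraph
      nontrivial := by
        induction e using Sym2.ind with
        | _ p q =>
        exact ⟨_, _, fun h => hen ((T.collapseMk_eq_iff_of_adj he).1 h)⟩
      action := act
      smul_adj := by
        rintro g X Y ⟨hXY, x, y, rfl, rfl, hxy⟩
        refine ⟨fun h => hXY ?_, g • x, g • y, rfl, rfl, T.smul_adj g hxy⟩
        exact MulAction.injective g h
      minimal := by
        intro W hW hWinv
        have hpre := T.isTree.segConvex_preimage T.isTree_collapseGraph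
          (fun _ _ => T.collapseMk_adj) T.collapse_injective_over
          T.collapseMk_surjective (T.isTree_collapseGraph.segConvex_of_connected_induce hW)
        obtain ⟨Y, hY⟩ := hW.nonempty
        have := T.minimal _ (T.connected.connected_induce hpre
          (Set.Nonempty.preimage ⟨Y, hY⟩ T.collapseMk_surjective)) fun g x hx => hWinv g _ hx
        rw [Set.eq_univ_iff_forall]
        intro X
        obtain ⟨x, rfl⟩ := T.collapseMk_surjective X
        exact (this ▸ Set.mem_univ x : x ∈ T.collapseMk σ ⁻¹' W)
      edge_stabilizer := by
        rintro g X Y ⟨hXY, x, y, rfl, rfl, hxy⟩ h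
        refine T.edge_stabilizer g x y hxy (T.collapse_injective_over (σ := σ) _
          (T.smul_adj g hxy) _ hxy ?_ h)
        rw [Sym2.map_mk]
        change s(g • T.collapseMk σ x, g • T.collapseMk σ y) ∈ _
        rw [h]
        exact ⟨hXY, x, y, rfl, rfl, hxy⟩ }
  have hf : IsCollapseMap T U (T.collapseMk σ) :=
    ⟨hsmul, fun _ _ => T.collapseMk_adj, T.collapse_injective_over⟩
  refine ⟨U, T.collapseMk σ, hf, ?_⟩
  ext e
  by_cases he : e ∈ T.graph.edgeSet
  · induction e using Sym2.ind with
    | _ p q =>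
    rw [← not_iff_not, mem_collapsedSubgraph_iff hf he, ← T.collapseMk_eq_iff_of_adj he]
    exact ⟨fun h => h.ne, fun h => (T.collapseMk_adj he).resolve_left h⟩
  · exact ⟨fun h => absurd h.1 he, fun h => absurd (hsub h) he⟩

end FreeSplitting

namespace GraphRealization

open SimpleGraph

variable {V : Type w} {G : SimpleGraph V}

/-! ### Topology of graph realizations -/

theorem continuous_cellMap {a b : V} (h : a = b ∨ G.Adj a b) : Continuous (cellMap h) :=
  continuous_iff_coinduced_le.2
    (le_iSup (fun p : {p : V × V // p.1 = p.2 ∨ G.Adj p.1 p.2} =>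
      TopologicalSpace.coinduced (cellMap p.2) inferInstance) ⟨(a, b), h⟩)

theorem continuous_iff {X : Type*} [TopologicalSpace X] {f : GraphRealization G → X} :
    Continuous f ↔ ∀ (a b : V) (h : a = b ∨ G.Adj a b), Continuous fun t => f (cellMap h t) := by
  refine ⟨fun hf a b h => hf.comp (continuous_cellMap h), fun h => ?_⟩
  refine continuous_iSup_dom.2 fun p => continuous_coinduced_dom.2 ?_
  exact h _ _ p.2

/-- The point of the realization at a vertex. -/
noncomputable def vertex (G : SimpleGraph V) (v : V) : GraphRealization G :=
  cellMap (Or.inl rfl : v = v ∨ _) 0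

theorem cellMap_coord {a b : V} (h : a = b ∨ G.Adj a b) (t : unitInterval) :
    (cellMap h t).coord = edgePoint a b t := rfl

theorem cellMap_zero {a b : V} (h : a = b ∨ G.Adj a b) : cellMap h 0 = vertex G a := by
  ext v
  simp [cellMap, vertex, edgePoint]

theorem cellMap_one {a b : V} (h : a = b ∨ G.Adj a b) : cellMap h 1 = vertex G b := by
  ext v
  simp [cellMap, vertex, edgePoint]

theorem cellMap_self {a : V} (h : a = a ∨ G.Adj a a) (t : unitInterval) :
    cellMap h t = vertex G a := by
  ext v
  simp only [cellMap, vertex, edgePoint, ← add_mul]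
  simp

theorem cellMap_symm {a b : V} (h : a = b ∨ G.Adj a b) (h' : b = a ∨ G.Adj b a)
    (t : unitInterval) : cellMap h' (unitInterval.symm t) = cellMap h t := by
  ext v
  simp only [cellMap, edgePoint, unitInterval.coe_symm_eq]
  ring

theorem exists_cellMap (x : GraphRealization G) :
    ∃ (a b : V) (h : a = b ∨ G.Adj a b) (t : unitInterval), x = cellMap h t := by
  obtain ⟨a, b, h, t, ht⟩ := x.mem_cell
  exact ⟨a, b, h, t, GraphRealization.ext ht⟩

/-- A point is a vertex or lies in the interior of an edge. -/
theorem eq_vertex_or (x : GraphRealization G) : (∃ v, x = vertex G v) ∨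
    ∃ (a b : V) (h : G.Adj a b) (t : unitInterval), 0 < (t : ℝ) ∧ (t : ℝ) < 1 ∧
      x = cellMap (Or.inr h) t := by
  obtain ⟨a, b, h, t, rfl⟩ := x.exists_cellMap
  rcases h with rfl | h
  · exact Or.inl ⟨a, cellMap_self _ t⟩
  · rcases eq_or_ne t 0 with rfl | h0
    · exact Or.inl ⟨a, cellMap_zero _⟩
    rcases eq_or_ne t 1 with rfl | h1
    · exact Or.inl ⟨b, cellMap_one _⟩
    exact Or.inr ⟨a, b, h, t, unitInterval.pos_iff_ne_zero.2 h0,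
      unitInterval.lt_one_iff_ne_one.2 h1, rfl⟩

theorem cellMap_injective {a b : V} (h : G.Adj a b) :
    Function.Injective (cellMap (Or.inr h : a = b ∨ G.Adj a b)) := by
  intro s t hst
  have := congrFun (congrArg coord hst) b
  simp only [cellMap, edgePoint, h.ne.symm] at this
  ext
  simpa using this

/-- The affine extension of a function on the vertices. -/
noncomputable def affineExt (φ : V → ℝ) (x : GraphRealization G) : ℝ := ∑ᶠ v, φ v * x.coord v

theorem affineExt_cellMap (φ : V → ℝ) {a b : V} (h : a = b ∨ G.Adj a b) (t : unitInterval) :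
    affineExt φ (cellMap h t) = (1 - t) * φ a + t * φ b := by
  classical
  have h1 : ∀ (c : V) (s : ℝ), ∑ᶠ v, φ v * (s * if v = c then 1 else 0) = s * φ c := by
    intro c s
    rw [finsum_eq_single _ c]
    · simp
      ring
    · intro x hx
      simp [hx]
  have h2 : ∀ (c : V) (s : ℝ),
      (Function.support fun v => φ v * (s * if v = c then 1 else 0)).Finite := by
    intro c s
    refine (Set.finite_singleton c).subset fun v hv => ?_
    by_contra hne
    exact hv (by simp [show v ≠ c from hne])
  rw [← h1 a, ← h1 b, ← finsum_add_distrib (h2 a _) (h2 b _)]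
  refine finsum_congr fun v => ?_
  simp only [cellMap, edgePoint]
  rw [← mul_add]

theorem affineExt_vertex (φ : V → ℝ) (v : V) : affineExt φ (vertex G v) = φ v := by
  rw [vertex, affineExt_cellMap]
  simp

theorem continuous_affineExt (φ : V → ℝ) : Continuous (affineExt φ : GraphRealization G → ℝ) := by
  rw [continuous_iff]
  intro a b h
  simp only [affineExt_cellMap]
  fun_prop

/-- The subcomplex spanned by a set of vertices. -/
def carrier (G : SimpleGraph V) (W : Set V) : Set (GraphRealization G) :=
  {x | ∃ a ∈ W, ∃ b ∈ W, ∃ (h : a = b ∨ G.Adj a b) (t : unitInterval), x = cellMap h t}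

theorem vertex_mem_carrier {W : Set V} {v : V} (hv : v ∈ W) : vertex G v ∈ carrier G W :=
  ⟨v, hv, v, hv, Or.inl rfl, 0, rfl⟩

theorem isPreconnected_carrier (hG : G.Connected) {W : Set V} (hW : G.SegConvex W) :
    IsPreconnected (carrier G W) := by
  rcases W.eq_empty_or_nonempty with rfl | ⟨q, hq⟩
  · convert isPreconnected_empty
    ext x
    simp [carrier]
  have hcell : ∀ {a b : V} (h : a = b ∨ G.Adj a b), IsPreconnected (Set.range (cellMap h)) :=
    fun h => isPreconnected_range (continuous_cellMap h)
  have hsub : ∀ {a b : V} (h : a = b ∨ G.Adj a b), a ∈ W → b ∈ W →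
      Set.range (cellMap h) ⊆ carrier G W := by
    rintro a b h ha hb _ ⟨t, rfl⟩
    exact ⟨a, ha, b, hb, h, t, rfl⟩
  have key := hG.convex_induction hW (P := fun v => ∃ s ⊆ carrier G W,
    vertex G q ∈ s ∧ vertex G v ∈ s ∧ IsPreconnected s) hq
    ⟨{vertex G q}, Set.singleton_subset_iff.2 (vertex_mem_carrier hq), rfl, rfl,
      isPreconnected_singleton⟩ (by
    rintro r hr v hv hrv ⟨s, hs, h1, h2, h3⟩
    refine ⟨s ∪ Set.range (cellMap (Or.inr hrv)), Set.union_subset hs (hsub _ hr hv),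
      Or.inl h1, Or.inr ⟨1, cellMap_one _⟩, ?_⟩
    exact h3.union (vertex G r) h2 ⟨0, cellMap_zero _⟩ (hcell _))
  refine isPreconnected_of_forall (vertex G q) ?_
  rintro x ⟨a, ha, b, hb, h, t, rfl⟩
  obtain ⟨s, hs, h1, h2, h3⟩ := key a ha
  exact ⟨s ∪ Set.range (cellMap h), Set.union_subset hs (hsub _ ha hb), Or.inl h1,
    Or.inr ⟨t, rfl⟩, h3.union (vertex G a) h2 ⟨0, cellMap_zero _⟩ (hcell _)⟩

theorem exists_eq_zero {A : Set (GraphRealization G)} (hA : IsPreconnected A)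
    {f : GraphRealization G → ℝ} (hf : Continuous f) {x y : GraphRealization G} (hx : x ∈ A)
    (hy : y ∈ A) (hfx : f x ≤ 0) (hfy : 0 ≤ f y) : ∃ z ∈ A, f z = 0 :=
  hA.intermediate_value hx hy hf.continuousOn ⟨hfx, hfy⟩

section Tree

variable (hG : G.IsTree)
include hG

/-! ### Separation by a vertex -/

open scoped Classical in
omit hG in
/-- A function on the vertices that distinguishes the component of `b` in the complement
of `a`. -/
noncomputable def vertexSep (G : SimpleGraph V) (a b : V) (v : V) : ℝ :=
  if v = a then 0 else if v ∈ G.half a b then -1 else 1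

theorem vertexSep_eq_of_adj {a b c d : V} (hab : G.Adj a b) (hcd : G.Adj c d) (hc : c ≠ a)
    (hd : d ≠ a) : vertexSep G a b c = vertexSep G a b d := by
  have : c ∈ G.half a b ↔ d ∈ G.half a b := by
    constructor
    · intro h
      by_contra h'
      rw [hG.not_mem_half hab] at h'
      exact hd (hG.crossing_unique hab hcd.symm h' h).1
    · intro h
      by_contra h'
      rw [hG.not_mem_half hab] at h'
      exact hc (hG.crossing_unique hab hcd h' h).1
  classical
  rw [vertexSep, vertexSep, if_neg hc, if_neg hd]
  exact if_congr this rfl rfl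

omit hG in
theorem vertexSep_self (a b : V) : vertexSep G a b a = 0 := by simp [vertexSep]

omit hG in
theorem vertexSep_ne {a b v : V} (h : v ≠ a) : vertexSep G a b v ≠ 0 := by
  simp only [vertexSep, h, if_false]
  split_ifs <;> norm_num

omit hG in
theorem vertexSep_of_mem {a b v : V} (h : v ∈ G.half a b) : vertexSep G a b v = -1 := by
  have : v ≠ a := fun e => IsTree.left_not_mem_half _ _ (e ▸ h)
  simp [vertexSep, this, h]

omit hG in
theorem vertexSep_nonneg {a b v : V} (h : v ∉ G.half a b) : 0 ≤ vertexSep G a b v := by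
  simp only [vertexSep, h, if_false]
  split_ifs <;> norm_num

/-- On an edge away from a the function is a nonzero constant, and on an edge at a it vanishes only
at a. -/
theorem eq_vertex_of_vertexSep {a b : V} (hab : G.Adj a b) {x : GraphRealization G}
    (h : affineExt (vertexSep G a b) x = 0) : x = vertex G a := by
  rcases x.eq_vertex_or with ⟨v, rfl⟩ | ⟨c, d, hcd, t, h0, h1, rfl⟩
  · rw [affineExt_vertex] at h
    by_contra hne
    exact vertexSep_ne (fun e => hne (by rw [e])) h
  · exfalso
    rw [affineExt_cellMap] at h
    by_cases hc : c = a
    · subst hc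
      rw [vertexSep_self, mul_zero, zero_add, mul_eq_zero] at h
      exact h.elim h0.ne' (vertexSep_ne hcd.ne.symm)
    by_cases hd : d = a
    · subst hd
      rw [vertexSep_self, mul_zero, add_zero, mul_eq_zero] at h
      exact h.elim (sub_pos.2 h1).ne' (vertexSep_ne hc)
    · rw [vertexSep_eq_of_adj hG hab hcd hc hd, ← add_mul, sub_add_cancel, one_mul] at h
      exact vertexSep_ne hd h

theorem vertex_mem_of_vertexSep {A : Set (GraphRealization G)} (hA : IsPreconnected A) {a b : V}
    (hab : G.Adj a b) {x y : GraphRealization G} (hx : x ∈ A) (hy : y ∈ A)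
    (hfx : affineExt (vertexSep G a b) x ≤ 0) (hfy : 0 ≤ affineExt (vertexSep G a b) y) :
    vertex G a ∈ A := by
  obtain ⟨z, hz, h⟩ := exists_eq_zero hA (continuous_affineExt _) hx hy hfx hfy
  rwa [← eq_vertex_of_vertexSep hG hab h]

/-- If z is strictly between two vertices of A, a function vanishing only at z passes from negative
to nonnegative values on A; the intermediate value theorem puts z in A. -/
theorem segConvex_vertices {A : Set (GraphRealization G)} (hA : IsPreconnected A) :
    G.SegConvex {v | vertex G v ∈ A} := by
  intro v hv u hu z hz
  rcases eq_or_ne v z with rfl | hvz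
  · exact hv
  obtain ⟨b, hb, hvb⟩ := hG.exists_branch hvz
  have hub : u ∉ G.half z b := fun h =>
    IsTree.left_not_mem_half _ _ (hG.segConvex_half hb v hvb u h hz)
  refine vertex_mem_of_vertexSep hG hA hb hv hu ?_ ?_
  · rw [affineExt_vertex, vertexSep_of_mem hvb]
    norm_num
  · rw [affineExt_vertex]
    exact vertexSep_nonneg hub

theorem mem_half_of_affineExt_neg {a b c d : V} (hab : G.Adj a b) (hcd : G.Adj c d)
    {t : unitInterval} (h : affineExt (vertexSep G a b) (cellMap (Or.inr hcd) t) < 0) :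
    (c = a ∨ c ∈ G.half a b) ∧ (d = a ∨ d ∈ G.half a b) := by
  rw [affineExt_cellMap] at h
  have ht0 := t.2.1
  have ht1 : 0 ≤ 1 - (t : ℝ) := sub_nonneg.2 t.2.2
  have h' : c ∈ G.half a b ∨ d ∈ G.half a b := by
    by_contra! hn
    have h2 := mul_nonneg ht1 (vertexSep_nonneg hn.1)
    have h3 := mul_nonneg ht0 (vertexSep_nonneg hn.2)
    linarith
  have key : ∀ c d, G.Adj c d → c ∈ G.half a b → d = a ∨ d ∈ G.half a b := by
    intro c d hcd hc
    by_cases hd : d ∈ G.half a b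
    · exact Or.inr hd
    · rw [hG.not_mem_half hab] at hd
      exact Or.inl (hG.crossing_unique hab hcd.symm hd hc).1
  rcases h' with h' | h'
  · exact ⟨Or.inr h', key c d hcd h'⟩
  · exact ⟨key d c hcd.symm h', Or.inr h'⟩

/-! ### Separation by an interior point of an edge -/

open scoped Classical in
omit hG in
/-- A function on the vertices whose affine extension vanishes at a point of the edge `pq`. -/
noncomputable def edgeSep (G : SimpleGraph V) (p q : V) (t : ℝ) (v : V) : ℝ :=
  if v ∈ G.half p q then 1 - t else -t

omit hG in
/-- The side of an interior point of the edge `pq` that contains `q`. -/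
def region (G : SimpleGraph V) (p q : V) (t : ℝ) : Set (GraphRealization G) :=
  {x | 0 < affineExt (edgeSep G p q t) x}

omit hG in
theorem edgeSep_of_mem {p q v : V} {t : ℝ} (h : v ∈ G.half p q) : edgeSep G p q t v = 1 - t := by
  simp [edgeSep, h]

omit hG in
theorem edgeSep_of_not_mem {p q v : V} {t : ℝ} (h : v ∉ G.half p q) : edgeSep G p q t v = -t := by
  simp [edgeSep, h]

theorem affineExt_edgeSep_symm {p q : V} (hpq : G.Adj p q) (t : ℝ) (x : GraphRealization G) :
    affineExt (edgeSep G q p (1 - t)) x = -affineExt (edgeSep G p q t) x := by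
  have : ∀ v, edgeSep G q p (1 - t) v = -edgeSep G p q t v := by
    intro v
    by_cases h : v ∈ G.half p q
    · rw [edgeSep_of_mem h, edgeSep_of_not_mem (by rwa [hG.not_mem_half hpq.symm])]
    · rw [edgeSep_of_not_mem h, edgeSep_of_mem ((hG.not_mem_half hpq).1 h)]
      ring
  simp only [affineExt, this, neg_mul, finsum_neg_distrib]

theorem affineExt_edgeSep_cellMap {p q : V} (hpq : G.Adj p q) (t : ℝ) (s : unitInterval) :
    affineExt (edgeSep G p q t) (cellMap (Or.inr hpq) s) = s - t := by
  rw [affineExt_cellMap, edgeSep_of_mem (hG.right_mem_half hpq),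
    edgeSep_of_not_mem (IsTree.left_not_mem_half _ _)]
  ring

theorem eq_of_adj_edgeSep {p q : V} (hpq : G.Adj p q) {t : ℝ} {c d : V} (hcd : G.Adj c d)
    (h1 : ¬ (c = p ∧ d = q)) (h2 : ¬ (d = p ∧ c = q)) :
    edgeSep G p q t c = edgeSep G p q t d := by
  have : c ∈ G.half p q ↔ d ∈ G.half p q := by
    constructor
    · intro h
      by_contra h'
      rw [hG.not_mem_half hpq] at h'
      exact h2 (hG.crossing_unique hpq hcd.symm h' h)
    · intro h
      by_contra h'
      rw [hG.not_mem_half hpq] at h'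
      exact h1 (hG.crossing_unique hpq hcd h' h)
  classical exact if_congr this rfl rfl

theorem edgeSep_cases {p q : V} (hpq : G.Adj p q) (t : ℝ) (x : GraphRealization G) :
    (∃ s, x = cellMap (Or.inr hpq) s) ∨
      (x ∈ carrier G (G.half p q) ∧ affineExt (edgeSep G p q t) x = 1 - t) ∨
      affineExt (edgeSep G p q t) x = -t := by
  have hv : ∀ v, (vertex G v ∈ carrier G (G.half p q) ∧
      affineExt (edgeSep G p q t) (vertex G v) = 1 - t) ∨
      affineExt (edgeSep G p q t) (vertex G v) = -t := by
    intro v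
    rw [affineExt_vertex]
    by_cases h : v ∈ G.half p q
    · exact Or.inl ⟨vertex_mem_carrier h, edgeSep_of_mem h⟩
    · exact Or.inr (edgeSep_of_not_mem h)
  rcases x.eq_vertex_or with ⟨v, rfl⟩ | ⟨c, d, hcd, s, h0, h1, rfl⟩
  · exact Or.inr (hv v)
  · by_cases h1 : c = p ∧ d = q
    · obtain ⟨rfl, rfl⟩ := h1
      exact Or.inl ⟨s, rfl⟩
    by_cases h2 : d = p ∧ c = q
    · obtain ⟨rfl, rfl⟩ := h2
      exact Or.inl ⟨unitInterval.symm s, (cellMap_symm _ _ s).symm⟩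
    · right
      have he := eq_of_adj_edgeSep hG hpq (t := t) hcd h1 h2
      rw [affineExt_cellMap, ← he, ← add_mul, sub_add_cancel, one_mul]
      by_cases h : c ∈ G.half p q
      · have hd : d ∈ G.half p q := by
          by_contra hd
          rw [hG.not_mem_half hpq] at hd
          exact h2 (hG.crossing_unique hpq hcd.symm hd h)
        exact Or.inl ⟨⟨c, h, d, hd, Or.inr hcd, s, rfl⟩, edgeSep_of_mem h⟩
      · exact Or.inr (edgeSep_of_not_mem h)

theorem eq_of_affineExt_edgeSep {p q : V} (hpq : G.Adj p q) {t : unitInterval} (h0 : 0 < (t : ℝ))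
    (h1 : (t : ℝ) < 1) {x : GraphRealization G} (h : affineExt (edgeSep G p q t) x = 0) :
    x = cellMap (Or.inr hpq) t := by
  rcases edgeSep_cases hG hpq t x with ⟨s, rfl⟩ | ⟨-, h'⟩ | h'
  · rw [affineExt_edgeSep_cellMap hG hpq, sub_eq_zero] at h
    rw [Subtype.ext h]
  · linarith
  · linarith

omit hG in
theorem carrier_subset_region {p q : V} {t : ℝ} (h1 : t < 1) :
    carrier G (G.half p q) ⊆ region G p q t := by
  rintro x ⟨a, ha, b, hb, h, s, rfl⟩
  rw [region, Set.mem_ofPred_eq, affineExt_cellMap, edgeSep_of_mem ha, edgeSep_of_mem hb,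
    ← add_mul, sub_add_cancel, one_mul]
  linarith

/-- The region is the subcomplex of the half-tree at q with a half-open piece of the edge pq
attached. -/
theorem isPreconnected_region {p q : V} (hpq : G.Adj p q) {t : ℝ} (h0 : 0 < t)
    (h1 : t < 1) : IsPreconnected (region G p q t) := by
  have hC := isPreconnected_carrier hG.connected (hG.segConvex_half hpq)
  have hC' := carrier_subset_region (G := G) (p := p) (q := q) h1
  have hq := vertex_mem_carrier (G := G) (hG.right_mem_half hpq)
  refine isPreconnected_of_forall (vertex G q) fun x hx => ?_
  rcases edgeSep_cases hG hpq t x with ⟨s, rfl⟩ | ⟨hxc, -⟩ | h'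
  · rw [region, Set.mem_ofPred_eq, affineExt_edgeSep_cellMap hG hpq] at hx
    refine ⟨cellMap (Or.inr hpq) '' Set.Icc s 1, ?_, ⟨1, ⟨s.2.2, le_rfl⟩, cellMap_one _⟩,
      ⟨s, ⟨le_rfl, s.2.2⟩, rfl⟩,
      isPreconnected_Icc.image _ (continuous_cellMap _).continuousOn⟩
    rintro _ ⟨r, hr, rfl⟩
    rw [region, Set.mem_ofPred_eq, affineExt_edgeSep_cellMap hG hpq]
    have : (s : ℝ) ≤ r := hr.1
    linarith
  · exact ⟨_, hC', hq, hxc, hC⟩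
  · rw [region, Set.mem_ofPred_eq, h'] at hx
    linarith

end Tree

end GraphRealization

/-! ### Invariance of walls under conjugacy -/

namespace FreeSplitting

open SimpleGraph GraphRealization

variable {F : Type u} [Group F] {S T : FreeSplitting.{u, w} F}

theorem smul_cellMap (g : F) {a b : T.V} (h : a = b ∨ T.graph.Adj a b)
    (h' : g • a = g • b ∨ T.graph.Adj (g • a) (g • b)) (t : unitInterval) :
    (g • (cellMap h t : T.Space) : T.Space) = cellMap h' t :=
  GraphRealization.ext (T.edgePoint_smul g a b t)

theorem smul_vertex (g : F) (v : T.V) :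
    (g • (vertex T.graph v : T.Space) : T.Space) = vertex T.graph (g • v) :=
  smul_cellMap g _ _ _

theorem smul_mem_carrier {W : Set T.V} {g : F} (hW : ∀ v ∈ W, g • v ∈ W) {x : T.Space}
    (hx : x ∈ carrier T.graph W) : g • x ∈ carrier T.graph W := by
  obtain ⟨a, ha, b, hb, h, t, rfl⟩ := hx
  exact ⟨_, hW a ha, _, hW b hb, h.imp (fun e => by rw [e]) (T.smul_adj g), t, smul_cellMap g _ _ t⟩

theorem inv_smul_smul_space (g : F) (x : T.Space) : g⁻¹ • g • x = x := by
  ext v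
  change x.coord (g⁻¹ • g⁻¹⁻¹ • v) = x.coord v
  rw [smul_inv_smul]

/-- The sides of an edge are determined by the topology and the action. -/
theorem mem_side_iff_region {p q : T.V} {t : ℝ} (h0 : 0 < t)
    (h1 : t < 1) {g : F} : g ∈ T.side p q ↔ g ≠ 1 ∧ ∃ B : Set T.Space, B.Nonempty ∧
      IsPreconnected B ∧ (∀ x : T.Space, g • x ∈ B ↔ x ∈ B) ∧ B ⊆ region T.graph p q t := by
  rw [mem_side_iff]
  refine and_congr_right fun hg => ⟨?_, ?_⟩
  · rintro ⟨A, hA, hAs⟩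
    refine ⟨carrier T.graph A, ?_, isPreconnected_carrier T.connected hA.convex, fun x => ?_, ?_⟩
    · obtain ⟨v, hv⟩ := hA.nonempty
      exact ⟨_, vertex_mem_carrier hv⟩
    · refine ⟨fun h => ?_, smul_mem_carrier fun v => (hA.smul_mem v).2⟩
      rw [← inv_smul_smul_space g x]
      exact smul_mem_carrier (fun v => (hA.inv_smul_mem v).2) h
    · refine Set.Subset.trans ?_ (carrier_subset_region h1)
      rintro x ⟨a, ha, b, hb, h⟩
      exact ⟨a, hAs ha, b, hAs hb, h⟩
  · rintro ⟨B, ⟨x, hx⟩, hB, hinv, hsub⟩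
    refine ⟨{v | vertex T.graph v ∈ B}, ⟨?_, segConvex_vertices T.isTree hB, fun v => ?_⟩, ?_⟩
    -- If B contained no vertex, it could not leave an open edge ab: each vertex separates. Then g •
    -- x lies in the same edge as x, so g maps ab to itself and is trivial.
    · by_contra hemp
      have hno : ∀ v, vertex T.graph v ∉ B := fun v hv => hemp ⟨v, hv⟩
      rcases x.eq_vertex_or with ⟨v, rfl⟩ | ⟨a, b, hab, s, hs0, hs1, rfl⟩
      · exact hno v hx
      have hgx := (hinv _).2 hx
      rw [smul_cellMap g (Or.inr hab) (Or.inr (T.smul_adj g hab))] at hgx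
      have key : ∀ c d, T.graph.Adj c d → affineExt (vertexSep T.graph c d)
          (cellMap (Or.inr hab) s : T.Space) ≤ 0 → affineExt (vertexSep T.graph c d)
          (cellMap (Or.inr (T.smul_adj g hab)) s : T.Space) < 0 := by
        intro c d hcd hle
        by_contra hnn
        exact hno c (vertex_mem_of_vertexSep T.isTree hB hcd hx hgx hle (not_lt.1 hnn))
      have ha := mem_half_of_affineExt_neg T.isTree hab (T.smul_adj g hab) (key a b hab (by
        rw [affineExt_cellMap, vertexSep_self, vertexSep_of_mem (T.isTree.right_mem_half hab)]
        linarith))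
      have hb := mem_half_of_affineExt_neg T.isTree hab.symm (T.smul_adj g hab) (key b a hab.symm (by
        rw [affineExt_cellMap, vertexSep_self,
          vertexSep_of_mem (T.isTree.right_mem_half hab.symm)]
        linarith))
      have hcase : ∀ z, (z = a ∨ z ∈ T.graph.half a b) → (z = b ∨ z ∈ T.graph.half b a) →
          z = a ∨ z = b := by
        rintro z (h | h) (h' | h')
        · exact Or.inl h
        · exact Or.inl h
        · exact Or.inr h'
        · exact absurd h ((T.isTree.not_mem_half hab).2 h')
      have hne : g • a ≠ g • b := (T.smul_adj g hab).ne
      rcases hcase _ ha.1 hb.1 with e1 | e1 <;> rcases hcase _ ha.2 hb.2 with e2 | e2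
      · exact hne (e1.trans e2.symm)
      · exact hg (T.eq_one_of_adj hab e1 e2)
      · exact hg (T.eq_one_of_flip hab e1 e2)
      · exact hne (e1.trans e2.symm)
    · rw [Set.mem_ofPred_eq, ← smul_vertex, hinv]
      exact Iff.rfl
    · intro v hv
      have := hsub hv
      rw [region, Set.mem_ofPred_eq, affineExt_vertex] at this
      by_contra hn
      rw [edgeSep_of_not_mem hn] at this
      linarith

/-- A homeomorphism maps some interior point of any edge to an interior point of an edge. -/
theorem exists_map_eq_cellMap (h : S.Space ≃ₜ T.Space) {p q : S.V} (hpq : S.graph.Adj p q) :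
    ∃ (t : unitInterval) (p' q' : T.V) (hpq' : T.graph.Adj p' q') (t' : unitInterval),
      0 < (t : ℝ) ∧ (t : ℝ) < 1 ∧ 0 < (t' : ℝ) ∧ (t' : ℝ) < 1 ∧
        h (cellMap (Or.inr hpq) t) = cellMap (Or.inr hpq') t' := by
  classical
  by_contra! hno
  have hv : ∀ t : unitInterval, 0 < t → t < 1 →
      ∃ v, h (cellMap (Or.inr hpq) t) = vertex T.graph v := by
    intro t h0 h1
    rcases (h (cellMap (Or.inr hpq) t)).eq_vertex_or with hv | ⟨a, b, hab, s, hs0, hs1, e⟩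
    · exact hv
    · exact absurd e (hno t a b hab s h0 h1 hs0 hs1)
  let t₁ : unitInterval := ⟨1 / 3, by norm_num, by norm_num⟩
  let t₂ : unitInterval := ⟨1 / 2, by norm_num, by norm_num⟩
  have h₁ : t₁ ∈ Set.Ioo (0 : unitInterval) 1 := by
    constructor <;> rw [← Subtype.coe_lt_coe] <;> norm_num [t₁]
  have h₂ : t₂ ∈ Set.Ioo (0 : unitInterval) 1 := by
    constructor <;> rw [← Subtype.coe_lt_coe] <;> norm_num [t₂]
  obtain ⟨v₁, e₁⟩ := hv t₁ h₁.1 h₁.2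
  obtain ⟨v₂, e₂⟩ := hv t₂ h₂.1 h₂.2
  have hne : v₂ ≠ v₁ := by
    intro e
    rw [e, ← e₁] at e₂
    have := cellMap_injective hpq (h.injective e₂)
    have := congrArg Subtype.val this
    norm_num [t₁, t₂] at this
  -- If the whole open edge were mapped to vertices, its connected image would contain the distinct
  -- vertices v₁ and v₂. This function is 1 at v₁ and 0 at v₂, hence takes the value 1/2 on the
  -- image, which it does at no vertex.
  set f : T.Space → ℝ := affineExt fun v => if v = v₁ then 1 else 0 with hf
  have hpre : IsPreconnected ((fun t => h (cellMap (Or.inr hpq) t)) '' Set.Ioo 0 1) :=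
    isPreconnected_Ioo.image _ (h.continuous.comp (continuous_cellMap _)).continuousOn
  obtain ⟨_, ⟨t, ht, rfl⟩, he⟩ := hpre.intermediate_value (f := f) (Set.mem_image_of_mem _ h₂)
    (Set.mem_image_of_mem _ h₁) (continuous_affineExt _).continuousOn
    (show (1 / 2 : ℝ) ∈ Set.Icc _ _ by
      rw [e₁, e₂, hf, affineExt_vertex, affineExt_vertex]
      simp only [hne, if_true, if_false]
      norm_num)
  obtain ⟨v, e⟩ := hv t ht.1 ht.2
  dsimp only at he
  rw [e, hf, affineExt_vertex] at he
  split_ifs at he <;> norm_num at he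

theorem side_subset_of_region (h : S.Space ≃ₜ T.Space)
    (hequiv : ∀ (g : F) (x : S.Space), h (g • x) = g • h x) {p q : S.V} {p' q' : T.V}
    {t t' : ℝ} (h0 : 0 < t) (h1 : t < 1)
    (h0' : 0 < t') (h1' : t' < 1)
    (hsub : ∀ x ∈ region S.graph p q t, h x ∈ region T.graph p' q' t') :
    S.side p q ⊆ T.side p' q' := by
  intro g
  rw [mem_side_iff_region h0 h1, mem_side_iff_region h0' h1']
  rintro ⟨hg, B, hne, hB, hinv, hBs⟩
  refine ⟨hg, h '' B, hne.image h, hB.image h h.continuous.continuousOn, fun x => ?_, ?_⟩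
  · obtain ⟨y, rfl⟩ := h.surjective x
    rw [← hequiv, h.injective.mem_set_image, h.injective.mem_set_image, hinv]
  · rintro _ ⟨x, hx, rfl⟩
    exact hsub x (hBs hx)

/-- A homeomorphism need not respect the simplicial structures, so a point interior to pq whose
image is interior to some edge is chosen. Its complement has two connected sides in each tree; the
homeomorphism matches them, possibly after exchange, and sides in the group are read off from these
regions. -/
theorem Conjugate.exists_wall_eq (hST : S.Conjugate T) {p q : S.V} (hpq : S.graph.Adj p q) :
    ∃ p' q', T.graph.Adj p' q' ∧ S.wall p q = T.wall p' q' := by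
  obtain ⟨h, hequiv⟩ := hST
  obtain ⟨t, p', q', hpq', t', h0, h1, h0', h1', e⟩ := exists_map_eq_cellMap h hpq
  set Φ : S.Space → ℝ := affineExt (edgeSep S.graph p q t) with hΦ
  set Ψ : T.Space → ℝ := affineExt (edgeSep T.graph p' q' t') with hΨ
  have hzero : ∀ x, Ψ (h x) = 0 ↔ Φ x = 0 := by
    intro x
    constructor
    · intro hx
      have := eq_of_affineExt_edgeSep T.isTree hpq' h0' h1' hx
      rw [← e] at this
      rw [h.injective this, hΦ, affineExt_edgeSep_cellMap S.isTree hpq, sub_self]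
    · intro hx
      rw [eq_of_affineExt_edgeSep S.isTree hpq h0 h1 hx, e, hΨ,
        affineExt_edgeSep_cellMap T.isTree hpq', sub_self]
  have hΨc : Continuous fun x => Ψ (h x) := (continuous_affineExt _).comp h.continuous
  -- each side is mapped into one side
  have hconst : ∀ A : Set S.Space, IsPreconnected A → (∀ x ∈ A, Φ x ≠ 0) →
      (∀ x ∈ A, 0 < Ψ (h x)) ∨ (∀ x ∈ A, Ψ (h x) < 0) := by
    intro A hA hne
    by_contra! hcon
    obtain ⟨⟨x, hx, hx'⟩, ⟨y, hy, hy'⟩⟩ := hcon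
    obtain ⟨z, hz, hz'⟩ := exists_eq_zero hA hΨc hx hy hx' hy'
    exact hne z hz ((hzero z).1 hz')
  have hneg : ∀ x, x ∈ region S.graph q p (1 - t) ↔ Φ x < 0 := by
    intro x
    rw [region, Set.mem_ofPred_eq, affineExt_edgeSep_symm S.isTree hpq, neg_pos]
  have hneg' : ∀ x, x ∈ region T.graph q' p' (1 - t') ↔ Ψ x < 0 := by
    intro x
    rw [region, Set.mem_ofPred_eq, affineExt_edgeSep_symm T.isTree hpq', neg_pos]
  have hpos := hconst (region S.graph p q t) (isPreconnected_region S.isTree hpq h0 h1)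
    (fun x hx => (show 0 < Φ x from hx).ne')
  have hneg₁ := hconst (region S.graph q p (1 - t)) (isPreconnected_region S.isTree hpq.symm
    (by linarith) (by linarith)) (fun x hx => ((hneg x).1 hx).ne)
  have hex₁ : ∃ x, 0 < Ψ (h x) := by
    obtain ⟨x, hx⟩ := h.surjective (vertex T.graph q')
    refine ⟨x, ?_⟩
    rw [hx, hΨ, affineExt_vertex, edgeSep_of_mem (T.isTree.right_mem_half hpq')]
    linarith
  have hex₂ : ∃ x, Ψ (h x) < 0 := by
    obtain ⟨x, hx⟩ := h.surjective (vertex T.graph p')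
    refine ⟨x, ?_⟩
    rw [hx, hΨ, affineExt_vertex, edgeSep_of_not_mem (IsTree.left_not_mem_half _ _)]
    linarith
  have htri : ∀ x, 0 < Φ x ∨ Φ x < 0 ∨ Ψ (h x) = 0 := by
    intro x
    rcases lt_trichotomy (Φ x) 0 with h | h | h
    · exact Or.inr (Or.inl h)
    · exact Or.inr (Or.inr ((hzero x).2 h))
    · exact Or.inl h
  have hs : 0 < 1 - (t : ℝ) := by linarith
  have hs1 : 1 - (t : ℝ) < 1 := by linarith
  have hs' : 0 < 1 - (t' : ℝ) := by linarith
  have hs1' : 1 - (t' : ℝ) < 1 := by linarith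
  have hequiv' : ∀ (g : F) (x : T.Space), h.symm (g • x) = g • h.symm x := fun g x => by
    rw [Homeomorph.symm_apply_eq, hequiv, Homeomorph.apply_symm_apply]
  -- Equal signs on both sides are impossible, since Ψ takes both signs. Of the mixed cases, one
  -- preserves the orientation of the edge and the other reverses it.
  rcases hpos with hp | hp <;> rcases hneg₁ with hn | hn
  · obtain ⟨x, hx⟩ := hex₂
    rcases htri x with h' | h' | h'
    · exact absurd (hp x h') (by linarith)
    · exact absurd (hn x ((hneg x).2 h')) (by linarith)
    · exact absurd h' hx.ne
  · have hp' : ∀ y, 0 < Ψ y → 0 < Φ (h.symm y) := by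
      intro y hy
      rw [← h.apply_symm_apply y] at hy
      rcases htri (h.symm y) with h' | h' | h'
      · exact h'
      · exact absurd (hn _ ((hneg _).2 h')) (by linarith)
      · exact absurd h' hy.ne'
    have hn' : ∀ y, Ψ y < 0 → Φ (h.symm y) < 0 := by
      intro y hy
      rw [← h.apply_symm_apply y] at hy
      rcases htri (h.symm y) with h' | h' | h'
      · exact absurd (hp _ h') (by linarith)
      · exact h'
      · exact absurd h' hy.ne
    refine ⟨p', q', hpq', Prod.ext (Set.Subset.antisymm ?_ ?_) (Set.Subset.antisymm ?_ ?_)⟩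
    · exact side_subset_of_region h hequiv hs hs1 hs' hs1'
        fun x hx => (hneg' _).2 (hn x hx)
    · exact side_subset_of_region h.symm hequiv' hs' hs1' hs hs1
        fun y hy => (hneg _).2 (hn' y ((hneg' y).1 hy))
    · exact side_subset_of_region h hequiv h0 h1 h0' h1' hp
    · exact side_subset_of_region h.symm hequiv' h0' h1' h0 h1 hp'
  · have hp' : ∀ y, Ψ y < 0 → 0 < Φ (h.symm y) := by
      intro y hy
      rw [← h.apply_symm_apply y] at hy
      rcases htri (h.symm y) with h' | h' | h'
      · exact h'
      · exact absurd (hn _ ((hneg _).2 h')) (by linarith)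
      · exact absurd h' hy.ne
    have hn' : ∀ y, 0 < Ψ y → Φ (h.symm y) < 0 := by
      intro y hy
      rw [← h.apply_symm_apply y] at hy
      rcases htri (h.symm y) with h' | h' | h'
      · exact absurd (hp _ h') (by linarith)
      · exact h'
      · exact absurd h' hy.ne'
    refine ⟨q', p', hpq'.symm, Prod.ext (Set.Subset.antisymm ?_ ?_) (Set.Subset.antisymm ?_ ?_)⟩
    · exact side_subset_of_region h hequiv hs hs1 h0' h1' hn
    · exact side_subset_of_region h.symm hequiv' h0' h1' hs hs1
        fun y hy => (hneg _).2 (hn' y hy)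
    · exact side_subset_of_region h hequiv h0 h1 hs' hs1'
        fun x hx => (hneg' _).2 (hp x hx)
    · exact side_subset_of_region h.symm hequiv' hs' hs1' h0 h1
        fun y hy => hp' y ((hneg' y).1 hy)
  · obtain ⟨x, hx⟩ := hex₁
    rcases htri x with h' | h' | h'
    · exact absurd (hp x h') (by linarith)
    · exact absurd (hn x ((hneg x).2 h')) (by linarith)
    · exact absurd h' hx.ne'

/-- The wall classes of a free splitting are a conjugacy invariant. -/
theorem Conjugate.classes_eq (hST : S.Conjugate T) : S.classes = T.classes := by
  have key : ∀ {S T : FreeSplitting.{u, w} F}, S.Conjugate T → S.classes ⊆ T.classes := by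
    rintro S T hST c ⟨p, q, hpq, rfl⟩
    obtain ⟨p', q', hpq', h⟩ := hST.exists_wall_eq hpq
    exact ⟨p', q', hpq', (wallClass_eq_of_wall_eq S h).symm⟩
  exact (key hST).antisymm (key hST.symm)

end FreeSplitting

/-! ### Functoriality of graph realizations -/

/-- Barycentric coordinates determine the point: two edges share it only as the same edge, the
reversed edge, or at a common endpoint. This is what injectivity of `natMap` rests on. -/
theorem edgePoint_eq_cases {V : Type w} {a b a' b' : V} (hab : a ≠ b) (hab' : a' ≠ b')
    {s s' : unitInterval} (h : edgePoint a b s = edgePoint a' b' s') :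
    (a = a' ∧ b = b' ∧ (s : ℝ) = s') ∨ (a = b' ∧ b = a' ∧ (s' : ℝ) = 1 - s) ∨
      ∃ c, ((c = a ∧ (s : ℝ) = 0) ∨ (c = b ∧ (s : ℝ) = 1)) ∧
        ((c = a' ∧ (s' : ℝ) = 0) ∨ (c = b' ∧ (s' : ℝ) = 1)) := by
  classical
  have hl : ∀ {a b : V}, a ≠ b → ∀ s : unitInterval, edgePoint a b s a = 1 - s := by
    intro a b hab s
    simp [edgePoint, hab]
  have hr : ∀ {a b : V}, a ≠ b → ∀ s : unitInterval, edgePoint a b s b = s := by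
    intro a b hab s
    simp [edgePoint, hab.symm]
  have h0 : ∀ {a b c : V}, c ≠ a → c ≠ b → ∀ s : unitInterval, edgePoint a b s c = 0 := by
    intro a b c h1 h2 s
    simp [edgePoint, h1, h2]
  have hmem : ∀ c, edgePoint a b s c ≠ 0 → c = a' ∨ c = b' := by
    intro c hc
    by_contra! hn
    exact hc (by rw [h, h0 hn.1 hn.2])
  have hsl := hl hab s
  have hsr := hr hab s
  have hone : ∀ c, edgePoint a b s c = 1 → (c = a' ∧ (s' : ℝ) = 0) ∨ (c = b' ∧ (s' : ℝ) = 1) := by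
    intro c hc
    rcases hmem c (by rw [hc]; norm_num) with rfl | rfl
    · left
      rw [h, hl hab'] at hc
      exact ⟨rfl, by linarith⟩
    · right
      rw [h, hr hab'] at hc
      exact ⟨rfl, hc⟩
  by_cases hs0 : (s : ℝ) = 0
  · exact Or.inr (Or.inr ⟨a, Or.inl ⟨rfl, hs0⟩, hone a (by rw [hsl, hs0, sub_zero])⟩)
  by_cases hs1 : (s : ℝ) = 1
  · exact Or.inr (Or.inr ⟨b, Or.inr ⟨rfl, hs1⟩, hone b (by rw [hsr, hs1])⟩)
  rcases hmem b (by rwa [hsr]) with rfl | rfl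
  · rcases hmem a (by rw [hsl, sub_ne_zero]; exact fun e => hs1 e.symm) with rfl | rfl
    · exact absurd rfl hab
    · right; left
      rw [h, hl hab'] at hsr
      exact ⟨rfl, rfl, by linarith⟩
  · rcases hmem a (by rw [hsl, sub_ne_zero]; exact fun e => hs1 e.symm) with rfl | rfl
    · left
      rw [h, hr hab'] at hsr
      exact ⟨rfl, rfl, hsr.symm⟩
    · exact absurd rfl hab

namespace GraphRealization

open SimpleGraph

variable {V V' : Type w} {G : SimpleGraph V} {G' : SimpleGraph V'}

theorem edgePoint_equiv (e : V ≃ V') (a b : V) (t : unitInterval) :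
    (fun v => edgePoint a b t (e.symm v)) = edgePoint (e a) (e b) t := by
  classical
  funext v
  simp only [edgePoint, Equiv.symm_apply_eq]

/-- The map of realizations induced by an isomorphism of graphs. -/
def map (e : G ≃g G') (x : GraphRealization G) : GraphRealization G' :=
  ⟨fun v => x.coord (e.symm v), by
    obtain ⟨a, b, h, t, ht⟩ := x.mem_cell
    exact ⟨e a, e b, h.imp (congrArg e) e.map_rel_iff.2, t, by
      rw [ht]; exact edgePoint_equiv e.toEquiv a b t⟩⟩

theorem continuous_map (e : G ≃g G') : Continuous (map e) := by
  rw [continuous_iff]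
  intro a b h
  have : (fun t => map e (cellMap h t)) =
      cellMap (G := G') (h.imp (congrArg e) e.map_rel_iff.2 : e a = e b ∨ G'.Adj (e a) (e b)) := by
    funext t
    exact GraphRealization.ext (edgePoint_equiv e.toEquiv a b t)
  rw [this]
  exact continuous_cellMap _

/-- The homeomorphism of realizations induced by an isomorphism of graphs. -/
def mapHomeomorph (e : G ≃g G') : GraphRealization G ≃ₜ GraphRealization G' where
  toFun := map e
  invFun := map e.symm
  left_inv x := by
    ext v
    exact congrArg x.coord (e.symm_apply_apply v)
  right_inv x := by
    ext v
    exact congrArg x.coord (e.apply_symm_apply v)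
  continuous_toFun := continuous_map e
  continuous_invFun := continuous_map e.symm

theorem mapHomeomorph_coord (e : G ≃g G') (x : GraphRealization G) (v : V) :
    (mapHomeomorph e x).coord (e v) = x.coord v :=
  congrArg x.coord (e.symm_apply_apply v)

end GraphRealization

namespace FreeSplitting

open SimpleGraph GraphRealization

variable {F : Type u} [Group F] {S T : FreeSplitting.{u, w} F}

/-! ### Natural edges -/

/-- The last edge of the second cell has the same wall as pq, so it also separates a from b. Thus b'
is a natural vertex on the segment from a to b, on the far side of an edge from a, and equals b. -/
theorem IsCell.unique [IsMulTorsionFree F] {a b a' b' p q : T.V} (h : T.IsCell a b)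
    (h' : T.IsCell a' b') (hpq : T.graph.Adj p q) (ha : a ∈ T.graph.half q p)
    (hb : b ∈ T.graph.half p q) (ha' : a' ∈ T.graph.half q p) (hb' : b' ∈ T.graph.half p q) :
    a = a' ∧ b = b' := by
  have key : ∀ {a b a' b' p q : T.V}, T.IsCell a b → T.IsCell a' b' → T.graph.Adj p q →
      a ∈ T.graph.half q p → b ∈ T.graph.half p q → a' ∈ T.graph.half q p →
      b' ∈ T.graph.half p q → b = b' := by
    intro a b a' b' p q h h' hpq ha hb ha' hb'
    obtain ⟨c, hbc, hc⟩ := T.connected.exists_step h'.ne.symm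
    have hac : a' ∈ T.graph.half b' c := (T.isTree.mem_half_iff_seg hbc).2 hc
    have h1 := h'.wall_eq hpq ha' hb' hbc.symm hac (T.isTree.right_mem_half hbc.symm)
    obtain ⟨h2, h3⟩ := h.separates_of_wall_eq hpq ha hb h1
    have h4 := (T.isTree.mem_seg_of_half hbc.symm h2 h3).2
    rcases h.eq_or_eq b' h4 h'.right with e | e
    · rw [e] at h2
      exact absurd h2 (IsTree.left_not_mem_half _ _)
    · exact e.symm
  exact ⟨key h.symm h'.symm hpq.symm hb ha hb' ha', key h h' hpq ha hb ha' hb'⟩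

/-- An edge that lies on the segment from `a` to `b`, oriented towards `b`. -/
structure Between (T : FreeSplitting.{u, w} F) (a b p q : T.V) : Prop where
  adj : T.graph.Adj p q
  left : a ∈ T.graph.half q p
  right : b ∈ T.graph.half p q

theorem Between.symm {a b p q : T.V} (h : T.Between a b p q) : T.Between b a q p :=
  ⟨h.adj.symm, h.right, h.left⟩

theorem Between.mem_seg {a b p q : T.V} (h : T.Between a b p q) :
    p ∈ T.graph.seg a b ∧ q ∈ T.graph.seg a b :=
  T.isTree.mem_seg_of_half h.adj h.left h.right

theorem Between.dist_eq {a b p q : T.V} (h : T.Between a b p q) :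
    T.graph.dist a q = T.graph.dist a p + 1 := by
  have := (T.isTree.mem_half_iff_seg h.adj.symm).1 h.left
  rw [SimpleGraph.mem_seg, dist_eq_one_iff_adj.2 h.adj.symm, T.graph.dist_comm (u := p),
    T.graph.dist_comm (u := q)] at this
  omega

theorem Between.dist_lt {a b p q : T.V} (h : T.Between a b p q) :
    T.graph.dist a p + 1 ≤ T.graph.dist a b := by
  have := h.mem_seg.2
  rw [SimpleGraph.mem_seg] at this
  have := h.dist_eq
  omega

theorem Between.smul {a b p q : T.V} (h : T.Between a b p q) (g : F) :
    T.Between (g • a) (g • b) (g • p) (g • q) :=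
  ⟨T.smul_adj g h.adj, (T.smul_mem_half g).2 h.left, (T.smul_mem_half g).2 h.right⟩

theorem exists_between {a b : T.V} {n : ℕ} (hn : n < T.graph.dist a b) :
    ∃ p q, T.Between a b p q ∧ T.graph.dist a p = n := by
  have hex : ∀ n, n ≤ T.graph.dist a b → ∃ v ∈ T.graph.seg a b, T.graph.dist a v = n := by
    intro n
    induction n with
    | zero => exact fun _ => ⟨a, left_mem_seg _ _, SimpleGraph.dist_self⟩
    | succ n ih =>
      intro h
      obtain ⟨v, hv, hd⟩ := ih (by omega)
      have hvb : v ≠ b := by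
        rintro rfl
        omega
      obtain ⟨c, hvc, hc⟩ := T.connected.exists_step hvb
      obtain ⟨h1, h2⟩ := T.connected.seg_trans' hv hc
      refine ⟨c, h1, ?_⟩
      rw [SimpleGraph.mem_seg, hd, dist_eq_one_iff_adj.2 hvc] at h2
      exact h2.symm
  obtain ⟨p, hp, hd⟩ := hex n hn.le
  have hpb : p ≠ b := by
    rintro rfl
    omega
  obtain ⟨q, hpq, hq⟩ := T.connected.exists_step hpb
  refine ⟨p, q, ⟨hpq, ?_, (T.isTree.mem_half_iff_seg hpq).2 hq⟩, hd⟩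
  rw [T.isTree.mem_half_iff_seg hpq.symm, seg_comm]
  exact (T.connected.seg_trans' hp hq).2

variable (T) in
/-- The graph of natural vertices and natural edges. -/
def natGraph : SimpleGraph {v : T.V // T.IsNaturalVertex v} where
  Adj a b := T.IsCell a.1 b.1
  symm := ⟨fun _ _ h => h.symm⟩
  loopless := ⟨fun _ h => h.ne rfl⟩

/-! ### The realization of the graph of natural vertices -/

section Natural

variable [IsMulTorsionFree F] (hF : ∃ g h : F, g * h ≠ h * g)
include hF

theorem exists_cell_between (v : T.V) : ∃ a b q, T.IsCell a b ∧ T.Between a b v q := by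
  obtain ⟨q, -, hq, -, -⟩ := T.exists_two_adj v
  obtain ⟨a, b, hab, ha, hb⟩ := T.exists_isCell hF hq
  exact ⟨a, b, q, hab, hq, ha, hb⟩

omit hF [IsMulTorsionFree F] in
/-- The relative position of a vertex on a segment. -/
noncomputable def ratio (T : FreeSplitting.{u, w} F) (a b v : T.V) : ℝ :=
  (T.graph.dist a v : ℝ) / T.graph.dist a b

omit hF [IsMulTorsionFree F] in
theorem ratio_mem {a b v : T.V} (hv : v ∈ T.graph.seg a b) :
    ratio T a b v ∈ unitInterval := by
  refine ⟨by unfold ratio; positivity, div_le_one_of_le₀ ?_ (by positivity)⟩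
  rw [SimpleGraph.mem_seg] at hv
  exact_mod_cast (by omega : T.graph.dist a v ≤ T.graph.dist a b)

omit hF [IsMulTorsionFree F] in
theorem ratio_symm {a b v : T.V} (hab : a ≠ b) (hv : v ∈ T.graph.seg a b) :
    ratio T b a v = 1 - ratio T a b v := by
  have h0 : (T.graph.dist a b : ℝ) ≠ 0 := by
    exact_mod_cast (T.connected.pos_dist_of_ne hab).ne'
  rw [SimpleGraph.mem_seg] at hv
  have h1 : (T.graph.dist a v : ℝ) + T.graph.dist v b = T.graph.dist a b := by exact_mod_cast hv
  unfold ratio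
  rw [T.graph.dist_comm (u := b) (v := a), T.graph.dist_comm (u := b) (v := v)]
  field_simp
  linarith

omit hF in
-- A vertex v that is not natural has only two directions, and a cell through v leaves along both.
-- Two cells through v therefore share an edge, and `IsCell.unique` applies up to reversal.
theorem IsCell.eq_of_mem_seg {a b a' b' v : T.V} (h : T.IsCell a b) (h' : T.IsCell a' b')
    (hv : v ∈ T.graph.seg a b) (hv' : v ∈ T.graph.seg a' b') (hn : ¬ T.IsNaturalVertex v) :
    (a = a' ∧ b = b') ∨ (a = b' ∧ b = a') := by
  have hstep : ∀ {a b : T.V}, T.IsCell a b → v ∈ T.graph.seg a b → ∃ c d,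
      c ≠ d ∧ T.graph.Adj v c ∧ T.graph.Adj v d ∧ a ∈ T.graph.half v c ∧ b ∈ T.graph.half v d := by
    intro a b h hv
    have hva : a ≠ v := by
      rintro rfl
      exact hn h.left
    have hvb : b ≠ v := by
      rintro rfl
      exact hn h.right
    obtain ⟨c, hc, hac⟩ := T.isTree.exists_branch hva
    obtain ⟨d, hd, hbd⟩ := T.isTree.exists_branch hvb
    refine ⟨c, d, ?_, hc, hd, hac, hbd⟩
    rintro rfl
    exact IsTree.left_not_mem_half _ _ (T.isTree.segConvex_half hc a hac b hbd hv)
  obtain ⟨c, d, hcd, hc, hd, hac, hbd⟩ := hstep h hv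
  obtain ⟨c', d', hcd', hc', hd', hac', hbd'⟩ := hstep h' hv'
  have honly : ∀ x, T.graph.Adj v x → x = c ∨ x = d := by
    intro x hx
    by_contra! hne
    exact hn (T.isNaturalVertex_of_adj hc hd hx hcd hne.1.symm hne.2.symm)
  have hda := T.isTree.half_subset_of_branch hd hc hcd.symm hac
  rcases honly c' hc' with rfl | rfl <;> rcases honly d' hd' with rfl | rfl
  · exact absurd rfl hcd'
  · exact Or.inl (h.unique h' hd hda hbd (T.isTree.half_subset_of_branch hd hc' hcd'.symm hac') hbd')
  · exact Or.inr (h.unique h'.symm hd hda hbd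
      (T.isTree.half_subset_of_branch hc' hd' hcd' hbd') hac')
  · exact absurd rfl hcd'

/-- The barycentric coordinates of a vertex in the graph of natural vertices. -/
noncomputable def natCoord (v : T.V) : {v : T.V // T.IsNaturalVertex v} → ℝ :=
  let h := (exists_cell_between hF v).choose_spec.choose_spec.choose_spec
  edgePoint ⟨_, h.1.left⟩ ⟨_, h.1.right⟩ ⟨_, ratio_mem h.2.mem_seg.1⟩

omit hF in
-- The coordinates do not depend on the chosen cell: at a natural vertex every cell gives the
-- indicator of that vertex, and elsewhere the cell is unique up to reversal.
theorem edgePoint_ratio_eq {a b a' b' v : T.V} (h : T.IsCell a b) (h' : T.IsCell a' b')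
    (hv : v ∈ T.graph.seg a b) (hv' : v ∈ T.graph.seg a' b') :
    (edgePoint ⟨a, h.left⟩ ⟨b, h.right⟩ ⟨_, ratio_mem hv⟩ : {v // T.IsNaturalVertex v} → ℝ) =
      edgePoint ⟨a', h'.left⟩ ⟨b', h'.right⟩ ⟨_, ratio_mem hv'⟩ := by
  classical
  by_cases hn : T.IsNaturalVertex v
  · have key : ∀ {a b : T.V} (h : T.IsCell a b) (hv : v ∈ T.graph.seg a b),
        (edgePoint ⟨a, h.left⟩ ⟨b, h.right⟩ ⟨_, ratio_mem hv⟩ :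
          {v // T.IsNaturalVertex v} → ℝ) = fun x => if x = ⟨v, hn⟩ then 1 else 0 := by
      intro a b h hv
      have h0 : (T.graph.dist a b : ℝ) ≠ 0 := by
        exact_mod_cast (T.connected.pos_dist_of_ne h.ne).ne'
      funext x
      rcases h.eq_or_eq v hv hn with rfl | rfl
      · simp [edgePoint, ratio]
      · simp [edgePoint, ratio, h0]
    rw [key h hv, key h' hv']
  · rcases h.eq_of_mem_seg h' hv hv' hn with ⟨rfl, rfl⟩ | ⟨rfl, rfl⟩
    · rfl
    · funext x
      simp only [edgePoint, ratio_symm h.ne hv]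
      ring

theorem natCoord_eq {a b v : T.V} (h : T.IsCell a b) (hv : v ∈ T.graph.seg a b) :
    natCoord hF v = edgePoint ⟨a, h.left⟩ ⟨b, h.right⟩ ⟨_, ratio_mem hv⟩ :=
  let c := (exists_cell_between hF v).choose_spec.choose_spec.choose_spec
  edgePoint_ratio_eq c.1 h c.2.mem_seg.1 hv

omit hF [IsMulTorsionFree F] in
/-- The position of a point of the edge `pq` on the segment from `a` to `b`. -/
noncomputable def position {a b p q : T.V} (h : T.Between a b p q) (t : unitInterval) :
    unitInterval :=
  ⟨((T.graph.dist a p : ℝ) + t) / T.graph.dist a b, by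
    have := t.2.1
    positivity, by
    refine div_le_one_of_le₀ ?_ (by positivity)
    have h1 : (T.graph.dist a p : ℝ) + 1 ≤ T.graph.dist a b := by exact_mod_cast h.dist_lt
    have := t.2.2
    linarith⟩

omit hF [IsMulTorsionFree F] in
theorem continuous_position {a b p q : T.V} (h : T.Between a b p q) :
    Continuous (position h) := by
  unfold position
  fun_prop

omit hF [IsMulTorsionFree F] in
theorem exists_position_eq {a b : T.V} (hab : a ≠ b) (s : unitInterval) :
    ∃ (p q : T.V) (h : T.Between a b p q) (t : unitInterval), position h t = s := by
  have hpos := T.connected.pos_dist_of_ne hab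
  set m := T.graph.dist a b with hm
  have h0 : (0 : ℝ) < m := by exact_mod_cast hpos
  by_cases hs : (s : ℝ) * m < m
  · have hnn : 0 ≤ (s : ℝ) * m := mul_nonneg s.2.1 h0.le
    obtain ⟨p, q, h, hd⟩ := exists_between (T := T) (a := a) (b := b) (n := ⌊(s : ℝ) * m⌋₊)
      ((Nat.floor_lt hnn).2 hs)
    refine ⟨p, q, h, ⟨(s : ℝ) * m - ⌊(s : ℝ) * m⌋₊, sub_nonneg.2 (Nat.floor_le hnn), ?_⟩, ?_⟩
    · have := Nat.lt_floor_add_one ((s : ℝ) * m)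
      linarith
    · ext
      simp only [position, hd, ← hm]
      field_simp
      ring
  -- At s = 1 the floor would point past the last edge, so the end of the last edge is used.
  · obtain ⟨p, q, h, hd⟩ := exists_between (T := T) (a := a) (b := b) (n := m - 1) (by omega)
    refine ⟨p, q, h, 1, ?_⟩
    ext
    have hs1 : (s : ℝ) = 1 := by
      have := s.2.2
      by_contra hne
      exact hs (mul_lt_of_lt_one_left h0 (lt_of_le_of_ne this hne))
    simp only [position, hd, ← hm, Set.Icc.coe_one, hs1]
    rw [Nat.cast_sub hpos]
    field_simp
    simp

theorem affine_natCoord {a b p q : T.V} (hab : T.IsCell a b) (h : T.Between a b p q)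
    (t : unitInterval) :
    (fun u => affineExt (fun v => natCoord hF v u) (cellMap (Or.inr h.adj) t : T.Space)) =
      edgePoint ⟨a, hab.left⟩ ⟨b, hab.right⟩ (position h t) := by
  have h0 : (T.graph.dist a b : ℝ) ≠ 0 := by
    exact_mod_cast (T.connected.pos_dist_of_ne hab.ne).ne'
  funext u
  rw [affineExt_cellMap, natCoord_eq hF hab h.mem_seg.1, natCoord_eq hF hab h.mem_seg.2]
  simp only [edgePoint, position, ratio, h.dist_eq]
  push_cast
  field_simp
  ring

omit hF [IsMulTorsionFree F] in
theorem exists_cellMap_adj (x : T.Space) : ∃ (p q : T.V) (h : T.graph.Adj p q) (t : unitInterval),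
    x = cellMap (Or.inr h) t := by
  rcases x.eq_vertex_or with ⟨v, rfl⟩ | ⟨a, b, h, t, -, -, rfl⟩
  · obtain ⟨q, -, hq, -, -⟩ := T.exists_two_adj v
    exact ⟨v, q, hq, 0, (cellMap_zero _).symm⟩
  · exact ⟨a, b, h, t, rfl⟩

theorem exists_cellMap_between (x : T.Space) : ∃ (a b p q : T.V) (_ : T.IsCell a b)
    (h : T.Between a b p q) (t : unitInterval), x = cellMap (Or.inr h.adj) t := by
  obtain ⟨p, q, hpq, t, rfl⟩ := exists_cellMap_adj x
  obtain ⟨a, b, hab, ha, hb⟩ := T.exists_isCell hF hpq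
  exact ⟨a, b, p, q, hab, ⟨hpq, ha, hb⟩, t, rfl⟩

/-- The map from the tree to the realization of the graph of natural vertices. -/
noncomputable def natMap (x : T.Space) : GraphRealization T.natGraph :=
  ⟨fun u => affineExt (fun v => natCoord hF v u) x, by
    obtain ⟨a, b, p, q, hab, h, t, rfl⟩ := exists_cellMap_between hF x
    exact ⟨⟨a, hab.left⟩, ⟨b, hab.right⟩, Or.inr hab, position h t, affine_natCoord hF hab h t⟩⟩

theorem natMap_cellMap {a b p q : T.V} (hab : T.IsCell a b) (h : T.Between a b p q)
    (t : unitInterval) : natMap hF (cellMap (Or.inr h.adj) t) =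
      cellMap (G := T.natGraph) (a := ⟨a, hab.left⟩) (b := ⟨b, hab.right⟩) (Or.inr hab)
        (position h t) :=
  GraphRealization.ext (affine_natCoord hF hab h t)

theorem continuous_natMap : Continuous (natMap hF : T.Space → GraphRealization T.natGraph) := by
  rw [GraphRealization.continuous_iff]
  rintro p q (rfl | hpq)
  · simp only [cellMap_self]
    exact continuous_const
  · obtain ⟨a, b, hab, ha, hb⟩ := T.exists_isCell hF hpq
    have h : T.Between a b p q := ⟨hpq, ha, hb⟩
    have := fun t => natMap_cellMap hF hab h t
    simp only [this]
    exact (continuous_cellMap _).comp (continuous_position h)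

theorem exists_natCell (y : GraphRealization T.natGraph) : ∃ (a b : T.V) (hab : T.IsCell a b)
    (s : unitInterval), y = cellMap (G := T.natGraph) (a := ⟨a, hab.left⟩) (b := ⟨b, hab.right⟩)
      (Or.inr hab) s := by
  rcases y.eq_vertex_or with ⟨⟨v, hv⟩, rfl⟩ | ⟨⟨a, ha⟩, ⟨b, hb⟩, h, t, -, -, rfl⟩
  · obtain ⟨a, b, q, hab, h⟩ := exists_cell_between hF v
    rcases hab.eq_or_eq v h.mem_seg.1 hv with rfl | rfl
    · exact ⟨v, b, hab, 0, (cellMap_zero _).symm⟩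
    · exact absurd h.right (IsTree.left_not_mem_half _ _)
  · exact ⟨a, b, h, t, rfl⟩

theorem natMap_surjective :
    Function.Surjective (natMap hF : T.Space → GraphRealization T.natGraph) := by
  intro y
  obtain ⟨a, b, hab, s, rfl⟩ := exists_natCell hF y
  obtain ⟨p, q, h, t, rfl⟩ := exists_position_eq hab.ne s
  exact ⟨_, natMap_cellMap hF hab h t⟩

omit hF [IsMulTorsionFree F] in
theorem cellMap_eq_of_position_eq {a b p q p' q' : T.V} (hab : a ≠ b) (h : T.Between a b p q)
    (h' : T.Between a b p' q') {t t' : unitInterval}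
    (he : (position h t : ℝ) = position h' t') :
    (cellMap (Or.inr h.adj) t : T.Space) = cellMap (Or.inr h'.adj) t' := by
  have h0 : (T.graph.dist a b : ℝ) ≠ 0 := by
    exact_mod_cast (T.connected.pos_dist_of_ne hab).ne'
  have he' : (T.graph.dist a p : ℝ) + t = T.graph.dist a p' + t' := by
    simp only [position] at he
    field_simp at he
    exact he
  have key : ∀ {p q p' q' : T.V} (h : T.Between a b p q) (h' : T.Between a b p' q')
      {t t' : unitInterval}, (T.graph.dist a p : ℝ) + t = T.graph.dist a p' + t' →
      T.graph.dist a p < T.graph.dist a p' →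
      (cellMap (Or.inr h.adj) t : T.Space) = cellMap (Or.inr h'.adj) t' := by
    intro p q p' q' h h' t t' he hlt
    have h1 : (T.graph.dist a p : ℝ) + 1 ≤ T.graph.dist a p' := by exact_mod_cast hlt
    have ht := t.2.2
    have ht' := t'.2.1
    have e1 : t = 1 := by
      ext
      rw [Set.Icc.coe_one]
      linarith
    have e2 : t' = 0 := by
      ext
      rw [Set.Icc.coe_zero]
      linarith
    have e3 : q = p' := by
      refine T.isTree.eq_of_mem_seg h.mem_seg.2 h'.mem_seg.1 ?_
      rw [h.dist_eq]
      rw [e1, e2, Set.Icc.coe_one, Set.Icc.coe_zero, add_zero] at he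
      exact_mod_cast he
    rw [e1, e2, cellMap_one, cellMap_zero, e3]
  rcases lt_trichotomy (T.graph.dist a p) (T.graph.dist a p') with hlt | heq | hlt
  · exact key h h' he' hlt
  · have e1 : p = p' := T.isTree.eq_of_mem_seg h.mem_seg.1 h'.mem_seg.1 heq
    have e2 : q = q' := by
      refine T.isTree.eq_of_mem_seg h.mem_seg.2 h'.mem_seg.2 ?_
      rw [h.dist_eq, h'.dist_eq, heq]
    subst e1 e2
    have : t = t' := by
      ext
      linarith
    rw [this]
  · exact (key h' h he'.symm hlt).symm

omit hF [IsMulTorsionFree F] in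
theorem position_symm {a b p q : T.V} (hab : a ≠ b) (h : T.Between a b p q) (t : unitInterval) :
    (position h.symm (unitInterval.symm t) : ℝ) = 1 - position h t := by
  have h0 : (T.graph.dist a b : ℝ) ≠ 0 := by
    exact_mod_cast (T.connected.pos_dist_of_ne hab).ne'
  have h1 := h.mem_seg.2
  have h2 := h.dist_eq
  rw [SimpleGraph.mem_seg] at h1
  have h3 : (T.graph.dist a p : ℝ) + 1 + T.graph.dist q b = T.graph.dist a b := by
    exact_mod_cast (by omega : T.graph.dist a p + 1 + T.graph.dist q b = T.graph.dist a b)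
  simp only [position, unitInterval.coe_symm_eq, T.graph.dist_comm (u := b)]
  field_simp
  linarith

omit hF [IsMulTorsionFree F] in
theorem cellMap_eq_vertex_left {a b p q : T.V} (hab : a ≠ b) (h : T.Between a b p q)
    {t : unitInterval} (he : (position h t : ℝ) = 0) :
    (cellMap (Or.inr h.adj) t : T.Space) = vertex T.graph a := by
  obtain ⟨c, hac, hc⟩ := T.connected.exists_step hab
  have h' : T.Between a b a c :=
    ⟨hac, T.isTree.right_mem_half hac.symm, (T.isTree.mem_half_iff_seg hac).2 hc⟩
  rw [cellMap_eq_of_position_eq hab h h' (t' := 0) (by rw [he]; simp [position]), cellMap_zero]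

omit hF [IsMulTorsionFree F] in
theorem cellMap_eq_vertex_right {a b p q : T.V} (hab : a ≠ b) (h : T.Between a b p q)
    {t : unitInterval} (he : (position h t : ℝ) = 1) :
    (cellMap (Or.inr h.adj) t : T.Space) = vertex T.graph b := by
  rw [← cellMap_symm (Or.inr h.adj) (Or.inr h.adj.symm)]
  exact cellMap_eq_vertex_left hab.symm h.symm (by rw [position_symm hab h, he, sub_self])

theorem natMap_injective :
    Function.Injective (natMap hF : T.Space → GraphRealization T.natGraph) := by
  intro x x' he
  obtain ⟨a, b, p, q, hab, h, t, rfl⟩ := exists_cellMap_between hF x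
  obtain ⟨a', b', p', q', hab', h', t', rfl⟩ := exists_cellMap_between hF x'
  rw [natMap_cellMap hF hab h, natMap_cellMap hF hab' h'] at he
  have hvert : ∀ {a b p q : T.V} (hab : T.IsCell a b) (h : T.Between a b p q) (t : unitInterval)
      (c : {v // T.IsNaturalVertex v}), ((c = ⟨a, hab.left⟩ ∧ (position h t : ℝ) = 0) ∨
        (c = ⟨b, hab.right⟩ ∧ (position h t : ℝ) = 1)) →
      (cellMap (Or.inr h.adj) t : T.Space) = vertex T.graph c.1 := by
    rintro a b p q hab h t c (⟨rfl, e⟩ | ⟨rfl, e⟩)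
    · exact cellMap_eq_vertex_left hab.ne h e
    · exact cellMap_eq_vertex_right hab.ne h e
  rcases edgePoint_eq_cases (fun e => hab.ne (congrArg Subtype.val e))
    (fun e => hab'.ne (congrArg Subtype.val e)) (congrArg coord he) with
    ⟨e1, e2, e3⟩ | ⟨e1, e2, e3⟩ | ⟨c, hc, hc'⟩
  · obtain rfl := congrArg Subtype.val e1
    obtain rfl := congrArg Subtype.val e2
    exact cellMap_eq_of_position_eq hab.ne h h' e3
  · obtain rfl := congrArg Subtype.val e1
    obtain rfl := congrArg Subtype.val e2
    rw [← cellMap_symm (Or.inr h'.adj) (Or.inr h'.adj.symm)]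
    refine cellMap_eq_of_position_eq hab.ne h h'.symm ?_
    rw [position_symm hab'.ne h', e3]
    ring
  · rw [hvert hab h t c hc, hvert hab' h' t' c hc']

/-- A natural edge consists of finitely many edges, so the preimage of a closed set in it is a
finite union of continuous images of compact sets. -/
theorem continuous_natMap_symm : Continuous
    (Equiv.ofBijective _ ⟨natMap_injective (T := T) hF, natMap_surjective hF⟩).symm := by
  set e := Equiv.ofBijective _ ⟨natMap_injective (T := T) hF, natMap_surjective hF⟩ with he
  rw [GraphRealization.continuous_iff]
  rintro a b (rfl | hab)
  · simp only [cellMap_self]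
    exact continuous_const
  obtain ⟨a, ha⟩ := a
  obtain ⟨b, hb⟩ := b
  have hab : T.IsCell a b := hab
  have hinv : ∀ {p q : T.V} (h : T.Between a b p q) (t : unitInterval),
      e.symm (cellMap (G := T.natGraph) (a := ⟨a, ha⟩) (b := ⟨b, hb⟩) (Or.inr hab)
        (position h t)) = cellMap (Or.inr h.adj) t := by
    intro p q h t
    rw [Equiv.symm_apply_eq]
    exact (natMap_cellMap hF hab h t).symm
  rw [continuous_iff_isClosed]
  intro Z hZ
  have hfin : {x : T.V × T.V | T.Between a b x.1 x.2}.Finite :=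
    ((T.finite_seg a b).prod (T.finite_seg a b)).subset fun x hx =>
      ⟨(Between.mem_seg hx).1, (Between.mem_seg hx).2⟩
  have : Finite {x : T.V × T.V // T.Between a b x.1 x.2} := hfin.to_subtype
  have hpre : (fun s => e.symm (cellMap (G := T.natGraph) (a := ⟨a, ha⟩) (b := ⟨b, hb⟩)
      (Or.inr hab) s)) ⁻¹' Z = ⋃ x : {x : T.V × T.V // T.Between a b x.1 x.2},
        position x.2 '' ((fun t => (cellMap (Or.inr x.2.adj) t : T.Space)) ⁻¹' Z) := by
    ext s
    rw [Set.mem_iUnion]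
    constructor
    · intro hs
      obtain ⟨p, q, h, t, rfl⟩ := exists_position_eq hab.ne s
      refine ⟨⟨(p, q), h⟩, t, ?_, rfl⟩
      rw [Set.mem_preimage, hinv] at hs
      exact hs
    · rintro ⟨⟨⟨p, q⟩, h⟩, t, ht, rfl⟩
      rw [Set.mem_preimage, hinv]
      exact ht
  rw [hpre]
  refine isClosed_iUnion_of_finite fun x => ?_
  exact ((hZ.preimage (continuous_cellMap _)).isCompact.image
    (continuous_position x.2)).isClosed

/-- The tree is homeomorphic to the realization of the graph of natural vertices. -/
noncomputable def natHomeomorph : T.Space ≃ₜ GraphRealization T.natGraph where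
  toEquiv := Equiv.ofBijective _ ⟨natMap_injective hF, natMap_surjective hF⟩
  continuous_toFun := continuous_natMap hF
  continuous_invFun := continuous_natMap_symm hF

theorem natHomeomorph_smul (g : F) (x : T.Space) (u : {v // T.IsNaturalVertex v}) :
    (natHomeomorph hF (g • x)).coord ⟨g • u.1, u.2.smul T g⟩ = (natHomeomorph hF x).coord u := by
  classical
  obtain ⟨a, b, p, q, hab, h, t, rfl⟩ := exists_cellMap_between hF x
  rw [smul_cellMap g (Or.inr h.adj) (Or.inr (T.smul_adj g h.adj))]
  change (natMap hF _).coord _ = (natMap hF _).coord _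
  rw [natMap_cellMap hF hab h, natMap_cellMap hF (hab.smul g) (h.smul g)]
  simp only [cellMap_coord, edgePoint, position, dist_smul, Subtype.ext_iff,
    smul_left_cancel_iff]

end Natural

/-! ### Rigidity -/

theorem wall_smul_eq {p q : S.V} {p' q' : T.V} (h : S.wall p q = T.wall p' q') (g : F) :
    S.wall (g • p) (g • q) = T.wall (g • p') (g • q') := by
  have h1 := congrArg Prod.fst h
  have h2 := congrArg Prod.snd h
  simp only [wall] at h1 h2
  simp only [wall, side_smul, h1, h2]

/-- Two vertices correspond if they lie on the same sides of edges with equal walls. -/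
def Corresponds (v : S.V) (v' : T.V) : Prop :=
  ∀ x y x' y', S.graph.Adj x y → T.graph.Adj x' y' → S.wall x y = T.wall x' y' →
    (v ∈ S.graph.half x y ↔ v' ∈ T.graph.half x' y')

theorem Corresponds.symm {v : S.V} {v' : T.V} (h : Corresponds v v') : Corresponds v' v :=
  fun x y x' y' hxy hxy' he => (h x' y' x y hxy' hxy he.symm).symm

theorem Corresponds.smul {v : S.V} {v' : T.V} (h : Corresponds v v') (g : F) :
    Corresponds (g • v) (g • v') := by
  intro x y x' y' hxy hxy' he
  rw [S.smul_mem_half', T.smul_mem_half']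
  exact h _ _ _ _ (S.smul_adj _ hxy) (T.smul_adj _ hxy') (wall_smul_eq he _)

theorem Corresponds.unique (hST : T.classes ⊆ S.classes) {v : S.V} {v' w' : T.V}
    (h : Corresponds v v') (h' : Corresponds v w') : v' = w' := by
  by_contra hne
  obtain ⟨x', y', hxy', h1, h2⟩ := T.isTree.exists_separating_edge hne
  obtain ⟨x, y, hxy, he⟩ := T.exists_wall_eq hST hxy'
  have := (h x y x' y' hxy hxy' he.symm).1 ((h' x y x' y' hxy hxy' he.symm).2 h2)
  exact (T.isTree.not_mem_half hxy').2 h1 this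

/-- The heart of rigidity. Three directions at v give g, k, l whose characteristic sets in S meet
exactly in v. Disjointness is expressed by walls, so their characteristic sets in T meet pairwise;
Helly's theorem gives v'. -/
theorem exists_corresponds [IsMulTorsionFree F] (hST : S.classes = T.classes) {v : S.V}
    (hv : S.IsNaturalVertex v) : ∃ v', T.IsNaturalVertex v' ∧ Corresponds v v' := by
  obtain ⟨b₁, -, hb₁, -, -⟩ := S.exists_two_adj v
  obtain ⟨b₂, b₃, hb₂, hb₃, h21, h31, h23⟩ := hv.exists_adj S b₁
  obtain ⟨g, hg, hvg, hg'⟩ := S.exists_charSet_turn hb₁ hb₂ h21.symm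
  obtain ⟨k, hk, hvk, hk'⟩ := S.exists_charSet_turn hb₁ hb₃ h31.symm
  obtain ⟨l, hl, hvl, hl'⟩ := S.exists_charSet_turn hb₂ hb₃ h23
  have honly : ∀ z, z ∈ S.charSet g → z ∈ S.charSet k → z ∈ S.charSet l → z = v := by
    intro z h1 h2 h3
    have hd : ∀ {b c : S.V}, S.graph.Adj v b → S.graph.Adj v c → b ≠ c → z ∈ S.graph.half v b →
        z ∉ S.graph.half v c := fun hb hc hbc h h' => hbc (S.isTree.branch_unique hb hc h h')
    rcases hg' z h1 with h | h | h
    · exact h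
    · rcases hl' z h3 with h' | h' | h'
      · exact h'
      · exact absurd h' (hd hb₁ hb₂ h21.symm h)
      · exact absurd h' (hd hb₁ hb₃ h31.symm h)
    · rcases hk' z h2 with h' | h' | h'
      · exact h'
      · exact absurd h' (hd hb₂ hb₁ h21 h)
      · exact absurd h' (hd hb₂ hb₃ h23 h)
  have hmeet : ∀ {g k : F}, g ≠ 1 → k ≠ 1 → v ∈ S.charSet g → v ∈ S.charSet k →
      (T.charSet g ∩ T.charSet k).Nonempty := by
    intro g k hg hk hvg hvk
    rw [← Set.not_disjoint_iff_nonempty_inter, T.disjoint_charSet_iff hg hk]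
    rintro ⟨p', q', hpq', h1, h2⟩
    obtain ⟨p, q, hpq, he⟩ := T.exists_wall_eq hST.ge hpq'
    have e1 : T.side q' p' = S.side q p := congrArg Prod.fst he
    have e2 : T.side p' q' = S.side p q := congrArg Prod.snd he
    rw [e1] at h1
    rw [e2] at h2
    exact Set.disjoint_left.1 ((S.disjoint_charSet_iff hg hk).2 ⟨p, q, hpq, h1, h2⟩) hvg hvk
  obtain ⟨v', ⟨hvg', hvk'⟩, hvl'⟩ := T.isTree.helly (T.invConvex_charSet hg).convex
    (T.invConvex_charSet hk).convex (T.invConvex_charSet hl).convex (hmeet hg hk hvg hvk)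
    (hmeet hk hl hvk hvl) (hmeet hg hl hvg hvl)
  -- If v' were on the wrong side, none of the three characteristic sets in S would be contained in
  -- the half-tree of v beyond xy. Each would cross this edge and contain x, so x = v, although v
  -- lies beyond x.
  have key : ∀ x y x' y', S.graph.Adj x y → T.graph.Adj x' y' → S.wall x y = T.wall x' y' →
      v ∈ S.graph.half x y → v' ∈ T.graph.half x' y' := by
    intro x y x' y' hxy hxy' he hvx
    by_contra hn
    have e2 : S.side x y = T.side x' y' := congrArg Prod.snd he
    have hx : ∀ {g : F}, g ≠ 1 → v ∈ S.charSet g → v' ∈ T.charSet g → x ∈ S.charSet g := by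
      intro g hg hvg hvg'
      have hnot : ¬ S.charSet g ⊆ S.graph.half x y := by
        intro hsub
        have : g ∈ T.side x' y' := e2 ▸ ⟨hg, hsub⟩
        exact hn (this.2 hvg')
      obtain ⟨z, hz, hzx⟩ := Set.not_subset.1 hnot
      rw [S.isTree.not_mem_half hxy] at hzx
      exact (S.invConvex_charSet hg).convex z hz v hvg (S.isTree.mem_seg_of_half hxy hzx hvx).1
    have := honly x (hx hg hvg hvg') (hx hk hvk hvk') (hx hl hvl hvl')
    rw [← this] at hvx
    exact IsTree.left_not_mem_half _ _ hvx
  have hcorr : Corresponds v v' := by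
    intro x y x' y' hxy hxy' he
    refine ⟨key x y x' y' hxy hxy' he, fun h => ?_⟩
    by_contra hn
    rw [S.isTree.not_mem_half hxy] at hn
    exact (T.isTree.not_mem_half hxy').2
      (key y x y' x' hxy.symm hxy'.symm (S.wall_swap he) hn) h
  refine ⟨v', ?_, hcorr⟩
  -- If v' had valence two, both of its edges would have the same wall as some edge xy of S. Then v'
  -- would have to lie on the far side of its own edge v'c'.
  by_contra hn
  obtain ⟨b', c', hb', hc', hbc'⟩ := T.exists_two_adj v'
  have hw := T.wall_eq_of_not_natural hb' hc' hbc' hn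
  obtain ⟨x, y, hxy, he⟩ := T.exists_wall_eq hST.ge hb'.symm
  have h1 := (hcorr x y b' v' hxy hb'.symm he.symm).2 (T.isTree.right_mem_half hb'.symm)
  exact IsTree.left_not_mem_half _ _ ((hcorr x y v' c' hxy hc' (he.symm.trans hw)).1 h1)

/-- Segments are cut out by half-trees, so a natural vertex between a' and b' corresponds to a
natural vertex between a and b, which is one of the endpoints. -/
theorem IsCell.of_corresponds [IsMulTorsionFree F] (hST : S.classes = T.classes) {a b : S.V}
    {a' b' : T.V} (h : S.IsCell a b) (ha : Corresponds a a') (hb : Corresponds b b')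
    (ha' : T.IsNaturalVertex a') (hb' : T.IsNaturalVertex b') : T.IsCell a' b' := by
  refine ⟨?_, ha', hb', fun v' hv' hn => ?_⟩
  · rintro rfl
    exact h.ne (Corresponds.unique hST.le ha.symm hb.symm)
  · obtain ⟨v, hv, hvv⟩ := exists_corresponds hST.symm hn
    have hmem : v ∈ S.graph.seg a b := by
      rw [S.isTree.mem_seg_iff_half]
      intro p q hpq hap hbp
      obtain ⟨p', q', hpq', he⟩ := S.exists_wall_eq hST.le hpq
      rw [hvv.symm p q p' q' hpq hpq' he]
      exact T.isTree.segConvex_half hpq' _ ((ha p q p' q' hpq hpq' he).1 hap) _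
        ((hb p q p' q' hpq hpq' he).1 hbp) hv'
    rcases h.eq_or_eq v hmem hv with rfl | rfl
    · exact Or.inl (Corresponds.unique hST.ge hvv.symm ha)
    · exact Or.inr (Corresponds.unique hST.ge hvv.symm hb)

/-- A free splitting is determined up to conjugacy by its wall classes. -/
theorem conjugate_of_classes_eq [IsMulTorsionFree F] (hF : ∃ g h : F, g * h ≠ h * g)
    (hST : S.classes = T.classes) : S.Conjugate T := by
  have h1 : ∀ v : {v // S.IsNaturalVertex v}, ∃ v' : {v // T.IsNaturalVertex v},
      Corresponds v.1 v'.1 := by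
    rintro ⟨v, hv⟩
    obtain ⟨v', hv', h⟩ := exists_corresponds hST hv
    exact ⟨⟨v', hv'⟩, h⟩
  have h2 : ∀ v : {v // T.IsNaturalVertex v}, ∃ v' : {v // S.IsNaturalVertex v},
      Corresponds v.1 v'.1 := by
    rintro ⟨v, hv⟩
    obtain ⟨v', hv', h⟩ := exists_corresponds hST.symm hv
    exact ⟨⟨v', hv'⟩, h⟩
  choose f hf using h1
  choose f' hf' using h2
  let e : S.natGraph ≃g T.natGraph :=
    { toFun := f
      invFun := f'
      left_inv := fun v => Subtype.ext (Corresponds.unique hST.le (hf' (f v)) (hf v).symm)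
      right_inv := fun v => Subtype.ext (Corresponds.unique hST.ge (hf (f' v)) (hf' v).symm)
      map_rel_iff' := fun {a b} => ⟨fun h => h.of_corresponds hST.symm (hf a).symm (hf b).symm
        a.2 b.2, fun h => h.of_corresponds hST (hf a) (hf b) (f a).2 (f b).2⟩ }
  refine ⟨((natHomeomorph hF).trans (mapHomeomorph e)).trans (natHomeomorph hF).symm,
    fun g x => ?_⟩
  simp only [Homeomorph.trans_apply]
  rw [Homeomorph.symm_apply_eq]
  ext u
  obtain ⟨u, rfl⟩ : ∃ u₀ : {v // T.IsNaturalVertex v}, u = ⟨g • u₀.1, u₀.2.smul T g⟩ :=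
    ⟨⟨g⁻¹ • u.1, u.2.smul T g⁻¹⟩, Subtype.ext (smul_inv_smul g u.1).symm⟩
  rw [natHomeomorph_smul, Homeomorph.apply_symm_apply]
  obtain ⟨v, rfl⟩ := e.surjective u
  have hev : e ⟨g • v.1, v.2.smul S g⟩ = ⟨g • (e v).1, (e v).2.smul T g⟩ :=
    Subtype.ext (Corresponds.unique hST.ge (hf _) ((hf v).smul g))
  rw [← hev, mapHomeomorph_coord, mapHomeomorph_coord, natHomeomorph_smul]

end FreeSplitting

namespace FreeSplitting

variable {F : Type u} [Group F] {T U : FreeSplitting.{u, w} F}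

/-! ### Free splittings and their sets of wall classes -/

theorem classes_nonempty (T : FreeSplitting.{u, w} F) : T.classes.Nonempty := by
  have := T.nontrivial
  obtain ⟨v⟩ := T.isTree.connected.nonempty
  obtain ⟨q, hq⟩ := T.isTree.connected.preconnected.exists_adj_of_nontrivial v
  exact ⟨_, v, q, hq, rfl⟩

theorem IsCollapseAlong.classes_eq {σ : Set (Sym2 T.V)} (h : T.IsCollapseAlong σ U) :
    U.classes = {c | ∃ p q, T.graph.Adj p q ∧ s(p, q) ∉ σ ∧ T.wallClass p q = c} := by
  obtain ⟨f, hf, rfl⟩ := h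
  exact hf.classes_eq

theorem conjClass_eq_iff : T.conjClass = U.conjClass ↔ T.Conjugate U :=
  Quotient.eq (r := conjugacySetoid F)

section

variable [IsMulTorsionFree F] (hF : ∃ g h : F, g * h ≠ h * g)
include hF

theorem IsNaturalSubgraph.exists_isCollapseAlong {σ : Set (Sym2 T.V)} (hσ : T.IsNaturalSubgraph σ)
    (hne : σ ≠ T.graph.edgeSet) : ∃ U : FreeSplitting.{u, w} F, T.IsCollapseAlong σ U :=
  T.exists_isCollapseAlong hσ.1 (hσ.subset_edgeSet hF) hne

/-- Collapsing the edges whose class is outside X leaves exactly the classes in X. Consequently the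
class sets of free splittings are closed under passage to nonempty subsets, as the faces of a
simplicial complex must be. -/
theorem exists_classes_eq {X : Set (WallClass F)} (hX : X ⊆ T.classes) (hne : X.Nonempty) :
    ∃ U : FreeSplitting.{u, w} F, T.IsCollapseAlong (T.classSubgraph X) U ∧ U.classes = X := by
  have hadj : ∀ c ∈ X, ∃ p q, T.graph.Adj p q ∧ s(p, q) ∉ T.classSubgraph X ∧
      T.wallClass p q = c := by
    intro c hc
    obtain ⟨p, q, hpq, rfl⟩ := hX hc
    exact ⟨p, q, hpq, fun h => (T.mem_classSubgraph.1 h).2 hc, rfl⟩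
  obtain ⟨U, hU⟩ := (T.isNaturalSubgraph_classSubgraph hF X).exists_isCollapseAlong hF (by
    intro he
    obtain ⟨c, hc⟩ := hne
    obtain ⟨p, q, hpq, h, -⟩ := hadj c hc
    exact h (he ▸ hpq))
  refine ⟨U, hU, hU.classes_eq.trans (Set.Subset.antisymm ?_ hadj)⟩
  rintro c ⟨p, q, hpq, h, rfl⟩
  by_contra hc
  exact h (T.mem_classSubgraph.2 ⟨hpq, hc⟩)

theorem IsCollapseAlong.eq_iff_conjugate {σ₁ σ₂ : Set (Sym2 T.V)} {U₁ U₂ : FreeSplitting.{u, w} F}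
    (hσ₁ : T.IsNaturalSubgraph σ₁) (hσ₂ : T.IsNaturalSubgraph σ₂)
    (h₁ : T.IsCollapseAlong σ₁ U₁) (h₂ : T.IsCollapseAlong σ₂ U₂) :
    σ₁ = σ₂ ↔ U₁.Conjugate U₂ := by
  constructor
  · rintro rfl
    exact conjugate_of_classes_eq hF (h₁.classes_eq.trans h₂.classes_eq.symm)
  · intro h
    have key : ∀ {σ₁ σ₂ : Set (Sym2 T.V)} {U₁ U₂ : FreeSplitting.{u, w} F},
        T.IsNaturalSubgraph σ₁ → T.IsNaturalSubgraph σ₂ → T.IsCollapseAlong σ₁ U₁ →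
        T.IsCollapseAlong σ₂ U₂ → U₁.Conjugate U₂ → σ₁ ⊆ σ₂ := by
      intro σ₁ σ₂ U₁ U₂ hσ₁ hσ₂ h₁ h₂ h e he
      induction e using Sym2.ind with
      | _ p q =>
        have hpq : T.graph.Adj p q := hσ₁.subset_edgeSet hF he
        by_contra he'
        have hc : T.wallClass p q ∈ U₂.classes := by
          rw [h₂.classes_eq]
          exact ⟨p, q, hpq, he', rfl⟩
        rw [← h.classes_eq, h₁.classes_eq] at hc
        obtain ⟨p', q', hpq', hn, hc⟩ := hc
        exact hn (hσ₁.mem_of_wallClass_eq hF hpq' he hc.symm)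
    exact (key hσ₁ hσ₂ h₁ h₂ h).antisymm (key hσ₂ hσ₁ h₂ h₁ h.symm)

/-- Subdivisions do not matter because classes are conjugacy invariants. Conversely, T is collapsed
onto the classes of U, and rigidity identifies the result with U. -/
theorem collapsesTo_iff : T.CollapsesTo U ↔ U.classes ⊆ T.classes := by
  constructor
  · rintro ⟨T', U', hT, hU, f, hf⟩
    rw [← hT.classes_eq, ← hU.classes_eq]
    exact hf.classes_subset
  · intro h
    obtain ⟨U', ⟨f, hf, -⟩, hU'⟩ := exists_classes_eq hF h U.classes_nonempty
    exact ⟨T, U', Conjugate.refl T, conjugate_of_classes_eq hF hU', f, hf⟩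

theorem mem_collapseClasses_iff {k : ℕ} :
    U.conjClass ∈ T.collapseClasses k ↔
      U.classes ⊆ T.classes ∧ U.numNaturalEdges = (k + 1 : ℕ) := by
  constructor
  · rintro ⟨σ, U', -, ⟨f, hf, -⟩, hk, h⟩
    have h := (conjClass_eq_iff.1 h).classes_eq
    rw [numNaturalEdges_eq _ hF] at hk ⊢
    exact ⟨h ▸ hf.classes_subset, h ▸ hk⟩
  · rintro ⟨h, hk⟩
    obtain ⟨U', hU, hU'⟩ := exists_classes_eq hF h U.classes_nonempty
    refine ⟨_, U', T.isNaturalSubgraph_classSubgraph hF _, hU, ?_,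
      conjClass_eq_iff.2 (conjugate_of_classes_eq hF hU')⟩
    rw [numNaturalEdges_eq _ hF] at hk ⊢
    rw [hU', hk]

/-- One-edge collapses of T correspond to the single elements of `T.classes`, so they determine this
set and thereby T. -/
theorem collapseClasses_zero_eq_iff :
    T.collapseClasses 0 = U.collapseClasses 0 ↔ T.Conjugate U := by
  constructor
  · intro h
    have key : ∀ {T U : FreeSplitting.{u, w} F}, T.collapseClasses 0 = U.collapseClasses 0 →
        T.classes ⊆ U.classes := by
      intro T U h c hc
      obtain ⟨A, -, hA⟩ :=
        exists_classes_eq hF (Set.singleton_subset_iff.2 hc) (Set.singleton_nonempty c)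
      have hmem : A.conjClass ∈ T.collapseClasses 0 :=
        (mem_collapseClasses_iff hF).2 ⟨hA ▸ Set.singleton_subset_iff.2 hc, by
          rw [A.numNaturalEdges_eq hF, hA]; simp⟩
      rw [h, mem_collapseClasses_iff hF, hA] at hmem
      exact hmem.1 rfl
    exact conjugate_of_classes_eq hF ((key h).antisymm (key h.symm))
  · intro h
    ext c
    induction c using Quotient.inductionOn with
    | _ A =>
      change A.conjClass ∈ _ ↔ A.conjClass ∈ _
      rw [mem_collapseClasses_iff hF, mem_collapseClasses_iff hF, h.classes_eq]

end

/-! ### The free splitting complex -/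

/-- The vertices of the free splitting complex: the wall classes that occur in free splittings. -/
def SplittingVertex (F : Type u) [Group F] : Type (max u (w + 1)) :=
  ULift.{w + 1, u} {c : WallClass F // ∃ T : FreeSplitting.{u, w} F, c ∈ T.classes}

/-- The wall class of a vertex of the free splitting complex. -/
def SplittingVertex.toClass (x : SplittingVertex.{u, w} F) : WallClass F := x.down.1

theorem SplittingVertex.toClass_injective :
    Function.Injective (toClass : SplittingVertex.{u, w} F → WallClass F) :=
  Subtype.val_injective.comp ULift.down_injective

theorem image_toClass_preimage (T : FreeSplitting.{u, w} F) :
    SplittingVertex.toClass '' (SplittingVertex.toClass.{u, w} ⁻¹' T.classes) = T.classes :=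
  Set.image_preimage_eq_of_subset fun c hc => ⟨⟨c, T, hc⟩, rfl⟩

section

variable [Group.FG F]

/-- The simplex of a free splitting. -/
noncomputable def simplex (T : FreeSplitting.{u, w} F) : Finset (SplittingVertex.{u, w} F) :=
  (T.finite_classes.preimage SplittingVertex.toClass_injective.injOn).toFinset

theorem mem_simplex {x : SplittingVertex.{u, w} F} : x ∈ T.simplex ↔ x.toClass ∈ T.classes :=
  Set.Finite.mem_toFinset _

theorem simplex_subset_iff : U.simplex ⊆ T.simplex ↔ U.classes ⊆ T.classes := by
  constructor
  · intro h c hc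
    exact mem_simplex.1 (h ((mem_simplex (x := ⟨c, U, hc⟩)).2 hc))
  · intro h x hx
    exact mem_simplex.2 (h (mem_simplex.1 hx))

theorem simplex_eq_iff : U.simplex = T.simplex ↔ U.classes = T.classes := by
  rw [Finset.Subset.antisymm_iff, Set.Subset.antisymm_iff, simplex_subset_iff, simplex_subset_iff]

theorem card_simplex (T : FreeSplitting.{u, w} F) :
    (T.simplex.card : ℕ∞) = ENat.card T.classes := by
  rw [← Set.encard_coe_eq_coe_finsetCard, ← SplittingVertex.toClass_injective.encard_image,
    simplex, Set.Finite.coe_toFinset, image_toClass_preimage]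
  rfl

theorem simplex_nonempty (T : FreeSplitting.{u, w} F) : T.simplex.Nonempty := by
  obtain ⟨c, hc⟩ := T.classes_nonempty
  exact ⟨⟨c, T, hc⟩, mem_simplex.2 hc⟩

variable [IsMulTorsionFree F] (hF : ∃ g h : F, g * h ≠ h * g)
include hF

theorem exists_simplex_eq {s : Finset (SplittingVertex.{u, w} F)} (hs : s.Nonempty)
    (hT : s ⊆ T.simplex) : ∃ U : FreeSplitting.{u, w} F, U.simplex = s := by
  obtain ⟨U, -, hU⟩ := exists_classes_eq hF (T := T) (X := SplittingVertex.toClass '' s) (by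
    rintro _ ⟨x, hx, rfl⟩
    exact mem_simplex.1 (hT hx)) (hs.to_set.image _)
  refine ⟨U, ?_⟩
  ext x
  rw [mem_simplex, hU, SplittingVertex.toClass_injective.mem_set_image, Finset.mem_coe]

/-- The free splitting complex. -/
def complex : AbstractSimplicialComplex (SplittingVertex.{u, w} F) where
  faces := Set.range simplex
  isRelLowerSet_faces := by
    rintro _ ⟨T, rfl⟩
    exact ⟨T.simplex_nonempty, fun s hs hne => exists_simplex_eq hF hne hs⟩
  singleton_mem := by
    intro x
    obtain ⟨T, hT⟩ := x.down.2
    exact exists_simplex_eq hF (T := T) (Finset.singleton_nonempty x)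
      (Finset.singleton_subset_iff.2 (mem_simplex.2 hT))

/-- Conjugacy classes of free splittings correspond to simplices of the free splitting complex. -/
noncomputable def conjClassEquiv : ConjClass.{u, w} F ≃ (complex.{u, w} hF).faces :=
  Equiv.ofBijective
    (Quotient.lift (fun T => ⟨T.simplex, T, rfl⟩) fun _ _ h =>
      Subtype.ext (simplex_eq_iff.2 (Conjugate.classes_eq h))) (by
    constructor
    · intro c d h
      induction c, d using Quotient.inductionOn₂ with
      | _ T U =>
        exact Quotient.sound (conjugate_of_classes_eq hF
          (simplex_eq_iff.1 (congrArg Subtype.val h)))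
    · rintro ⟨_, T, rfl⟩
      exact ⟨T.conjClass, rfl⟩)

theorem conjClassEquiv_conjClass (T : FreeSplitting.{u, w} F) :
    (conjClassEquiv hF T.conjClass).1 = T.simplex := rfl

end

end FreeSplitting

/-! ### Algebraic properties of free groups -/

namespace FreeGroupBasis

variable {ι : Type*} {G : Type*} [Group G] (b : FreeGroupBasis ι G)
include b

theorem isMulTorsionFree : IsMulTorsionFree G :=
  b.repr.injective.isMulTorsionFree b.repr.toMonoidHom

theorem group_fg [Finite ι] : Group.FG G :=
  Group.fg_of_surjective (f := b.repr.symm.toMonoidHom) b.repr.symm.surjective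

theorem mul_ne_mul {i j : ι} (hij : i ≠ j) : b i * b j ≠ b j * b i := by
  classical
  intro h
  -- The symmetric group on three letters separates the two products: the transpositions (0 1) and
  -- (1 2) do not commute.
  let f := b.lift fun k => if k = i then Equiv.swap (0 : Fin 3) 1 else Equiv.swap 1 2
  have hi : f (b i) = Equiv.swap (0 : Fin 3) 1 := by simp [f, lift]
  have hj : f (b j) = Equiv.swap (1 : Fin 3) 2 := by simp [f, lift, hij.symm]
  have h := congrArg f h
  rw [map_mul, map_mul, hi, hj] at h
  exact absurd h (by decide)

end FreeGroupBasis

/-! ### The main theorem -/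

theorem mainTheorem6 {F : Type u} [Group F] {n : ℕ} (hn : 2 ≤ n)
    (b : FreeGroupBasis (Fin n) F) :
    -- proper natural subgraphs can be collapsed
    (∀ (T : FreeSplitting.{u, w} F) (σ : Set (Sym2 T.V)),
      T.IsNaturalSubgraph σ → σ ≠ T.graph.edgeSet →
        ∃ U : FreeSplitting.{u, w} F, T.IsCollapseAlong σ U) ∧
    -- natural subgraphs are equal if and only if their collapses are conjugate
    (∀ (T : FreeSplitting.{u, w} F) (σ₁ σ₂ : Set (Sym2 T.V)) (U₁ U₂ : FreeSplitting.{u, w} F),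
      T.IsNaturalSubgraph σ₁ → T.IsNaturalSubgraph σ₂ →
      T.IsCollapseAlong σ₁ U₁ → T.IsCollapseAlong σ₂ U₂ →
        (σ₁ = σ₂ ↔ U₁.Conjugate U₂)) ∧
    -- the 1-edge collapses determine a free splitting up to conjugacy
    (∀ T T' : FreeSplitting.{u, w} F,
      T.collapseClasses 0 = T'.collapseClasses 0 ↔ T.Conjugate T') ∧
    -- existence of the free splitting complex
    (∃ (ι : Type (max u (w + 1))) (FS : AbstractSimplicialComplex ι)
      (φ : FreeSplitting.ConjClass.{u, w} F ≃ FS.faces),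
      (∀ (K : ℕ) (T : FreeSplitting.{u, w} F),
        (φ T.conjClass).1.card = K + 1 ↔ T.numNaturalEdges = (K + 1 : ℕ)) ∧
      (∀ T U : FreeSplitting.{u, w} F,
        (φ U.conjClass).1 ⊆ (φ T.conjClass).1 ↔ T.CollapsesTo U)) := by
  have := b.isMulTorsionFree
  have := b.group_fg
  have hF : ∃ g h : F, g * h ≠ h * g :=
    ⟨_, _, b.mul_ne_mul (i := ⟨0, by lia⟩) (j := ⟨1, by lia⟩) (by simp)⟩
  refine ⟨fun T σ hσ hne => hσ.exists_isCollapseAlong hF hne,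
    fun T σ₁ σ₂ U₁ U₂ hσ₁ hσ₂ h₁ h₂ => h₁.eq_iff_conjugate hF hσ₁ hσ₂ h₂,
    fun T T' => FreeSplitting.collapseClasses_zero_eq_iff hF,
    FreeSplitting.SplittingVertex.{u, w} F, FreeSplitting.complex hF,
    FreeSplitting.conjClassEquiv hF, fun K T => ?_, fun T U => ?_⟩
  · rw [FreeSplitting.conjClassEquiv_conjClass, T.numNaturalEdges_eq hF, ← T.card_simplex,
      Nat.cast_inj]
  · rw [FreeSplitting.conjClassEquiv_conjClass, FreeSplitting.conjClassEquiv_conjClass,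
      FreeSplitting.simplex_subset_iff, FreeSplitting.collapsesTo_iff hF]
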